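/- Let $H^*$ denote singular cohomology with integer coefficients. Let $m,n\ge 0$ and write points of $\mathbb{CP}^{m+n+1}$ as $[a:b]$ with $a\in\mathbb{C}^{m+1}$, $b\in\mathbb{C}^{n+1}$, $(a,b)\neq 0$; identify $\mathbb{CP}^m$ with $\{[a:0]\}$ and $\mathbb{CP}^n$ with $\{[0:b]\}$. For $A\subset\mathbb{CP}^m$ an arbitrary subset, let $$A*\mathbb{CP}^n := A\cup\mathbb{CP}^n\cup\{[a:b] : a\ne 0,\ b\ne 0,\ [a:0]\in A\}\subset\mathbb{CP}^{m+n+1}$$ be the projective join, let $E_A := A*\mathbb{CP}^n\setminus\mathbb{CP}^n$, and let $p_A:E_A\to A$ be the projection $[a:b]\mapsto[a:0]$. Then: 1. For every $k\le 2n+1$, the homomorphism $H^k(A*\mathbb{CP}^n)\to H^k(\mathbb{CP}^n)$ induced by the inclusion is an isomorphism. 2. The natural map $H^{2(n+1)}(\mathbb{CP}^{m+n+1},\mathbb{CP}^n)\to H^{2(n+1)}(\mathbb{CP}^{m+n+1})$ is an isomorphism. There are neighbourhoods $T$ of $\mathbb{CP}^n$ in $A*\mathbb{CP}^n$ of which $\mathbb{CP}^n$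 is a deformation retract, and for every such $T$ the inclusions induce isomorphisms $H^*(A*\mathbb{CP}^n,\mathbb{CP}^n)\xleftarrow{\ \simeq\ }H^*(A*\mathbb{CP}^n,T)\xrightarrow{\ \simeq\ }H^*(E_A,T\setminus\mathbb{CP}^n)$. Through these, the usual cup product $H^p(E_A)\otimes H^q(E_A,T\setminus\mathbb{CP}^n)\to H^{p+q}(E_A,T\setminus\mathbb{CP}^n)$ defines a cup product $H^p(E_A)\otimes H^q(A*\mathbb{CP}^n,\mathbb{CP}^n)\to H^{p+q}(A*\mathbb{CP}^n,\mathbb{CP}^n)$. 3. Let $u$ be a generator of $H^2(\mathbb{CP}^{m+n+1})$, and let $t_A\in H^{2(n+1)}(A*\mathbb{CP}^n,\mathbb{CP}^n)$ be the restriction of the class of $H^{2(n+1)}(\mathbb{CP}^{m+n+1},\mathbb{CP}^n)$ that corresponds to $u^{n+1}\in H^{2(n+1)}(\mathbb{CP}^{m+n+1})$. For every such $T$ and every $k>2n+1$, the homomorphism $$f_A: H^{k-2(n+1)}(A)\to H^k(A*\mathbb{CP}^n),\qquad f_A(v) = p_A^*v\smile t_A$$ (the cup product of part 2, followed by the natural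 map $H^k(A*\mathbb{CP}^n,\mathbb{CP}^n)\to H^k(A*\mathbb{CP}^n)$) is an isomorphism. -/

import Mathlib

noncomputable section

open Function Set

/-! ## Singular cohomology of pairs with integer coefficients -/

namespace SingCoh

/-- Singular `q`-simplices of `X`. -/
abbrev Simplex (q : ℕ) (X : Type*) [TopologicalSpace X] := C(stdSimplex ℝ (Fin (q + 1)), X)

/-- Singular `q`-cochains of `X` with integer coefficients (dual of the free group on simplices). -/
abbrev Cochain (q : ℕ) (X : Type*) [TopologicalSpace X] := Simplex q X → ℤ

variable {X X' : Type*} [TopologicalSpace X] [TopologicalSpace X'] {p q r : ℕ}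

/-- Precomposition of a simplex with the affine map of standard simplices given on vertices
by `f`. -/
def reindex (σ : Simplex q X) (f : Fin (p + 1) → Fin (q + 1)) : Simplex p X :=
  σ.comp ⟨stdSimplex.map f, stdSimplex.continuous_map f⟩

theorem reindex_reindex (σ : Simplex q X) (f : Fin (p + 1) → Fin (q + 1))
    (g : Fin (r + 1) → Fin (p + 1)) : reindex (reindex σ f) g = reindex σ (f ∘ g) := by
  ext x
  simp only [reindex, ContinuousMap.comp_apply, ContinuousMap.coe_mk]
  rw [stdSimplex.map_comp_apply]

theorem range_reindex_subset (σ : Simplex q X) (f : Fin (p + 1) → Fin (q + 1)) :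
    range (reindex σ f) ⊆ range σ := by
  rintro _ ⟨x, rfl⟩
  exact ⟨_, rfl⟩

/-- The coboundary `(δ φ)(σ) = ∑ᵢ (-1)ⁱ φ(σ ∘ dᵢ)`. -/
def coboundary (q : ℕ) : Cochain q X →+ Cochain (q + 1) X where
  toFun φ σ := ∑ i : Fin (q + 2), (-1) ^ (i : ℕ) * φ (reindex σ i.succAbove)
  map_zero' := by ext; simp
  map_add' φ ψ := by ext; simp [mul_add, Finset.sum_add_distrib]

/-- Cochains of the pair `(X, Y)`: those vanishing on the simplices of `Y`. -/
def relCochains (q : ℕ) (Y : Set X) : AddSubgroup (Cochain q X) where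
  carrier := {φ | ∀ σ : Simplex q X, range σ ⊆ Y → φ σ = 0}
  zero_mem' _ _ := rfl
  add_mem' ha hb σ h := by simp [ha σ h, hb σ h]
  neg_mem' ha σ h := by simp [ha σ h]

def relCocycles (q : ℕ) (Y : Set X) : AddSubgroup (Cochain q X) :=
  relCochains q Y ⊓ (coboundary q).ker

def relCoboundaries : ∀ (q : ℕ) (_ : Set X), AddSubgroup (Cochain q X)
  | 0, _ => ⊥
  | q + 1, Y => (relCochains q Y).map (coboundary q)

/-- The singular cohomology group `H^q(X, Y; ℤ)`. As a singular simplex is never contained in the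
empty set, `H q X ∅` is the absolute group `H^q(X; ℤ)`. -/
def H (q : ℕ) (X : Type*) [TopologicalSpace X] (Y : Set X) : Type _ :=
  relCocycles q Y ⧸ (relCoboundaries q Y).addSubgroupOf (relCocycles q Y)

instance (q : ℕ) (Y : Set X) : AddCommGroup (H q X Y) :=
  inferInstanceAs (AddCommGroup (_ ⧸ (relCoboundaries q Y).addSubgroupOf (relCocycles q Y)))

/-- The class of a cocycle. -/
def H.mk (q : ℕ) (Y : Set X) : relCocycles q Y →+ H q X Y := QuotientAddGroup.mk' _

/-! ### Induced maps -/

/-- Pullback of cochains. -/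
def cochainMap (q : ℕ) (f : C(X, X')) : Cochain q X' →+ Cochain q X where
  toFun φ σ := φ (f.comp σ)
  map_zero' := rfl
  map_add' _ _ := rfl

theorem coboundary_cochainMap (f : C(X, X')) (φ : Cochain q X') :
    coboundary q (cochainMap q f φ) = cochainMap (q + 1) f (coboundary q φ) := rfl

theorem cochainMap_mem_relCochains {f : C(X, X')} {Y : Set X} {Y' : Set X'} (h : MapsTo f Y Y')
    {φ : Cochain q X'} (hφ : φ ∈ relCochains q Y') : cochainMap q f φ ∈ relCochains q Y := by
  intro σ hσ
  refine hφ _ ?_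
  rintro _ ⟨x, rfl⟩
  exact h (hσ ⟨x, rfl⟩)

theorem cochainMap_mem_relCocycles {f : C(X, X')} {Y : Set X} {Y' : Set X'} (h : MapsTo f Y Y')
    {φ : Cochain q X'} (hφ : φ ∈ relCocycles q Y') : cochainMap q f φ ∈ relCocycles q Y := by
  refine ⟨cochainMap_mem_relCochains h hφ.1, ?_⟩
  change coboundary q (cochainMap q f φ) = 0
  rw [coboundary_cochainMap, show coboundary q φ = 0 from hφ.2, map_zero]

theorem cochainMap_mem_relCoboundaries {f : C(X, X')} {Y : Set X} {Y' : Set X'}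
    (h : MapsTo f Y Y') {φ : Cochain q X'} (hφ : φ ∈ relCoboundaries q Y') :
    cochainMap q f φ ∈ relCoboundaries q Y := by
  cases q with
  | zero =>
    have h0 : φ = 0 := hφ
    rw [h0, map_zero]
    exact zero_mem _
  | succ q =>
    obtain ⟨α, hα, rfl⟩ := hφ
    exact ⟨_, cochainMap_mem_relCochains h hα, coboundary_cochainMap f α⟩

/-- The homomorphism `f^* : H^q(X', Y') → H^q(X, Y)` induced by a map of pairs
`f : (X, Y) → (X', Y')`. -/
def pullback (q : ℕ) (f : C(X, X')) {Y : Set X} {Y' : Set X'} (h : MapsTo f Y Y') :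
    H q X' Y' →+ H q X Y :=
  QuotientAddGroup.map _ _
    (((cochainMap q f).comp (relCocycles q Y').subtype).codRestrict (relCocycles q Y)
      fun φ => cochainMap_mem_relCocycles h φ.2)
    fun _ hφ => cochainMap_mem_relCoboundaries h hφ

/-! ### Cup product -/

/-- The front `p`-face of a `(p+q)`-simplex, on vertices. -/
def front (p q : ℕ) : Fin (p + 1) → Fin (p + q + 1) := Fin.castLE (by omega)

/-- The back `q`-face of a `(p+q)`-simplex, on vertices. -/
def back (p q : ℕ) : Fin (q + 1) → Fin (p + q + 1) := Fin.natAdd p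

/-- `(φ ⌣ ψ)(σ) = φ(front p-face of σ) ψ(back q-face of σ)`. -/
def cupCochain (φ : Cochain p X) (ψ : Cochain q X) : Cochain (p + q) X :=
  fun σ => φ (reindex σ (front p q)) * ψ (reindex σ (back p q))

theorem leibniz_apply (φ : Cochain p X) (ψ : Cochain q X) (σ : Simplex (p + q + 1) X) :
    coboundary (p + q) (cupCochain φ ψ) σ =
      coboundary p φ (reindex σ (Fin.castLE (by omega))) *
        ψ (reindex σ fun i => ⟨p + 1 + i, by omega⟩) +
      (-1) ^ p * (φ (reindex σ (Fin.castLE (by omega))) *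
        coboundary q ψ (reindex σ (back p (q + 1)))) := by
  have e : p + 1 + (q + 1) = p + q + 2 := by omega
  simp only [coboundary, AddMonoidHom.coe_mk, ZeroHom.coe_mk, cupCochain, reindex_reindex]
  rw [← Fin.sum_congr' _ e, Fin.sum_univ_add, Fin.sum_univ_castSucc (n := p + 1),
    Fin.sum_univ_succ (n := q + 1)]
  have h1 : ∀ i : Fin (p + 1), (Fin.cast e (Fin.castAdd (q + 1) i)).succAbove ∘ front p q =
      Fin.castLE (by omega) ∘ (Fin.castSucc i).succAbove := by
    intro i
    ext j
    simp only [comp_apply, front, Fin.succAbove, Fin.lt_def]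
    split_ifs <;> simp_all <;> omega
  have h2 : ∀ i : Fin (p + 1), (Fin.cast e (Fin.castAdd (q + 1) i)).succAbove ∘ back p q =
      fun i => ⟨p + 1 + i, by omega⟩ := by
    intro i
    ext j
    simp only [comp_apply, back, Fin.succAbove, Fin.lt_def]
    split_ifs <;> simp_all <;> omega
  have h3 : ∀ i : Fin (q + 1), (Fin.cast e (Fin.natAdd (p + 1) i)).succAbove ∘ front p q =
      Fin.castLE (by omega) := by
    intro i
    ext j
    simp only [comp_apply, front, Fin.succAbove, Fin.lt_def]
    split_ifs <;> simp_all <;> omega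
  have h4 : ∀ i : Fin (q + 1), (Fin.cast e (Fin.natAdd (p + 1) i)).succAbove ∘ back p q =
      back p (q + 1) ∘ i.succ.succAbove := by
    intro i
    ext j
    simp only [comp_apply, back, Fin.succAbove, Fin.lt_def]
    split_ifs <;> simp_all <;> omega
  have h5 : (Fin.castLE (by omega) : Fin (p + 2) → Fin (p + q + 2)) ∘
      (Fin.last (p + 1)).succAbove = Fin.castLE (by omega) := by
    ext j; simp
  have h6 : back p (q + 1) ∘ (0 : Fin (q + 2)).succAbove =
      fun i => ⟨p + 1 + i, by omega⟩ := by
    ext j; simp [back]; omega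
  simp only [h1, h2, h3, h4, h5, h6]
  simp only [Fin.val_cast, Fin.val_castAdd, Fin.val_natAdd, Fin.val_castSucc, Fin.val_last,
    Fin.val_succ, Fin.val_zero, add_mul, mul_add, Finset.sum_mul, Finset.mul_sum, pow_add,
    pow_zero, pow_one]
  have h7 : ∀ a b c d s : ℤ, a = c → b = d → a + b = c + s + (-s + d) := by
    intro a b c d s h h'; rw [h, h']; ring
  convert h7 _ _ _ _ _ ?_ ?_ using 3
  rotate_left
  · refine Finset.sum_congr rfl fun i _ => ?_
    ring
  · refine Finset.sum_congr rfl fun i _ => ?_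
    ring
  · ring

theorem coboundary_cupCochain_eq_zero {φ : Cochain p X} {ψ : Cochain q X}
    (hφ : coboundary p φ = 0) (hψ : coboundary q ψ = 0) :
    coboundary (p + q) (cupCochain φ ψ) = 0 := by
  ext σ
  rw [leibniz_apply, hφ, hψ]
  simp

theorem cupCochain_mem_relCochains {Y : Set X} (φ : Cochain p X) {ψ : Cochain q X}
    (hψ : ψ ∈ relCochains q Y) : cupCochain φ ψ ∈ relCochains (p + q) Y := by
  intro σ hσ
  simp [cupCochain, hψ _ ((range_reindex_subset σ _).trans hσ)]

theorem cupCochain_mem_relCocycles {Y : Set X} {φ : Cochain p X} {ψ : Cochain q X}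
    (hφ : φ ∈ relCocycles p (∅ : Set X)) (hψ : ψ ∈ relCocycles q Y) :
    cupCochain φ ψ ∈ relCocycles (p + q) Y :=
  ⟨cupCochain_mem_relCochains φ hψ.1, coboundary_cupCochain_eq_zero hφ.2 hψ.2⟩

theorem mem_relCoboundaries_of_eq {Y : Set X} {j k : ℕ} (h : k = j + 1) {φ : Cochain k X}
    {α : Cochain j X} (hα : α ∈ relCochains j Y)
    (hφ : ∀ σ : Simplex (j + 1) X,
      φ (reindex σ (Fin.cast (by omega))) = coboundary j α σ) :
    φ ∈ relCoboundaries k Y := by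
  subst h
  refine ⟨α, hα, ?_⟩
  ext σ
  rw [← hφ]
  congr 1
  ext x
  simp [reindex]

theorem cupCochain_left_mem_relCoboundaries {Y : Set X} {φ : Cochain p X} {ψ : Cochain q X}
    (hφ : φ ∈ relCoboundaries p (∅ : Set X)) (hψ : ψ ∈ relCocycles q Y) :
    cupCochain φ ψ ∈ relCoboundaries (p + q) Y := by
  cases p with
  | zero =>
    have h0 : φ = 0 := hφ
    have h1 : cupCochain φ ψ = 0 := by ext; simp [cupCochain, h0]
    rw [h1]
    exact zero_mem _
  | succ p =>
    obtain ⟨α, -, rfl⟩ := hφ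
    refine mem_relCoboundaries_of_eq (j := p + q) (by omega)
      (cupCochain_mem_relCochains α hψ.1) fun σ => ?_
    rw [leibniz_apply, show coboundary q ψ = 0 from hψ.2]
    simp only [cupCochain, reindex_reindex, Pi.zero_apply, mul_zero, add_zero]
    rfl

theorem cupCochain_right_mem_relCoboundaries {Y : Set X} {φ : Cochain p X} {ψ : Cochain q X}
    (hφ : φ ∈ relCocycles p (∅ : Set X)) (hψ : ψ ∈ relCoboundaries q Y) :
    cupCochain φ ψ ∈ relCoboundaries (p + q) Y := by
  cases q with
  | zero =>
    have h0 : ψ = 0 := hψ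
    have h1 : cupCochain φ ψ = 0 := by ext; simp [cupCochain, h0]
    rw [h1]
    exact zero_mem _
  | succ q =>
    obtain ⟨β, hβ, rfl⟩ := hψ
    refine ⟨(-1 : ℤ) ^ p • cupCochain φ β,
      zsmul_mem (cupCochain_mem_relCochains φ hβ) _, ?_⟩
    rw [map_zsmul]
    ext σ
    have h := leibniz_apply φ β σ
    rw [show coboundary p φ = 0 from hφ.2] at h
    change (-1 : ℤ) ^ p • coboundary (p + q) (cupCochain φ β) σ = _
    rw [h]
    simp only [Pi.zero_apply, zero_mul, zero_add, smul_eq_mul, ← mul_assoc, ← mul_pow]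
    simp only [mul_neg, mul_one, neg_neg, one_pow, one_mul]
    rfl

/-- The cup product on cocycles. -/
def cupCocycle (p q : ℕ) (Y : Set X) :
    relCocycles p (∅ : Set X) →+ relCocycles q Y →+ relCocycles (p + q) Y :=
  AddMonoidHom.mk' (fun φ => AddMonoidHom.mk'
      (fun ψ => ⟨cupCochain φ.1 ψ.1, cupCochain_mem_relCocycles φ.2 ψ.2⟩)
      (fun ψ ψ' => by ext; simp [cupCochain, mul_add]))
    (fun φ φ' => by ext; simp [cupCochain, add_mul])

/-- The cup product of a cocycle with a relative cohomology class. -/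
def cocycleCup (p q : ℕ) (Y : Set X) (φ : relCocycles p (∅ : Set X)) : H q X Y →+ H (p + q) X Y :=
  QuotientAddGroup.lift ((relCoboundaries q Y).addSubgroupOf (relCocycles q Y))
    ((H.mk (p + q) Y).comp (cupCocycle p q Y φ)) fun _ hψ =>
      (QuotientAddGroup.eq_zero_iff _).2 (cupCochain_right_mem_relCoboundaries φ.2 hψ)

theorem cocycleCup_mk (p q : ℕ) (Y : Set X) (φ : relCocycles p (∅ : Set X))
    (ψ : relCocycles q Y) :
    cocycleCup p q Y φ (H.mk q Y ψ) = H.mk (p + q) Y (cupCocycle p q Y φ ψ) := rfl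

/-- The cup product `H^p(X) ⊗ H^q(X, Y) → H^{p+q}(X, Y)`. -/
def cup (p q : ℕ) (Y : Set X) : H p X ∅ →+ H q X Y →+ H (p + q) X Y :=
  QuotientAddGroup.lift ((relCoboundaries p (∅ : Set X)).addSubgroupOf (relCocycles p ∅))
    (AddMonoidHom.mk' (cocycleCup p q Y) fun φ φ' => by
      refine AddMonoidHom.ext fun x => ?_
      obtain ⟨ψ, rfl⟩ := QuotientAddGroup.mk'_surjective _ x
      exact congrArg (H.mk (p + q) Y) (DFunLike.congr_fun (map_add (cupCocycle p q Y) φ φ') ψ))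
    fun φ hφ => by
      refine AddMonoidHom.ext fun x => ?_
      obtain ⟨ψ, rfl⟩ := QuotientAddGroup.mk'_surjective _ x
      exact (QuotientAddGroup.eq_zero_iff _).2 (cupCochain_left_mem_relCoboundaries hφ ψ.2)

theorem cup_mk_mk (p q : ℕ) (Y : Set X) (φ : relCocycles p (∅ : Set X)) (ψ : relCocycles q Y) :
    cup p q Y (H.mk p ∅ φ) (H.mk q Y ψ) = H.mk (p + q) Y (cupCocycle p q Y φ ψ) := rfl

/-- The unit of the cohomology ring: the class of the cochain `1`. -/
def unit (X : Type*) [TopologicalSpace X] : H 0 X ∅ :=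
  H.mk 0 ∅ ⟨fun _ => 1, by
    refine ⟨fun σ h => ?_, ?_⟩
    · obtain ⟨x⟩ : Nonempty (stdSimplex ℝ (Fin (0 + 1))) := inferInstance
      exact (h ⟨x, rfl⟩).elim
    · change coboundary 0 _ = 0
      ext σ
      simp [coboundary]⟩

/-- The cup powers `u^k ∈ H^{2k}(X)` of a class `u ∈ H²(X)`. -/
def cupPow (u : H 2 X ∅) : ∀ k : ℕ, H (2 * k) X ∅
  | 0 => unit X
  | k + 1 => cup (2 * k) 2 ∅ (cupPow u k) u

/-! ### Pairs of subsets of an ambient space -/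

/-- `H^q(U, V)` for subsets `V ⊆ U` of a space `X`. -/
abbrev HPair (q : ℕ) (U V : Set X) := H q U (Subtype.val ⁻¹' V)

/-- `H^q(U)` for a subset `U` of a space `X`. -/
abbrev HAbs (q : ℕ) (U : Set X) := H q U ∅

/-- The homomorphism `H^q(U', V') → H^q(U, V)` induced by an inclusion of pairs
`(U, V) ⊆ (U', V')`. -/
def res (q : ℕ) {U U' V V' : Set X} (hU : U ⊆ U') (hV : V ⊆ V') :
    HPair q U' V' →+ HPair q U V :=
  pullback q (ContinuousMap.inclusion hU) fun _ hx => hV hx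

/-- The homomorphism `H^q(U') → H^q(U)` induced by an inclusion `U ⊆ U'`. -/
def resAbs (q : ℕ) {U U' : Set X} (hU : U ⊆ U') : HAbs q U' →+ HAbs q U :=
  pullback q (ContinuousMap.inclusion hU) (mapsTo_empty _ _)

/-- The homomorphism `H^q(U, V) → H^q(U)` of the long exact sequence of the pair. -/
def toAbs (q : ℕ) (U V : Set X) : HPair q U V →+ HAbs q U :=
  pullback q (ContinuousMap.id U) (mapsTo_empty _ _)

end SingCoh

/-- The inverse of a bijective homomorphism (and `0` if the homomorphism is not bijective). -/
def invHom {G K : Type*} [AddCommGroup G] [AddCommGroup K] (f : G →+ K) : K →+ G :=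
  open Classical in
  if h : Bijective f then (AddEquiv.ofBijective f h).symm.toAddMonoidHom else 0

/-! ## Projective spaces and projective joins -/

open SingCoh

namespace ProjJoin

/-- The quotient topology on a projective space. -/
instance instTopologicalSpaceProjectivization (V : Type*) [AddCommGroup V] [Module ℂ V]
    [TopologicalSpace V] : TopologicalSpace (Projectivization ℂ V) :=
  inferInstanceAs (TopologicalSpace (Quotient (projectivizationSetoid ℂ V)))

/-- `ℂP^N`. -/
abbrev CP (N : ℕ) := Projectivization ℂ (Fin (N + 1) → ℂ)

/-- `ℂP^{m+n+1}`, with homogeneous coordinates `[a : b]`, `a ∈ ℂ^{m+1}`, `b ∈ ℂ^{n+1}`. -/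
abbrev CPSum (m n : ℕ) := Projectivization ℂ ((Fin (m + 1) → ℂ) × (Fin (n + 1) → ℂ))

variable {m n : ℕ}

/-- The embedding `ℂP^m → ℂP^{m+n+1}`, `[a] ↦ [a : 0]`. -/
def inlCP (m n : ℕ) : CP m → CPSum m n :=
  Projectivization.map (LinearMap.inl ℂ _ _) LinearMap.inl_injective

/-- The embedding `ℂP^n → ℂP^{m+n+1}`, `[b] ↦ [0 : b]`. -/
def inrCP (m n : ℕ) : CP n → CPSum m n :=
  Projectivization.map (LinearMap.inr ℂ _ _) LinearMap.inr_injective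

/-- The projective join `A * B = A ∪ B ∪ π(Ã × B̃)`. -/
def join (A : Set (CP m)) (B : Set (CP n)) : Set (CPSum m n) :=
  inlCP m n '' A ∪ inrCP m n '' B ∪
    {x | ∃ (a : Fin (m + 1) → ℂ) (b : Fin (n + 1) → ℂ) (ha : a ≠ 0) (hb : b ≠ 0),
      Projectivization.mk ℂ a ha ∈ A ∧ Projectivization.mk ℂ b hb ∈ B ∧
        x = Projectivization.mk ℂ (a, b) fun h => ha (congrArg Prod.fst h)}

/-- The copy of `ℂP^n` in `ℂP^{m+n+1}`. -/
def CPn (m n : ℕ) : Set (CPSum m n) := range (inrCP m n)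

/-- `A * ℂP^n`. -/
abbrev joinCP (A : Set (CP m)) (n : ℕ) : Set (CPSum m n) := join A (univ : Set (CP n))

theorem CPn_subset_joinCP (A : Set (CP m)) : CPn m n ⊆ joinCP A n := by
  rintro _ ⟨b, rfl⟩
  exact Or.inl (Or.inr ⟨b, mem_univ _, rfl⟩)

theorem mk_mem_CPn_iff (v : (Fin (m + 1) → ℂ) × (Fin (n + 1) → ℂ)) (hv : v ≠ 0) :
    Projectivization.mk ℂ v hv ∈ CPn m n ↔ v.1 = 0 := by
  constructor
  · rintro ⟨b, hb⟩
    induction b using Projectivization.ind with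
    | h b hb0 =>
      rw [inrCP, Projectivization.map_mk, Projectivization.mk_eq_mk_iff'] at hb
      obtain ⟨c, hc⟩ := hb
      have h1 : c • v.1 = 0 := congrArg Prod.fst hc
      have h2 : c • v.2 = b := congrArg Prod.snd hc
      rcases smul_eq_zero.1 h1 with h | h
      · exact (hb0 (by rw [← h2, h, zero_smul])).elim
      · exact h
  · intro h
    have h2 : v.2 ≠ 0 := fun h' => hv (Prod.ext h h')
    refine ⟨Projectivization.mk ℂ v.2 h2, ?_⟩
    rw [inrCP, Projectivization.map_mk, Projectivization.mk_eq_mk_iff']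
    exact ⟨1, by ext <;> simp [h]⟩

/-- The projection `ℂP^{m+n+1} \ ℂP^n → ℂP^m`, `[a : b] ↦ [a]`. -/
def fstProj (x : ↥((CPn m n)ᶜ : Set (CPSum m n))) : CP m :=
  Projectivization.mk ℂ x.1.rep.1 fun h => x.2 <| by
    rw [← x.1.mk_rep]
    exact (mk_mem_CPn_iff _ _).2 h

theorem fstProj_mk (v : (Fin (m + 1) → ℂ) × (Fin (n + 1) → ℂ)) (hv : v ≠ 0)
    (hv' : Projectivization.mk ℂ v hv ∈ (CPn m n)ᶜ) (h : v.1 ≠ 0) :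
    fstProj ⟨Projectivization.mk ℂ v hv, hv'⟩ = Projectivization.mk ℂ v.1 h := by
  rw [fstProj, Projectivization.mk_eq_mk_iff]
  obtain ⟨c, hc⟩ := Projectivization.exists_smul_eq_mk_rep ℂ v hv
  exact ⟨c, congrArg Prod.fst hc⟩

theorem continuous_fstProj : Continuous (fstProj (m := m) (n := n)) := by
  have hq : Topology.IsQuotientMap (Projectivization.mk' ℂ :
      {v : (Fin (m + 1) → ℂ) × (Fin (n + 1) → ℂ) // v ≠ 0} → CPSum m n) :=
    isQuotientMap_quotient_mk'
  have hpre : (Projectivization.mk' ℂ : {v : (Fin (m + 1) → ℂ) × (Fin (n + 1) → ℂ) // v ≠ 0} →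
      CPSum m n) ⁻¹' (CPn m n)ᶜ = {v | v.1.1 ≠ 0} := by
    ext v
    exact not_congr (mk_mem_CPn_iff v.1 v.2)
  have hopen : IsOpen ((CPn m n)ᶜ : Set (CPSum m n)) := by
    rw [← hq.isOpen_preimage, hpre]
    exact isOpen_ne_fun (by fun_prop) continuous_const
  rw [(hq.restrictPreimage_isOpen hopen).continuous_iff]
  have key : ∀ v : (Projectivization.mk' ℂ : {v : (Fin (m + 1) → ℂ) × (Fin (n + 1) → ℂ) // v ≠ 0} →
      CPSum m n) ⁻¹' (CPn m n)ᶜ, v.1.1.1 ≠ 0 :=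
    fun v => hpre.subset v.2
  have heq : (fstProj ∘ (CPn m n)ᶜ.restrictPreimage (Projectivization.mk' ℂ)) =
      fun v => Projectivization.mk' ℂ ⟨v.1.1.1, key v⟩ := by
    ext v
    exact fstProj_mk v.1.1 v.1.2 v.2 (key v)
  rw [heq]
  exact Continuous.comp (continuous_quotient_mk' (s := projectivizationSetoid ℂ _)) (by fun_prop)

/-- `E_A = A * ℂP^n \ ℂP^n`. -/
abbrev joinBundle (A : Set (CP m)) (n : ℕ) : Set (CPSum m n) := joinCP A n \ CPn m n

theorem fstProj_mem {A : Set (CP m)} (x : CPSum m n) (hx : x ∈ joinBundle A n) :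
    fstProj ⟨x, hx.2⟩ ∈ A := by
  obtain ⟨(⟨a, ha, rfl⟩ | ⟨b, -, rfl⟩) | ⟨a, b, ha, hb, hA, -, rfl⟩, h⟩ := hx
  · induction a using Projectivization.ind with
    | h a ha0 =>
      have := fstProj_mk (m := m) (n := n) (a, 0) (fun h => ha0 (congrArg Prod.fst h)) h ha0
      exact this.symm.subst (motive := fun y => y ∈ A) ha
  · exact (h ⟨b, rfl⟩).elim
  · rw [fstProj_mk (a, b) _ h ha]
    exact hA

/-- The projection `p_A : A * ℂP^n \ ℂP^n → A`, `[a : b] ↦ [a]`. -/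
def projA (A : Set (CP m)) (n : ℕ) : C(joinBundle A n, A) where
  toFun x := ⟨fstProj ⟨x.1, x.2.2⟩, fstProj_mem x.1 x.2⟩
  continuous_toFun :=
    (continuous_fstProj.comp (continuous_subtype_val.subtype_mk _)).subtype_mk _

/-- `T` is a neighbourhood of `ℂP^n` in `A * ℂP^n` of which `ℂP^n` is a deformation retract. -/
structure IsTubularNbhd (A : Set (CP m)) (n : ℕ) (T : Set (CPSum m n)) : Prop where
  subset_join : T ⊆ joinCP A n
  CPn_subset : CPn m n ⊆ T
  nhds : ∃ U : Set (CPSum m n), IsOpen U ∧ CPn m n ⊆ U ∧ U ∩ joinCP A n ⊆ T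
  retract : ∃ r : C(T, CPn m n),
    r.comp (ContinuousMap.inclusion CPn_subset) = ContinuousMap.id _ ∧
    ((ContinuousMap.inclusion CPn_subset).comp r).Homotopic (ContinuousMap.id T)

section fA

variable {A : Set (CP m)} {T : Set (CPSum m n)}

/-- The map `H^q(A * ℂP^n, T) → H^q(A * ℂP^n, ℂP^n)` induced by the inclusion. -/
def resTube (hT : IsTubularNbhd A n T) (q : ℕ) :
    HPair q (joinCP A n) T →+ HPair q (joinCP A n) (CPn m n) :=
  res q subset_rfl hT.CPn_subset

/-- The map `H^q(A * ℂP^n, T) → H^q(A * ℂP^n \ ℂP^n, T \ ℂP^n)` induced by the inclusion. -/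
def resExc (_hT : IsTubularNbhd A n T) (q : ℕ) :
    HPair q (joinCP A n) T →+ HPair q (joinBundle A n) (T \ CPn m n) :=
  res q sdiff_subset sdiff_subset

/-- The cup product
`H^p(A * ℂP^n \ ℂP^n) ⊗ H^q(A * ℂP^n, ℂP^n) → H^{p+q}(A * ℂP^n, ℂP^n)`, which is the usual one
`H^p(E_A) ⊗ H^q(E_A, T \ ℂP^n) → H^{p+q}(E_A, T \ ℂP^n)` after the identifications
`H^*(A * ℂP^n, ℂP^n) ≃ H^*(A * ℂP^n, T) ≃ H^*(E_A, T \ ℂP^n)`. -/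
def cupJoin (hT : IsTubularNbhd A n T) (p q : ℕ) :
    HAbs p (joinBundle A n) →+ HPair q (joinCP A n) (CPn m n) →+
      HPair (p + q) (joinCP A n) (CPn m n) :=
  ((cup p q _).compr₂ ((resTube hT (p + q)).comp (invHom (resExc hT (p + q))))).compl₂
    ((resExc hT q).comp (invHom (resTube hT q)))

/-- The class `t_A ∈ H^{2(n+1)}(A * ℂP^n, ℂP^n)`: the restriction of `u^{n+1}`, seen in
`H^{2(n+1)}(ℂP^{m+n+1}, ℂP^n) ≃ H^{2(n+1)}(ℂP^{m+n+1})`. -/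
def classT (A : Set (CP m)) (n : ℕ) (u : HAbs 2 (univ : Set (CPSum m n))) :
    HPair (2 * (n + 1)) (joinCP A n) (CPn m n) :=
  res _ (subset_univ _) subset_rfl
    (invHom (toAbs (2 * (n + 1)) univ (CPn m n)) (cupPow u (n + 1)))

/-- The homomorphism `f_A : H^j(A) → H^{j+2(n+1)}(A * ℂP^n)`, `f_A(v) = p_A^* v ⌣ t_A`. -/
def fA (hT : IsTubularNbhd A n T) (u : HAbs 2 (univ : Set (CPSum m n))) (j : ℕ) :
    HAbs j A →+ HAbs (j + 2 * (n + 1)) (joinCP A n) :=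
  (toAbs _ (joinCP A n) (CPn m n)).comp
    (((cupJoin hT j (2 * (n + 1))).flip (classT A n u)).comp
      (pullback j (projA A n) (mapsTo_empty _ _)))

end fA

end ProjJoin

end

noncomputable section

open Function Set

/-! ## Differential groups -/

/-! The complement of `ℂP^n` in `ℂP^{m+n+1}` is, through `[a : b] ↦ [a]`, a complex vector bundle of
rank `n+1` over `ℂP^m` with zero section `{[a : 0]}`, and `E_A` is its restriction to `A`. The
points of the join off the zero section contract to `ℂP^n` along `[ta : b]`. Together with excision
this identifies `H^*(A * ℂP^n, ℂP^n)` with the cohomology of `E_A` relative to the complement of its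
zero section. The theorem is then the Thom isomorphism for `E_A`, once `t_A` is known to be a Thom
class.

That `t_A` is a Thom class is checked on fibres. The fibre over a point, together with `ℂP^n`, is a
projective subspace `ℂP^{n+1}`; the generator `u` restricts to a generator of its second cohomology
(`bijective_H2_linMap`), and the top power of that generator generates the top group
(`zmultiples_cupPow`). Hence `t_A` restricts to a generator of `H^{2n+2}(ℂ^{n+1}, ℂ^{n+1} ∖ 0)`. The
statement on top powers is itself an induction on dimension using the Thom isomorphism of the line
bundle `ℙ(V × ℂ) ∖ pt → ℙ(V)`, under which cup product with `u` turns `u^n` into `u^{n+1}`.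

The Thom isomorphism needs no hypothesis on `A`. For a product `U × ℝ^k` with an arbitrary space `U`
it is obtained one real coordinate at a time (`qIso_lineThom`, `isThom_genCochain`); a cocycle which
restricts to generators on the fibres is then also a Thom cocycle (`isThom_of_fibre`). The finitely
many affine charts of `ℂP^m` trivialise the bundle, and Mayer–Vietoris over their traces on `A`
gives the global statement (`isThomOn_of_cover`).

Part 1 follows because the Thom isomorphism makes the groups of `(A * ℂP^n, ℂP^n)` vanish below
degree `2n+2`. Parts 2 and 3 use in addition that `H^q(ℂP^n) = 0` for `q > 2n`. An arbitrary `T` is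
compared with smaller standard tubes.

All comparisons are made on cochains, in the ungraded group of families of cochains of all degrees,
so that maps which shift the degree, such as cup products, need no separate treatment.
Quasi-isomorphisms are expressed by acyclicity of the mapping cone. The geometric input is the prism
operator and the theorem on small simplices (`acyclic_relF`), which yields excision and
Mayer–Vietoris. -/

/-- An abelian group with an endomorphism of square zero. -/
class DiffGroup (A : Type*) [AddCommGroup A] where
  /-- The differential. -/
  d : A →+ A
  d_d : ∀ x, d (d x) = 0

namespace DiffGroup

attribute [simp] d_d

variable {A B C : Type*} [AddCommGroup A] [DiffGroup A] [AddCommGroup B] [DiffGroup B]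
  [AddCommGroup C] [DiffGroup C]

/-- A subgroup in which each cycle is a boundary. -/
def Acyclic (S : AddSubgroup A) : Prop := ∀ x ∈ S, d x = 0 → ∃ y ∈ S, d y = x

/-- A homomorphism of differential groups which maps the subgroup `S` into `T` and whose mapping
cone, relative to `S` and `T`, is acyclic. -/
structure QIso (S : AddSubgroup A) (T : AddSubgroup B) (f : A →+ B) : Prop where
  comm : ∀ x, f (d x) = d (f x)
  maps : ∀ x ∈ S, f x ∈ T
  cone : ∀ x ∈ S, ∀ y ∈ T, d x = 0 → f x = d y → ∃ z ∈ S, ∃ w ∈ T, d z = x ∧ f z - d w = y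

variable {S : AddSubgroup A} {T : AddSubgroup B} {R : AddSubgroup C} {f : A →+ B} {g : B →+ C}

theorem QIso.inj (h : QIso S T f) {x : A} (hx : x ∈ S) (hdx : d x = 0) {y : B} (hy : y ∈ T)
    (hxy : f x = d y) : ∃ z ∈ S, d z = x := by
  obtain ⟨z, hz, -, -, h1, -⟩ := h.cone x hx y hy hdx hxy
  exact ⟨z, hz, h1⟩

theorem QIso.surj (h : QIso S T f) {y : B} (hy : y ∈ T) (hdy : d y = 0) :
    ∃ z ∈ S, d z = 0 ∧ ∃ w ∈ T, f z - d w = y := by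
  obtain ⟨z, hz, w, hw, h1, h2⟩ := h.cone 0 (zero_mem _) y hy (map_zero _) (by simp [hdy])
  exact ⟨z, hz, h1, w, hw, h2⟩

/-- A cycle `(x, y)` of the cone is killed in two stages: injectivity gives `z` with `d z = x`, and
then `f z - y` is a cycle, which surjectivity moves to a cycle of the source up to a boundary. -/
theorem QIso.of_inj_surj (comm : ∀ x, f (d x) = d (f x)) (maps : ∀ x ∈ S, f x ∈ T)
    (inj : ∀ x ∈ S, d x = 0 → ∀ y ∈ T, f x = d y → ∃ z ∈ S, d z = x)
    (surj : ∀ y ∈ T, d y = 0 → ∃ z ∈ S, d z = 0 ∧ ∃ w ∈ T, f z - d w = y) : QIso S T f where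
  comm := comm
  maps := maps
  cone x hx y hy hdx hxy := by
    obtain ⟨z, hz, rfl⟩ := inj x hx hdx y hy hxy
    obtain ⟨z', hz', h1, w, hw, h2⟩ := surj (f z - y) (sub_mem (maps z hz) hy)
      (by rw [map_sub, ← hxy, comm, sub_self])
    refine ⟨z - z', sub_mem hz hz', -w, neg_mem hw, by simp [h1], ?_⟩
    have h3 : y = f z - (f z' - d w) := by rw [h2]; abel
    rw [h3, map_sub, map_neg]
    abel

theorem QIso.comp (hg : QIso T R g) (hf : QIso S T f) : QIso S R (g.comp f) := by
  refine QIso.of_inj_surj (fun x => by simp [hf.comm, hg.comm])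
    (fun x hx => hg.maps _ (hf.maps _ hx)) (fun x hx hdx y hy hxy => ?_) fun y hy hdy => ?_
  · obtain ⟨z, hz, h⟩ := hg.inj (hf.maps x hx) (by rw [← hf.comm, hdx, map_zero]) hy hxy
    exact hf.inj hx hdx hz h.symm
  · obtain ⟨z, hz, h1, w, hw, h2⟩ := hg.surj hy hdy
    obtain ⟨z', hz', h1', w', hw', h2'⟩ := hf.surj hz h1
    refine ⟨z', hz', h1', g w' + w, add_mem (hg.maps _ hw') hw, ?_⟩
    rw [← h2, ← h2', AddMonoidHom.comp_apply, map_add, map_sub, hg.comm]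
    abel

theorem QIso.of_comp_left (hg : QIso T R g) (hgf : QIso S R (g.comp f))
    (comm : ∀ x, f (d x) = d (f x)) (maps : ∀ x ∈ S, f x ∈ T) : QIso S T f := by
  refine QIso.of_inj_surj comm maps (fun x hx hdx y hy hxy => ?_) fun y hy hdy => ?_
  · refine hgf.inj hx hdx (hg.maps y hy) ?_
    rw [AddMonoidHom.comp_apply, hxy, hg.comm]
  · obtain ⟨z, hz, h1, w, hw, h2⟩ := hgf.surj (hg.maps y hy) (by rw [← hg.comm, hdy, map_zero])
    obtain ⟨v, hv, h3⟩ := hg.inj (sub_mem (maps z hz) hy) (by rw [map_sub, ← comm, h1, hdy]; simp)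
      hw (by rw [map_sub, ← h2]; simp)
    exact ⟨z, hz, h1, v, hv, by rw [h3]; abel⟩

theorem QIso.of_comp_right (hf : QIso S T f) (hgf : QIso S R (g.comp f))
    (comm : ∀ x, g (d x) = d (g x)) (maps : ∀ x ∈ T, g x ∈ R) : QIso T R g := by
  refine QIso.of_inj_surj comm maps (fun x hx hdx y hy hxy => ?_) fun y hy hdy => ?_
  · obtain ⟨z, hz, h1, w, hw, h2⟩ := hf.surj hx hdx
    obtain ⟨v, hv, h3⟩ := hgf.inj hz h1 (add_mem hy (maps w hw))
      (by rw [AddMonoidHom.comp_apply, map_add, ← hxy, ← comm, ← map_add, ← h2]; simp)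
    exact ⟨f v - w, sub_mem (hf.maps v hv) hw, by rw [map_sub, ← hf.comm, h3, h2]⟩
  · obtain ⟨z, hz, h1, w, hw, h2⟩ := hgf.surj hy hdy
    exact ⟨f z, hf.maps z hz, by rw [← hf.comm, h1, map_zero], w, hw, h2⟩

theorem QIso.of_homotopy {f' : A →+ B} (hf : QIso S T f) (P : A →+ B)
    (hP : ∀ x ∈ S, P x ∈ T)
    (comm : ∀ x, f' (d x) = d (f' x)) (maps : ∀ x ∈ S, f' x ∈ T)
    (h : ∀ x ∈ S, f x - f' x = d (P x) + P (d x)) : QIso S T f' := by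
  refine QIso.of_inj_surj comm maps (fun x hx hdx y hy hxy => ?_) fun y hy hdy => ?_
  · refine hf.inj hx hdx (y := y + P x) (add_mem hy (hP x hx)) ?_
    have := h x hx
    rw [hdx, map_zero, add_zero, sub_eq_iff_eq_add] at this
    rw [this, hxy, map_add, add_comm]
  · obtain ⟨z, hz, h1, w, hw, h2⟩ := hf.surj hy hdy
    refine ⟨z, hz, h1, w - P z, sub_mem hw (hP z hz), ?_⟩
    have := h z hz
    rw [h1, map_zero, add_zero, sub_eq_iff_eq_add] at this
    rw [← h2, this, map_sub]
    abel

theorem QIso.id : QIso S S (AddMonoidHom.id A) :=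
  QIso.of_inj_surj (fun _ => rfl) (fun _ h => h) (fun _ _ _ y hy h => ⟨y, hy, h.symm⟩)
    fun y hy h => ⟨y, hy, h, 0, zero_mem _, by simp⟩

/-- A homomorphism with an inverse up to homotopy on both sides. -/
theorem QIso.of_homotopy_inverse {g : B →+ A} (PA : A →+ A) (PB : B →+ B)
    (commf : ∀ x, f (d x) = d (f x)) (mapsf : ∀ x ∈ S, f x ∈ T)
    (commg : ∀ x, g (d x) = d (g x)) (mapsg : ∀ x ∈ T, g x ∈ S)
    (hPA : ∀ x ∈ S, PA x ∈ S) (hPB : ∀ x ∈ T, PB x ∈ T)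
    (hA : ∀ x ∈ S, x - g (f x) = d (PA x) + PA (d x))
    (hB : ∀ x ∈ T, x - f (g x) = d (PB x) + PB (d x)) : QIso S T f := by
  have h1 : QIso S S (g.comp f) := QIso.id.of_homotopy PA hPA
    (fun x => by simp [commf, commg]) (fun x hx => mapsg _ (mapsf _ hx)) hA
  have h2 : QIso T T (f.comp g) := QIso.id.of_homotopy PB hPB
    (fun x => by simp [commf, commg]) (fun x hx => mapsf _ (mapsg _ hx)) hB
  refine QIso.of_inj_surj commf mapsf (fun x hx hdx y hy hxy => ?_) fun y hy hdy => ?_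
  · exact h1.inj hx hdx (mapsg y hy) (by simp [hxy, commg])
  · obtain ⟨z, hz, h1, w, hw, h2⟩ := h2.surj hy hdy
    exact ⟨g z, mapsg z hz, by rw [← commg, h1, map_zero], w, hw, h2⟩

/-- A surjection with acyclic kernel. -/
theorem QIso.of_surjective (hS : ∀ x ∈ S, d x ∈ S) (comm : ∀ x, f (d x) = d (f x))
    (maps : ∀ x ∈ S, f x ∈ T) (surj : ∀ y ∈ T, ∃ x ∈ S, f x = y)
    (hker : ∀ x ∈ S, f x = 0 → d x = 0 → ∃ y ∈ S, f y = 0 ∧ d y = x) : QIso S T f where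
  comm := comm
  maps := maps
  cone x hx y hy hdx hxy := by
    obtain ⟨z, hz, rfl⟩ := surj y hy
    obtain ⟨w, hw, hw0, h⟩ := hker (x - d z) (sub_mem hx (hS z hz))
      (by simp [hxy, comm]) (by simp [hdx])
    refine ⟨w + z, add_mem hw hz, 0, zero_mem _, by simp [h], ?_⟩
    rw [map_add, hw0]
    simp

/-- Converse to `QIso.of_surjective`: the cone condition for `(x, 0)` gives `d z = x` and `f z = d
w`, and lifting `w` to `v` allows `z` to be replaced by `z - d v`, which lies in the kernel. -/
theorem QIso.acyclic_ker (h : QIso S T f) (hS : ∀ x ∈ S, d x ∈ S)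
    (surj : ∀ y ∈ T, ∃ x ∈ S, f x = y) {x : A} (hx : x ∈ S) (hx0 : f x = 0) (hdx : d x = 0) :
    ∃ y ∈ S, f y = 0 ∧ d y = x := by
  obtain ⟨z, hz, w, hw, h1, h2⟩ := h.cone x hx 0 (zero_mem _) hdx (by simp [hx0])
  obtain ⟨v, hv, rfl⟩ := surj w hw
  exact ⟨z - d v, sub_mem hz (hS v hv), by rw [map_sub, h.comm, h2], by simp [h1]⟩

/-- An inclusion of subgroups with acyclic quotient. -/
theorem QIso.of_le {S' : AddSubgroup A} (hle : S ≤ S')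
    (h : ∀ x ∈ S', d x ∈ S → ∃ y ∈ S', x - d y ∈ S) : QIso S S' (AddMonoidHom.id A) where
  comm _ := rfl
  maps x hx := hle hx
  cone x hx y hy hdx hxy := by
    have hxy : x = d y := hxy
    subst hxy
    obtain ⟨z, hz, h1⟩ := h y hy hx
    exact ⟨y - d z, h1, -z, neg_mem hz, by simp, by simp⟩

/-- The Mayer–Vietoris comparison: two exact sequences `K → A → B₁ ⊕ B₂ → C → 0` with acyclic `K`,
and homomorphisms between them. -/
theorem QIso.of_mayerVietoris {A' B₁ B₂ B₁' B₂' C' : Type*}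
    [AddCommGroup A'] [DiffGroup A'] [AddCommGroup B₁] [DiffGroup B₁] [AddCommGroup B₂]
    [DiffGroup B₂] [AddCommGroup B₁'] [DiffGroup B₁'] [AddCommGroup B₂'] [DiffGroup B₂']
    [AddCommGroup C'] [DiffGroup C']
    {S : AddSubgroup A} {S' : AddSubgroup A'} {T₁ : AddSubgroup B₁} {T₁' : AddSubgroup B₁'}
    {T₂ : AddSubgroup B₂} {T₂' : AddSubgroup B₂'} {R : AddSubgroup C} {R' : AddSubgroup C'}
    (f : A →+ A') (f₁ : B₁ →+ B₁') (f₂ : B₂ →+ B₂') (g : C →+ C')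
    (r₁ : A →+ B₁) (r₂ : A →+ B₂) (s₁ : B₁ →+ C) (s₂ : B₂ →+ C)
    (r₁' : A' →+ B₁') (r₂' : A' →+ B₂') (s₁' : B₁' →+ C') (s₂' : B₂' →+ C')
    (hS : ∀ x ∈ S, d x ∈ S) (hS' : ∀ x ∈ S', d x ∈ S')
    (hT₁ : ∀ x ∈ T₁, d x ∈ T₁) (hT₁' : ∀ x ∈ T₁', d x ∈ T₁')
    (comm : ∀ x, f (d x) = d (f x)) (maps : ∀ x ∈ S, f x ∈ S')
    (hf₁ : QIso T₁ T₁' f₁) (hf₂ : QIso T₂ T₂' f₂) (hg : QIso R R' g)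
    (cr₁ : ∀ x, r₁ (d x) = d (r₁ x)) (cr₂ : ∀ x, r₂ (d x) = d (r₂ x))
    (cs₁ : ∀ x, s₁ (d x) = d (s₁ x)) (cs₂ : ∀ x, s₂ (d x) = d (s₂ x))
    (cr₁' : ∀ x, r₁' (d x) = d (r₁' x)) (cr₂' : ∀ x, r₂' (d x) = d (r₂' x))
    (cs₁' : ∀ x, s₁' (d x) = d (s₁' x)) (cs₂' : ∀ x, s₂' (d x) = d (s₂' x))
    (mr₁ : ∀ x ∈ S, r₁ x ∈ T₁) (mr₂ : ∀ x ∈ S, r₂ x ∈ T₂)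
    (ms₁ : ∀ x ∈ T₁, s₁ x ∈ R) (ms₂ : ∀ x ∈ T₂, s₂ x ∈ R)
    (mr₁' : ∀ x ∈ S', r₁' x ∈ T₁') (mr₂' : ∀ x ∈ S', r₂' x ∈ T₂')
    (ms₁' : ∀ x ∈ T₁', s₁' x ∈ R') (ms₂' : ∀ x ∈ T₂', s₂' x ∈ R')
    (nr₁ : ∀ x, f₁ (r₁ x) = r₁' (f x)) (nr₂ : ∀ x, f₂ (r₂ x) = r₂' (f x))
    (ns₁ : ∀ x, g (s₁ x) = s₁' (f₁ x)) (ns₂ : ∀ x, g (s₂ x) = s₂' (f₂ x))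
    (hsr : ∀ x, s₁ (r₁ x) = s₂ (r₂ x)) (hsr' : ∀ x, s₁' (r₁' x) = s₂' (r₂' x))
    (ex : ∀ x ∈ T₁, ∀ y ∈ T₂, s₁ x = s₂ y → ∃ z ∈ S, r₁ z = x ∧ r₂ z = y)
    (ex' : ∀ x ∈ T₁', ∀ y ∈ T₂', s₁' x = s₂' y → ∃ z ∈ S', r₁' z = x ∧ r₂' z = y)
    (sj : ∀ x ∈ R, ∃ y ∈ T₁, s₁ y = x) (sj' : ∀ x ∈ R', ∃ y ∈ T₁', s₁' y = x)
    (hK : ∀ x ∈ S, r₁ x = 0 → r₂ x = 0 → d x = 0 → ∃ y ∈ S, r₁ y = 0 ∧ r₂ y = 0 ∧ d y = x)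
    (hK' : ∀ x ∈ S', r₁' x = 0 → r₂' x = 0 → d x = 0 → ∃ y ∈ S', d y = x) :
    QIso S S' f where
  comm := comm
  maps := maps
  cone x hx y hy hdx hxy := by
    -- The cone cycle `(x, y)` is bounded separately over the two pieces; the two solutions need not
    -- agree in `C`.
    obtain ⟨z₁, hz₁, w₁, hw₁, e₁, e₁'⟩ := hf₁.cone (r₁ x) (mr₁ x hx) (r₁' y) (mr₁' y hy)
      (by rw [← cr₁, hdx, map_zero]) (by rw [nr₁, hxy, cr₁'])
    obtain ⟨z₂, hz₂, w₂, hw₂, e₂, e₂'⟩ := hf₂.cone (r₂ x) (mr₂ x hx) (r₂' y) (mr₂' y hy)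
      (by rw [← cr₂, hdx, map_zero]) (by rw [nr₂, hxy, cr₂'])
    -- The discrepancy of the two solutions is a cycle of the cone of `g`. Bounding it and lifting
    -- the result through the surjections `s₁`, `s₁'` corrects the first solution so that the pieces
    -- can be glued.
    obtain ⟨c, hc, c', hc', e₃, e₃'⟩ := hg.cone (s₁ z₁ - s₂ z₂)
      (sub_mem (ms₁ _ hz₁) (ms₂ _ hz₂)) (s₁' w₁ - s₂' w₂) (sub_mem (ms₁' _ hw₁) (ms₂' _ hw₂))
      (by rw [map_sub, ← cs₁, ← cs₂, e₁, e₂, hsr, sub_self])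
      (by
        rw [map_sub, map_sub, ns₁, ns₂, ← cs₁', ← cs₂', ← sub_eq_zero]
        have h1 : d w₁ = f₁ z₁ - r₁' y := by rw [← e₁']; abel
        have h2 : d w₂ = f₂ z₂ - r₂' y := by rw [← e₂']; abel
        rw [h1, h2, map_sub, map_sub, hsr']
        abel)
    obtain ⟨b, hb, rfl⟩ := sj c hc
    obtain ⟨b', hb', rfl⟩ := sj' c' hc'
    obtain ⟨z, hz, h1, h2⟩ := ex (z₁ - d b) (sub_mem hz₁ (hT₁ b hb)) z₂ hz₂
      (by rw [map_sub, cs₁, e₃]; abel)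
    obtain ⟨w, hw, h1', h2'⟩ := ex' (w₁ - f₁ b + d b')
      (add_mem (sub_mem hw₁ (hf₁.maps b hb)) (hT₁' b' hb')) w₂ hw₂
      (by
        rw [ns₁, sub_eq_iff_eq_add] at e₃'
        rw [map_add, map_sub, cs₁', e₃']
        abel)
    -- After gluing, the errors in both cone equations die on the two pieces, so they lie in the
    -- acyclic kernels: first the error in `d z = x`, then the one in `f z - d w = y`.
    obtain ⟨k, hk, k1, k2, k3⟩ := hK (x - d z) (sub_mem hx (hS z hz))
      (by rw [map_sub, cr₁, h1, map_sub, e₁, d_d]; simp)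
      (by rw [map_sub, cr₂, h2, e₂, sub_self]) (by simp [hdx])
    obtain ⟨v, hv, k4⟩ := hK' (f (z + k) - d w - y)
      (sub_mem (sub_mem (maps _ (add_mem hz hk)) (hS' w hw)) hy)
      (by
        rw [map_sub, map_sub, ← nr₁, map_add, k1, h1, cr₁', h1', ← e₁']
        simp only [map_add, map_sub, d_d, hf₁.comm, map_zero]
        abel)
      (by
        rw [map_sub, map_sub, ← nr₂, map_add, k2, h2, cr₂', h2', ← e₂', map_add, map_zero]
        abel)
      (by rw [map_sub, map_sub, d_d, ← comm, map_add, k3, ← hxy]; simp)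
    exact ⟨z + k, add_mem hz hk, w + v, add_mem hw hv, by rw [map_add, k3]; abel,
      by rw [map_add d, k4]; abel⟩

end DiffGroup

end

noncomputable section

open Function Set DiffGroup

namespace SingCoh

/-! ## Affine chains -/

/-- The point of a standard simplex with barycentric coordinates `x` with respect to `w`. -/
def comb {p q : ℕ} (w : Fin (p + 1) → stdSimplex ℝ (Fin (q + 1)))
    (x : stdSimplex ℝ (Fin (p + 1))) : stdSimplex ℝ (Fin (q + 1)) :=
  ⟨∑ j, x j • (w j : Fin (q + 1) → ℝ),
    (convex_stdSimplex ℝ _).sum_mem (fun j _ => x.2.1 j) x.2.2 fun j _ => (w j).2⟩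

theorem comb_apply {p q : ℕ} (w : Fin (p + 1) → stdSimplex ℝ (Fin (q + 1)))
    (x : stdSimplex ℝ (Fin (p + 1))) (i : Fin (q + 1)) : comb w x i = ∑ j, x j * w j i := by
  change (∑ j, x j • (w j : Fin (q + 1) → ℝ)) i = _
  rw [Finset.sum_apply]
  rfl

theorem map_eq_comb {p q : ℕ} (f : Fin (p + 1) → Fin (q + 1)) (x : stdSimplex ℝ (Fin (p + 1))) :
    stdSimplex.map f x = comb (fun j => stdSimplex.vertex (f j)) x := by
  ext i
  rw [comb_apply, stdSimplex.map_coe, FunOnFinite.linearMap_apply_apply, Finset.sum_filter]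
  refine Finset.sum_congr rfl fun j _ => ?_
  by_cases h : f j = i
  · simp [h]
  · simp [h, Ne.symm h]

/-- A space with convex combinations of finitely many points. -/
class ConvSp (K : Type*) [TopologicalSpace K] where
  /-- The affine simplex with given vertices. -/
  aff {q : ℕ} (v : Fin (q + 1) → K) : C(stdSimplex ℝ (Fin (q + 1)), K)
  aff_comb {p q : ℕ} (v : Fin (q + 1) → K) (w : Fin (p + 1) → stdSimplex ℝ (Fin (q + 1)))
    (x : stdSimplex ℝ (Fin (p + 1))) : aff v (comb w x) = aff (fun j => aff v (w j)) x
  aff_vertex {q : ℕ} (v : Fin (q + 1) → K) (i : Fin (q + 1)) : aff v (stdSimplex.vertex i) = v i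
  aff_const {q : ℕ} (c : K) (x : stdSimplex ℝ (Fin (q + 1))) : aff (fun _ => c) x = c

open ConvSp

/-- Convex sets have convex combinations. -/
@[reducible]
def convSpOfConvex {E : Type*} [AddCommGroup E] [Module ℝ E] [TopologicalSpace E]
    [IsTopologicalAddGroup E] [ContinuousSMul ℝ E] {K : Set E} (hK : Convex ℝ K) : ConvSp K where
  aff {q} v :=
    { toFun := fun x => ⟨∑ j, x j • (v j : E),
        hK.sum_mem (fun j _ => x.2.1 j) x.2.2 fun j _ => (v j).2⟩
      continuous_toFun := by
        refine Continuous.subtype_mk (continuous_finsetSum _ fun j _ => ?_) _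
        exact ((continuous_apply j).comp continuous_subtype_val).smul continuous_const }
  aff_comb v w x := by
    ext
    simp only [ContinuousMap.coe_mk, comb_apply, Finset.smul_sum, Finset.sum_smul, mul_smul]
    exact Finset.sum_comm
  aff_vertex v i := by
    ext
    simp [Pi.single_apply]
  aff_const c x := by
    ext
    simp [← Finset.sum_smul]

instance (q : ℕ) : ConvSp (stdSimplex ℝ (Fin (q + 1))) := convSpOfConvex (convex_stdSimplex ℝ _)

instance : ConvSp unitInterval := convSpOfConvex (convex_Icc 0 1)

instance {K K' : Type*} [TopologicalSpace K] [ConvSp K] [TopologicalSpace K'] [ConvSp K'] :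
    ConvSp (K × K') where
  aff v := (aff fun j => (v j).1).prodMk (aff fun j => (v j).2)
  aff_comb v w x := by simp [aff_comb]
  aff_vertex v i := by simp [aff_vertex]
  aff_const c x := by simp [aff_const]

theorem aff_stdSimplex {p q : ℕ} (v : Fin (p + 1) → stdSimplex ℝ (Fin (q + 1)))
    (x : stdSimplex ℝ (Fin (p + 1))) : aff v x = comb v x := rfl

theorem aff_vertices {q : ℕ} (x : stdSimplex ℝ (Fin (q + 1))) :
    aff (fun i : Fin (q + 1) => (stdSimplex.vertex i : stdSimplex ℝ (Fin (q + 1)))) x = x := by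
  rw [aff_stdSimplex, ← map_eq_comb (fun i => i)]
  exact stdSimplex.map_id_apply x

variable {K K' : Type*} [TopologicalSpace K] [ConvSp K] [TopologicalSpace K'] [ConvSp K']
  {X X' : Type*} [TopologicalSpace X] [TopologicalSpace X'] {p q : ℕ}

theorem reindex_aff (g : C(K, X)) (v : Fin (q + 1) → K) (f : Fin (p + 1) → Fin (q + 1)) :
    reindex (g.comp (aff v)) f = g.comp (aff (v ∘ f)) := by
  ext x
  simp only [reindex, ContinuousMap.comp_apply, ContinuousMap.coe_mk]
  rw [map_eq_comb, aff_comb]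
  simp only [aff_vertex]
  rfl

/-- A map compatible with convex combinations. -/
def IsAff (f : K → K') : Prop :=
  ∀ (q : ℕ) (v : Fin (q + 1) → K) (x : stdSimplex ℝ (Fin (q + 1))), f (aff v x) = aff (f ∘ v) x

/-- Chains of affine simplices, given by their lists of vertices; the empty list is allowed. -/
abbrev Aff (K : Type*) := FreeAbelianGroup (List K)

open FreeAbelianGroup (of lift)

/-- Add a vertex in front. -/
def cone {K : Type*} (b : K) : Aff K →+ Aff K := FreeAbelianGroup.map (List.cons b)

@[simp]
theorem cone_of {K : Type*} (b : K) (l : List K) : cone b (of l) = of (b :: l) :=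
  FreeAbelianGroup.map_of_apply l

/-- The boundary of an affine simplex. -/
def bdList {K : Type*} : List K → Aff K
  | [] => 0
  | v :: l => of l - cone v (bdList l)

/-- The (augmented) boundary of affine chains. -/
def bd {K : Type*} : Aff K →+ Aff K := lift bdList

@[simp]
theorem bd_nil {K : Type*} : bd (of ([] : List K)) = 0 := FreeAbelianGroup.lift_apply_of _ _

@[simp]
theorem bd_cons {K : Type*} (v : K) (l : List K) :
    bd (of (v :: l)) = of l - cone v (bd (of l)) := by
  simp [bd, bdList]

/-- Because the empty simplex is present, coning is a contracting homotopy with no exceptional case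
at the vertices. This makes the inductive constructions by cones below work uniformly. -/
theorem bd_cone {K : Type*} (b : K) (c : Aff K) : bd (cone b c) = c - cone b (bd c) := by
  have : (bd.comp (cone b)) = AddMonoidHom.id _ - (cone b).comp bd := by
    ext l
    simp
  exact DFunLike.congr_fun this c

theorem bd_bd {K : Type*} (c : Aff K) : bd (bd c) = 0 := by
  have : (bd.comp bd : Aff K →+ Aff K) = 0 := by
    ext l
    induction l with
    | nil => simp
    | cons v l ih =>
      have ih : bd (bd (of l)) = 0 := ih
      simp [bd_cone, ih]
  exact DFunLike.congr_fun this c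

theorem bd_ofFn {K : Type*} {q : ℕ} (v : Fin (q + 1) → K) :
    bd (of (List.ofFn v)) =
      ∑ i : Fin (q + 1), (-1 : ℤ) ^ (i : ℕ) • of (List.ofFn (v ∘ i.succAbove)) := by
  induction q with
  | zero => simp [List.ofFn_succ]
  | succ q ih =>
    rw [List.ofFn_succ, bd_cons, ih, map_sum, sub_eq_add_neg, ← Finset.sum_neg_distrib,
      Fin.sum_univ_succ (n := q + 1)]
    refine congrArg₂ _ ?_ ?_
    · simp [Function.comp_def]
    · refine Finset.sum_congr rfl fun i _ => ?_
      rw [map_zsmul, cone_of, List.ofFn_succ (f := v ∘ i.succ.succAbove), Fin.val_succ, pow_succ,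
        mul_neg_one, neg_smul]
      simp [Function.comp_def]

/-- Chains of affine simplices from a given set. -/
def chains {K : Type*} (Q : Set (List K)) : AddSubgroup (Aff K) := AddSubgroup.closure (of '' Q)

theorem of_mem_chains {K : Type*} {Q : Set (List K)} {l : List K} (h : l ∈ Q) :
    of l ∈ chains Q := AddSubgroup.subset_closure ⟨l, h, rfl⟩

theorem map_mem_of_chains {K M : Type*} [AddCommGroup M] {Q : Set (List K)} (G : Aff K →+ M)
    {R : AddSubgroup M} (h : ∀ l ∈ Q, G (of l) ∈ R) {c : Aff K} (hc : c ∈ chains Q) : G c ∈ R := by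
  have : chains Q ≤ R.comap G := by
    rw [chains, AddSubgroup.closure_le]
    rintro _ ⟨l, hl, rfl⟩
    exact h l hl
  exact this hc

theorem cone_mem_chains {K : Type*} {Q Q' : Set (List K)} {b : K} (h : ∀ l ∈ Q, b :: l ∈ Q')
    {c : Aff K} (hc : c ∈ chains Q) : cone b c ∈ chains Q' :=
  map_mem_of_chains _ (fun l hl => by simpa using of_mem_chains (h l hl)) hc

/-- Supports every induction along the boundary: faces are one vertex shorter, and they use only
vertices of the given simplex, so convexity and diameter conditions pass to them. -/
theorem bd_mem_chains {K : Type*} (v : K) (l : List K) :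
    bd (of (v :: l)) ∈ chains {l' | l'.length = l.length ∧ l' ⊆ v :: l} := by
  induction l generalizing v with
  | nil => simpa using of_mem_chains (by simp)
  | cons w l ih =>
    rw [bd_cons]
    refine sub_mem (of_mem_chains ⟨rfl, List.subset_cons_self _ _⟩) (cone_mem_chains ?_ (ih w))
    rintro l' ⟨h1, h2⟩
    refine ⟨by simp [h1], ?_⟩
    rw [List.cons_subset]
    exact ⟨by simp, fun x hx => List.mem_cons_of_mem _ (h2 hx)⟩

/-- Homomorphisms on affine chains may be compared by induction on the boundary. -/
theorem aff_hom_ext {K M : Type*} [AddCommGroup M] {G G' : Aff K →+ M}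
    (h0 : G (of []) = G' (of []))
    (h1 : ∀ v l, G (bd (of (v :: l))) = G' (bd (of (v :: l))) →
      G (of (v :: l)) = G' (of (v :: l))) :
    G = G' := by
  have : ∀ n, ∀ l : List K, l.length = n → G (of l) = G' (of l) := by
    intro n
    induction n with
    | zero =>
      intro l hl
      rw [List.length_eq_zero_iff.1 hl, h0]
    | succ n ih =>
      intro l hl
      cases l with
      | nil => simp at hl
      | cons v l =>
        refine h1 v l ?_
        have := map_mem_of_chains (G - G') (R := ⊥) ?_ (bd_mem_chains v l)
        · simpa [sub_eq_zero] using this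
        · rintro l' ⟨h, -⟩
          simpa [sub_eq_zero] using ih l' (by simpa [h] using hl)
  ext l
  exact this _ l rfl

/-- Auxiliary to `recOp`. -/
def recOpAux {K M : Type*} [AddCommGroup M] (z : M) (F : K → List K → M → M) : ℕ → Aff K →+ M
  | 0 => lift fun _ => z
  | n + 1 => lift fun l => match l with
    | [] => z
    | v :: l => F v l (recOpAux z F n (bd (of (v :: l))))

/-- The homomorphism `G` on affine chains with `G [] = z` and `G l = F l (G (∂ l))`. -/
def recOp {K M : Type*} [AddCommGroup M] (z : M) (F : K → List K → M → M) : Aff K →+ M :=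
  lift fun l => recOpAux z F l.length (of l)

theorem recOp_nil {K M : Type*} [AddCommGroup M] (z : M) (F : K → List K → M → M) :
    recOp z F (of []) = z := by
  simp [recOp, recOpAux]

/-- The auxiliary recursion is indexed by the length of the list. All terms of the boundary of `v ::
l` have length `l.length`, which is the index reached after one unfolding. -/
theorem recOp_cons {K M : Type*} [AddCommGroup M] (z : M) (F : K → List K → M → M) (v : K)
    (l : List K) : recOp z F (of (v :: l)) = F v l (recOp z F (bd (of (v :: l)))) := by
  have h := map_mem_of_chains (recOpAux z F l.length - recOp z F) (R := ⊥) ?_ (bd_mem_chains v l)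
  · have h : recOpAux z F l.length (bd (of (v :: l))) = recOp z F (bd (of (v :: l))) := by
      simpa [sub_eq_zero] using h
    rw [← h, recOp, FreeAbelianGroup.lift_apply_of, List.length_cons, recOpAux,
      FreeAbelianGroup.lift_apply_of]
  · rintro l' ⟨h, -⟩
    simp [recOp, h]

/-- The map of affine chains induced by a map of points. -/
def push {K K' : Type*} (f : K → K') : Aff K →+ Aff K' := FreeAbelianGroup.map (List.map f)

@[simp]
theorem push_of {K K' : Type*} (f : K → K') (l : List K) : push f (of l) = of (l.map f) :=
  FreeAbelianGroup.map_of_apply l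

theorem push_cone {K K' : Type*} (f : K → K') (b : K) (c : Aff K) :
    push f (cone b c) = cone (f b) (push f c) := by
  have : (push f).comp (cone b) = (cone (f b)).comp (push f) := by ext l; simp
  exact DFunLike.congr_fun this c

theorem push_bd {K K' : Type*} (f : K → K') (c : Aff K) : push f (bd c) = bd (push f c) := by
  have : (push f).comp bd = bd.comp (push f) := by
    ext l
    induction l with
    | nil => simp
    | cons v l ih =>
      have ih : push f (bd (of l)) = bd (of (l.map f)) := by simpa using ih
      simp [push_cone, ih]
  exact DFunLike.congr_fun this c

/-! ### Total cochains -/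

/-- Families of cochains, one in each degree. -/
abbrev Tot (X : Type*) [TopologicalSpace X] := ∀ q : ℕ, Cochain q X

/-- The coboundary of total cochains. -/
def totD : Tot X →+ Tot X where
  toFun φ := fun
    | 0 => 0
    | q + 1 => coboundary q (φ q)
  map_zero' := by
    ext q σ
    cases q <;> simp
  map_add' φ ψ := by
    ext q σ
    cases q <;> simp

/-- The value of a cochain on an affine simplex. -/
def evList (φ : Tot X) (g : C(K, X)) : List K → ℤ
  | [] => 0
  | v :: l => φ l.length (g.comp (aff fun i : Fin (l.length + 1) => (v :: l).get i))

/-- The value of a cochain on the image of an affine chain. -/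
def ev (φ : Tot X) (g : C(K, X)) : Aff K →+ ℤ := lift (evList φ g)

@[simp]
theorem ev_nil (φ : Tot X) (g : C(K, X)) : ev φ g (of []) = 0 :=
  FreeAbelianGroup.lift_apply_of _ _

theorem ev_ofFn (φ : Tot X) (g : C(K, X)) (v : Fin (q + 1) → K) :
    ev φ g (of (List.ofFn v)) = φ q (g.comp (aff v)) := by
  have key : ∀ (a : K) (l : List K) (h : l.length = q),
      (∀ i : Fin (q + 1), (a :: l).get (i.cast (by simp [h])) = v i) →
      evList φ g (a :: l) = φ q (g.comp (aff v)) := by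
    rintro a l rfl h
    rw [evList]
    congr 3
    ext i
    exact h i
  rw [ev, FreeAbelianGroup.lift_apply_of, List.ofFn_succ]
  refine key _ _ (by simp) fun i => ?_
  refine Fin.cases ?_ (fun i => ?_) i <;> simp

theorem list_cases {K : Type*} (l : List K) :
    l = [] ∨ ∃ (q : ℕ) (v : Fin (q + 1) → K), l = List.ofFn v := by
  cases l with
  | nil => exact Or.inl rfl
  | cons a l => exact Or.inr ⟨l.length, (a :: l).get, (List.ofFn_get (a :: l)).symm⟩

theorem ev_push (φ : Tot X) (g : C(K', X)) {f : C(K, K')} (hf : IsAff f) (c : Aff K) :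
    ev φ g (push f c) = ev φ (g.comp f) c := by
  have : (ev φ g).comp (push f) = ev φ (g.comp f) := by
    ext l
    obtain rfl | ⟨q, v, rfl⟩ := list_cases l
    · simp
    · simp only [AddMonoidHom.comp_apply, push_of, List.map_ofFn, ev_ofFn]
      congr 1
      ext x
      simp [hf q v x]
  exact DFunLike.congr_fun this c

theorem ev_bd (φ : Tot X) (g : C(K, X)) (c : Aff K) : ev (totD φ) g c = ev φ g (bd c) := by
  have : ev (totD φ) g = (ev φ g).comp bd := by
    ext l
    obtain rfl | ⟨q, v, rfl⟩ := list_cases l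
    · simp
    · rw [ev_ofFn, AddMonoidHom.comp_apply, bd_ofFn, map_sum]
      cases q with
      | zero => simp [totD]
      | succ q =>
        change ∑ i : Fin (q + 2), _ = _
        refine Finset.sum_congr rfl fun i _ => ?_
        rw [map_zsmul, ev_ofFn, reindex_aff, smul_eq_mul]
  exact DFunLike.congr_fun this c

/-- The standard simplex as an affine chain in itself. -/
def idChain (q : ℕ) : Aff (stdSimplex ℝ (Fin (q + 1))) :=
  of (List.ofFn fun i => stdSimplex.vertex i)

theorem ev_idChain (φ : Tot X) (σ : Simplex q X) : ev φ σ (idChain q) = φ q σ := by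
  rw [idChain, ev_ofFn]
  congr 1
  ext x
  simp only [ContinuousMap.comp_apply]
  rw [aff_vertices]

theorem totD_totD (φ : Tot X) : totD (totD φ) = 0 := by
  ext q σ
  rw [← ev_idChain (totD (totD φ)), ev_bd, ev_bd, bd_bd, map_zero]
  rfl

instance : DiffGroup (Tot X) where
  d := totD
  d_d := totD_totD

/-- The faces of a standard simplex. -/
def faceMap (f : Fin (p + 1) → Fin (q + 1)) :
    C(stdSimplex ℝ (Fin (p + 1)), stdSimplex ℝ (Fin (q + 1))) :=
  ⟨stdSimplex.map f, stdSimplex.continuous_map f⟩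

theorem isAff_faceMap (f : Fin (p + 1) → Fin (q + 1)) : IsAff (faceMap f) := by
  intro r v x
  change stdSimplex.map f _ = _
  rw [map_eq_comb, ← aff_stdSimplex, aff_stdSimplex v, aff_comb]
  have h : faceMap f ∘ v =
      fun j => aff (fun j => (stdSimplex.vertex (f j) : stdSimplex ℝ (Fin (q + 1)))) (v j) :=
    funext fun j => map_eq_comb f (v j)
  rw [h]

theorem of_vertices_eq_push (f : Fin (p + 1) → Fin (q + 1)) :
    (of (List.ofFn fun i => stdSimplex.vertex (f i)) : Aff (stdSimplex ℝ (Fin (q + 1)))) =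
      push (faceMap f) (idChain p) := by
  simp only [idChain, push_of, List.map_ofFn]
  congr 2
  ext1 i
  exact (stdSimplex.map_vertex f i).symm

/-- The coboundary of a cochain defined by a natural operation on affine chains. -/
theorem totD_apply_eq_sum (ψ : Tot X) (σ : Simplex q X)
    (G : Aff (stdSimplex ℝ (Fin (q + 1))) →+ ℤ) (h0 : G (of []) = 0)
    (h : ∀ (p : ℕ) (f : Fin (p + 1) → Fin (q + 1)), p ≤ q → ψ p (reindex σ f) =
      G (of (List.ofFn fun i => stdSimplex.vertex (f i)))) :
    totD ψ q σ = G (bd (idChain q)) := by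
  rw [idChain, bd_ofFn, map_sum]
  cases q with
  | zero => simp [totD, h0]
  | succ q =>
    change ∑ i : Fin (q + 2), _ = _
    refine Finset.sum_congr rfl fun i _ => ?_
    rw [map_zsmul, smul_eq_mul, h _ _ q.le_succ]
    rfl

/-! ### Homotopies -/

/-- The prism operator on affine chains. -/
def prism (K : Type*) : Aff K →+ Aff (K × unitInterval) :=
  recOp 0 fun v l c => cone (v, 0)
    (push (fun x => (x, 1)) (of (v :: l)) - push (fun x => (x, 0)) (of (v :: l)) - c)

theorem prism_cons {K : Type*} (v : K) (l : List K) : prism K (of (v :: l)) = cone (v, 0)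
    (push (fun x => (x, 1)) (of (v :: l)) - push (fun x => (x, 0)) (of (v :: l)) -
      prism K (bd (of (v :: l)))) := recOp_cons _ _ v l

/-- The bracket which is coned off in the definition of `prism` is a cycle, by the formula for the
boundary, so the boundary of the cone is the bracket itself. -/
theorem bd_prism {K : Type*} (c : Aff K) :
    bd (prism K c) = push (fun x => (x, 1)) c - push (fun x => (x, 0)) c - prism K (bd c) := by
  have : bd.comp (prism K) = push (fun x => (x, 1)) - push (fun x => (x, 0)) -
      (prism K).comp bd := by
    refine aff_hom_ext ?_ fun v l h => ?_
    · simp [prism, recOp_nil]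
    · have h : bd (prism K (bd (of (v :: l)))) = push (fun x => (x, 1)) (bd (of (v :: l))) -
        push (fun x => (x, 0)) (bd (of (v :: l))) - prism K (bd (bd (of (v :: l)))) := h
      simp only [AddMonoidHom.comp_apply, AddMonoidHom.sub_apply]
      rw [prism_cons, bd_cone, map_sub bd, map_sub bd, h, ← push_bd, ← push_bd, bd_bd]
      simp only [map_zero, sub_zero, sub_self]
  exact DFunLike.congr_fun this c

/-- The prism is built from vertices alone, so it is natural for arbitrary maps of points; no
affinity is needed here, in contrast to subdivision. -/
theorem push_prism {K K' : Type*} (f : K → K') (c : Aff K) :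
    push (Prod.map f id) (prism K c) = prism K' (push f c) := by
  have : (push (Prod.map f id)).comp (prism K) = (prism K').comp (push f) := by
    refine aff_hom_ext ?_ fun v l h => ?_
    · simp [prism, recOp_nil]
    · have h : push (Prod.map f id) (prism K (bd (of (v :: l)))) =
        prism K' (push f (bd (of (v :: l)))) := h
      simp only [AddMonoidHom.comp_apply]
      rw [prism_cons, push_cone, map_sub (push _), map_sub (push _), h, push_of f, List.map_cons,
        prism_cons, push_bd, push_of f]
      simp [Function.comp_def]
  exact DFunLike.congr_fun this c

/-- The homomorphism of total cochains induced by a map. -/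
def totMap (f : C(X, X')) : Tot X' →+ Tot X where
  toFun φ q := cochainMap q f (φ q)
  map_zero' := rfl
  map_add' _ _ := rfl

theorem totMap_apply (f : C(X, X')) (φ : Tot X') (σ : Simplex q X) :
    totMap f φ q σ = φ q (f.comp σ) := rfl

theorem totMap_d (f : C(X, X')) (φ : Tot X') : totMap f (d φ) = d (totMap f φ) := by
  ext q σ
  cases q <;> rfl

theorem totMap_comp {X'' : Type*} [TopologicalSpace X''] (f : C(X, X')) (g : C(X', X''))
    (φ : Tot X'') : totMap (g.comp f) φ = totMap f (totMap g φ) := rfl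

/-- The homotopy operator of a homotopy. -/
def homotopyOp (F : C(X × unitInterval, X')) : Tot X' →+ Tot X where
  toFun φ q σ := ev φ (F.comp (σ.prodMap (ContinuousMap.id _))) (prism _ (idChain q))
  map_zero' := by
    ext q σ
    have : ev (0 : Tot X') (F.comp (σ.prodMap (ContinuousMap.id _))) = 0 := by
      ext l
      cases l <;> simp [ev, evList]
    simp [this]
  map_add' φ ψ := by
    ext q σ
    have : ev (φ + ψ) (F.comp (σ.prodMap (ContinuousMap.id _))) =
        ev φ (F.comp (σ.prodMap (ContinuousMap.id _))) +
          ev ψ (F.comp (σ.prodMap (ContinuousMap.id _))) := by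
      ext l
      cases l <;> simp [ev, evList]
    simp [this]

theorem homotopyOp_spec (F : C(X × unitInterval, X')) (φ : Tot X') :
    totMap (F.comp ((ContinuousMap.id X).prodMk (ContinuousMap.const X 1))) φ -
      totMap (F.comp ((ContinuousMap.id X).prodMk (ContinuousMap.const X 0))) φ =
      d (homotopyOp F φ) + homotopyOp F (d φ) := by
  ext q σ
  -- The two terms of the homotopy formula are the prism of the boundary, by naturality under faces,
  -- and the boundary of the prism.
  have h1 : d (homotopyOp F φ) q σ =
      ev φ (F.comp (σ.prodMap (ContinuousMap.id _))) (prism _ (bd (idChain q))) := by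
    refine totD_apply_eq_sum (homotopyOp F φ) σ
      ((ev φ (F.comp (σ.prodMap (ContinuousMap.id _)))).comp (prism _)) ?_ fun p f _ => ?_
    · simp [prism, recOp_nil]
    · rw [of_vertices_eq_push, AddMonoidHom.comp_apply, ← push_prism]
      exact (ev_push φ (F.comp (σ.prodMap (ContinuousMap.id _)))
        (f := (faceMap f).prodMap (ContinuousMap.id _))
        (fun r v x => Prod.ext (isAff_faceMap f r _ x) rfl) (prism _ (idChain p))).symm
  have h2 : homotopyOp F (d φ) q σ = ev φ (F.comp (σ.prodMap (ContinuousMap.id _)))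
      (bd (prism _ (idChain q))) := ev_bd _ _ _
  have h3 : ∀ t : unitInterval, ev φ (F.comp (σ.prodMap (ContinuousMap.id _)))
      (push (fun x => (x, t)) (idChain q)) =
      totMap (F.comp ((ContinuousMap.id X).prodMk (ContinuousMap.const X t))) φ q σ := by
    intro t
    rw [totMap_apply, ← ev_idChain φ]
    exact ev_push φ _
      (f := (ContinuousMap.id (stdSimplex ℝ (Fin (q + 1)))).prodMk (ContinuousMap.const _ t))
      (fun r v x => Prod.ext rfl (aff_const t x).symm) _
  simp only [Pi.sub_apply, Pi.add_apply]
  rw [h1, h2, bd_prism, map_sub, map_sub, h3, h3]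
  ring

end SingCoh

end

noncomputable section

open Function Set DiffGroup

namespace SingCoh

open ConvSp
open FreeAbelianGroup (of lift)

/-! ## Subdivision -/

section Subdivision

variable {K K' : Type*} [TopologicalSpace K] [ConvSp K] [TopologicalSpace K'] [ConvSp K']

/-- The barycenter of an affine simplex. -/
def bary (v : K) (l : List K) : K :=
  aff (fun i : Fin (l.length + 1) => (v :: l).get i) stdSimplex.barycenter

/-- Barycentric subdivision of affine chains. -/
def subdiv : Aff K →+ Aff K := recOp (of []) fun v l c => cone (bary v l) c

/-- The chain homotopy between subdivision and the identity. -/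
def subdivHom : Aff K →+ Aff K := recOp 0 fun v l c => cone (bary v l) (of (v :: l) - c)

@[simp]
theorem subdiv_nil : subdiv (of ([] : List K)) = of [] := recOp_nil _ _

theorem subdiv_cons (v : K) (l : List K) :
    subdiv (of (v :: l)) = cone (bary v l) (subdiv (bd (of (v :: l)))) := recOp_cons _ _ v l

@[simp]
theorem subdivHom_nil : subdivHom (of ([] : List K)) = 0 := recOp_nil _ _

theorem subdivHom_cons (v : K) (l : List K) :
    subdivHom (of (v :: l)) = cone (bary v l) (of (v :: l) - subdivHom (bd (of (v :: l)))) :=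
  recOp_cons _ _ v l

theorem bd_subdiv (c : Aff K) : bd (subdiv c) = subdiv (bd c) := by
  have : bd.comp subdiv = subdiv.comp (bd (K := K)) := by
    refine aff_hom_ext (by simp) fun v l h => ?_
    have h : bd (subdiv (bd (of (v :: l)))) = subdiv (bd (bd (of (v :: l)))) := h
    simp only [AddMonoidHom.comp_apply]
    rw [subdiv_cons, bd_cone, h, bd_bd, map_zero, map_zero, sub_zero]
  exact DFunLike.congr_fun this c

/-- By induction, the boundary of `of (v :: l) - subdivHom (bd (of (v :: l)))` is the subdivision of
the boundary of `v :: l`. Coning that from the barycentre is the subdivision of `v :: l`, so it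
appears as the correction term in `bd_cone`. -/
theorem bd_subdivHom (c : Aff K) : bd (subdivHom c) = c - subdiv c - subdivHom (bd c) := by
  have : bd.comp subdivHom = AddMonoidHom.id _ - subdiv - subdivHom.comp (bd (K := K)) := by
    refine aff_hom_ext (by simp) fun v l h => ?_
    have h : bd (subdivHom (bd (of (v :: l)))) = bd (of (v :: l)) - subdiv (bd (of (v :: l))) -
      subdivHom (bd (bd (of (v :: l)))) := h
    simp only [AddMonoidHom.comp_apply, AddMonoidHom.sub_apply, AddMonoidHom.id_apply]
    rw [subdivHom_cons, bd_cone, map_sub bd, h, bd_bd, map_zero, sub_zero, sub_sub_cancel,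
      subdiv_cons]
    abel
  exact DFunLike.congr_fun this c


theorem bary_eq_of_ofFn {q : ℕ} (u : Fin (q + 1) → K) {v : K} {l : List K}
    (h : v :: l = List.ofFn u) : bary v l = aff u stdSimplex.barycenter := by
  have hl : l.length = q := by simpa using congrArg List.length h
  subst hl
  rw [bary]
  congr 2
  ext i
  rw [List.get_of_eq h]
  exact List.get_ofFn u _

theorem bary_map {f : K → K'} (hf : IsAff f) (v : K) (l : List K) :
    bary (f v) (l.map f) = f (bary v l) := by
  have h := (List.ofFn_get (v :: l)).symm
  rw [bary_eq_of_ofFn (q := l.length) _ h, hf]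
  refine bary_eq_of_ofFn (q := l.length) _ ?_
  rw [← List.map_ofFn, ← h]
  rfl

theorem push_subdiv {f : K → K'} (hf : IsAff f) (c : Aff K) :
    push f (subdiv c) = subdiv (push f c) := by
  have : (push f).comp subdiv = subdiv.comp (push f) := by
    refine aff_hom_ext (by simp) fun v l h => ?_
    have h : push f (subdiv (bd (of (v :: l)))) = subdiv (push f (bd (of (v :: l)))) := h
    simp only [AddMonoidHom.comp_apply]
    rw [subdiv_cons, push_cone, h, push_bd, push_of, List.map_cons, subdiv_cons, bary_map hf]
  exact DFunLike.congr_fun this c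

theorem push_subdivHom {f : K → K'} (hf : IsAff f) (c : Aff K) :
    push f (subdivHom c) = subdivHom (push f c) := by
  have : (push f).comp subdivHom = subdivHom.comp (push f) := by
    refine aff_hom_ext (by simp) fun v l h => ?_
    have h : push f (subdivHom (bd (of (v :: l)))) = subdivHom (push f (bd (of (v :: l)))) := h
    simp only [AddMonoidHom.comp_apply]
    rw [subdivHom_cons, push_cone, map_sub (push f), h, push_bd, push_of, List.map_cons,
      subdivHom_cons, bary_map hf]
  exact DFunLike.congr_fun this c

/-- The `m`-fold subdivision. -/
def subdivPow : ℕ → Aff K →+ Aff K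
  | 0 => AddMonoidHom.id _
  | m + 1 => subdiv.comp (subdivPow m)

/-- The homotopy between the identity and the `m`-fold subdivision. -/
def subdivHomIter : ℕ → Aff K →+ Aff K
  | 0 => 0
  | m + 1 => subdivHomIter m + subdivHom.comp (subdivPow m)

theorem subdivHomIter_succ (m : ℕ) (c : Aff K) : subdivHomIter (m + 1) c =
    subdivHomIter m c + subdivHom (subdivPow m c) := rfl

theorem subdivPow_succ (m : ℕ) (c : Aff K) : subdivPow (m + 1) c = subdiv (subdivPow m c) := rfl

theorem bd_subdivPow (m : ℕ) (c : Aff K) : bd (subdivPow m c) =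
    subdivPow m (bd c) := by
  induction m with
  | zero => rfl
  | succ m ih => rw [subdivPow_succ, subdivPow_succ, bd_subdiv, ih]

theorem bd_subdivHomIter (m : ℕ) (c : Aff K) : bd (subdivHomIter m c) =
    c - subdivPow m c - subdivHomIter m (bd c) := by
  induction m with
  | zero => simp [subdivHomIter, subdivPow]
  | succ m ih =>
    rw [subdivHomIter_succ, subdivHomIter_succ, map_add, ih, bd_subdivHom, bd_subdivPow,
      subdivPow_succ]
    abel

theorem push_subdivPow {f : K → K'} (hf : IsAff f) (m : ℕ) (c : Aff K) :
    push f (subdivPow m c) =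
      subdivPow m (push f c) := by
  induction m with
  | zero => rfl
  | succ m ih => rw [subdivPow_succ, subdivPow_succ, push_subdiv hf, ih]

theorem push_subdivHomIter {f : K → K'} (hf : IsAff f) (m : ℕ) (c : Aff K) :
    push f (subdivHomIter m c) = subdivHomIter m (push f c) := by
  induction m with
  | zero => simp [subdivHomIter]
  | succ m ih => rw [subdivHomIter_succ, subdivHomIter_succ, map_add, ih, push_subdivHom hf,
      push_subdivPow hf]

theorem subdivPow_nil (m : ℕ) :
    subdivPow m (of ([] : List K)) = of [] := by
  induction m with
  | zero => rfl
  | succ m ih => rw [subdivPow_succ, ih, subdiv_nil]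

theorem subdivHomIter_nil (m : ℕ) : subdivHomIter m (of ([] : List K)) = 0 := by
  induction m with
  | zero => simp [subdivHomIter]
  | succ m ih => rw [subdivHomIter_succ, ih, subdivPow_nil, subdivHom_nil, add_zero]

/-- A set closed under convex combinations. -/
def AffClosed (S : Set K) : Prop :=
  ∀ (q : ℕ) (v : Fin (q + 1) → K) (x : stdSimplex ℝ (Fin (q + 1))), (∀ i, v i ∈ S) → aff v x ∈ S

theorem AffClosed.bary_mem {S : Set K} (hS : AffClosed S) {v : K} {l : List K}
    (h : ∀ x ∈ v :: l, x ∈ S) : bary v l ∈ S :=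
  hS _ _ _ fun i => h _ (List.get_mem (v :: l) i)

theorem subdivHom_mem {S : Set K} (hS : AffClosed S) {l : List K} (h : ∀ x ∈ l, x ∈ S) :
    subdivHom (of l) ∈ chains {l' : List K | ∀ x ∈ l', x ∈ S} := by
  induction hn : l.length generalizing l with
  | zero =>
    rw [List.length_eq_zero_iff.1 hn, subdivHom_nil]
    exact zero_mem _
  | succ n ih =>
    cases l with
    | nil => simp at hn
    | cons v l =>
      rw [subdivHom_cons]
      refine cone_mem_chains (Q := {l' : List K | ∀ x ∈ l', x ∈ S}) ?_
        (sub_mem (of_mem_chains h) (map_mem_of_chains _ ?_ (bd_mem_chains v l)))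
      · intro l' hl' x hx
        rcases List.mem_cons.1 hx with rfl | hx
        · exact hS.bary_mem h
        · exact hl' x hx
      · rintro l' ⟨h1, h2⟩
        exact ih (fun x hx => h x (h2 hx)) (by simpa [h1] using hn)

end Subdivision

/-! ### Shrinking of simplices under barycentric subdivision -/

section Diameter

variable {q : ℕ}

theorem affClosed_closedBall (y : stdSimplex ℝ (Fin (q + 1))) (r : ℝ) :
    AffClosed (Metric.closedBall y r) := by
  intro p v x h
  exact (convex_closedBall (y : Fin (q + 1) → ℝ) r).sum_mem (fun j _ => x.2.1 j) x.2.2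
    fun j _ => h j

/-- The barycentre is the mean of `n + 1` vertices, one of which is `w` itself and contributes
nothing, so the distance is at most `n / (n + 1) * δ`. The bound is weakened to `N` so that a single
ratio serves all faces at once. -/
theorem dist_bary_le {v : stdSimplex ℝ (Fin (q + 1))} {l : List (stdSimplex ℝ (Fin (q + 1)))}
    {δ : ℝ} {N : ℕ} (hN : l.length ≤ N) (hδ : 0 ≤ δ)
    (h : ∀ x ∈ v :: l, ∀ y ∈ v :: l, dist x y ≤ δ) {w : stdSimplex ℝ (Fin (q + 1))}
    (hw : w ∈ v :: l) : dist w (bary v l) ≤ N / (N + 1) * δ := by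
  obtain ⟨i, rfl⟩ := List.get_of_mem hw
  set n := l.length with hn
  have hn0 : (0 : ℝ) < n + 1 := by positivity
  set g : Fin (n + 1) → Fin (q + 1) → ℝ := fun j => ((v :: l).get j : Fin (q + 1) → ℝ)
  have e : ((bary v l : stdSimplex ℝ (Fin (q + 1))) : Fin (q + 1) → ℝ) =
      ∑ j, ((n : ℝ) + 1)⁻¹ • g j := by
    change ∑ j : Fin (n + 1), (stdSimplex.barycenter : stdSimplex ℝ (Fin (n + 1))) j • g j = _
    refine Finset.sum_congr rfl fun j _ => ?_
    congr 1
    change ((Fintype.card (Fin (n + 1)) : ℝ))⁻¹ = _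
    simp
  have e2 : g i = ∑ _j : Fin (n + 1), ((n : ℝ) + 1)⁻¹ • g i := by
    rw [Finset.sum_const, Finset.card_univ, Fintype.card_fin, ← Nat.cast_smul_eq_nsmul ℝ, smul_smul]
    push_cast
    rw [mul_inv_cancel₀ hn0.ne', one_smul]
  have hle : ∀ j, dist (g i) (g j) ≤ if j = i then 0 else δ := by
    intro j
    split_ifs with hj
    · simp [hj]
    · exact h _ (List.get_mem (v :: l) i) _ (List.get_mem (v :: l) j)
  have : dist (g i) ((bary v l : stdSimplex ℝ (Fin (q + 1))) : Fin (q + 1) → ℝ) ≤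
      n / (n + 1) * δ := by
    rw [dist_eq_norm, e]
    conv_lhs => rw [e2]
    rw [← Finset.sum_sub_distrib]
    refine (norm_sum_le _ _).trans ?_
    calc ∑ j, ‖((n : ℝ) + 1)⁻¹ • g i - ((n : ℝ) + 1)⁻¹ • g j‖
        ≤ ∑ j, ((n : ℝ) + 1)⁻¹ * (if j = i then 0 else δ) := by
          refine Finset.sum_le_sum fun j _ => ?_
          rw [← smul_sub, norm_smul, Real.norm_of_nonneg (by positivity), ← dist_eq_norm]
          exact mul_le_mul_of_nonneg_left (hle j) (by positivity)
      _ = n / (n + 1) * δ := by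
          rw [← Finset.mul_sum, Finset.sum_ite, Finset.sum_const_zero, zero_add, Finset.sum_const,
            Finset.filter_ne', Finset.card_erase_of_mem (Finset.mem_univ _), Finset.card_univ,
            Fintype.card_fin, List.length_cons, Nat.add_sub_cancel, nsmul_eq_mul, ← mul_assoc,
            inv_mul_eq_div]
  refine this.trans (mul_le_mul_of_nonneg_right ?_ hδ)
  rw [div_le_div_iff₀ hn0 (by positivity)]
  have : (n : ℝ) ≤ N := by exact_mod_cast hN
  nlinarith

/-- The simplices of the subdivision of `l`: they lie in the convex hull of `l` and are smaller. -/
theorem subdiv_mem {N : ℕ} {δ : ℝ} (hδ : 0 ≤ δ) {l : List (stdSimplex ℝ (Fin (q + 1)))}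
    (hN : l.length ≤ N + 1) (h : ∀ x ∈ l, ∀ y ∈ l, dist x y ≤ δ) :
    subdiv (of l) ∈ chains {l' : List (stdSimplex ℝ (Fin (q + 1))) | l'.length = l.length ∧
      (∀ S, AffClosed S → (∀ x ∈ l, x ∈ S) → ∀ x ∈ l', x ∈ S) ∧
      ∀ x ∈ l', ∀ y ∈ l', dist x y ≤ N / (N + 1) * δ} := by
  induction hn : l.length generalizing l with
  | zero =>
    rw [List.length_eq_zero_iff.1 hn, subdiv_nil]
    exact of_mem_chains (by simp)
  | succ n ih =>
    cases l with
    | nil => simp at hn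
    | cons v l =>
      rw [subdiv_cons]
      have hn' : l.length = n := by simpa using hn
      refine cone_mem_chains (Q := {l' : List (stdSimplex ℝ (Fin (q + 1))) | l'.length = n ∧
        (∀ S, AffClosed S → (∀ x ∈ v :: l, x ∈ S) → ∀ x ∈ l', x ∈ S) ∧
        ∀ x ∈ l', ∀ y ∈ l', dist x y ≤ N / (N + 1) * δ}) ?_
        (map_mem_of_chains _ ?_ (bd_mem_chains v l))
      · rintro l' ⟨h1, h2, h3⟩
        -- A ball around the barycentre is convex; as it contains the vertices of the simplex, it
        -- contains all vertices of the subdivided faces.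
        have hb : ∀ x ∈ l', dist x (bary v l) ≤ N / (N + 1) * δ :=
          h2 (Metric.closedBall (bary v l) _) (affClosed_closedBall _ _) fun x hx =>
            dist_bary_le (by simpa using hN) hδ h hx
        refine ⟨by simp [h1], fun S hS hl x hx => ?_, fun x hx y hy => ?_⟩
        · rcases List.mem_cons.1 hx with rfl | hx
          · exact hS.bary_mem hl
          · exact h2 S hS hl x hx
        · rcases List.mem_cons.1 hx with rfl | hx <;> rcases List.mem_cons.1 hy with rfl | hy
          · rw [dist_self]
            positivity
          · rw [dist_comm]
            exact hb y hy
          · exact hb x hx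
          · exact h3 x hx y hy
      · rintro l' ⟨h1, h2⟩
        have := ih (l := l') (by omega) (fun x hx y hy => h x (h2 hx) y (h2 hy)) (by omega)
        refine (AddSubgroup.closure_mono (Set.image_mono ?_)) this
        rintro l'' ⟨h3, h4, h5⟩
        exact ⟨by omega, fun S hS hl => h4 S hS fun x hx => hl x (h2 hx), h5⟩

theorem subdivPow_idChain_mem (m : ℕ) : subdivPow m (idChain q) ∈
    chains {l : List (stdSimplex ℝ (Fin (q + 1))) | l.length = q + 1 ∧
      ∀ x ∈ l, ∀ y ∈ l, dist x y ≤ ((q : ℝ) / (q + 1)) ^ m} := by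
  induction m with
  | zero =>
    refine of_mem_chains ⟨by simp, fun x _ y _ => ?_⟩
    rw [pow_zero]
    exact (Metric.dist_le_diam_of_mem (bounded_stdSimplex _) x.2 y.2).trans diam_stdSimplex_le
  | succ m ih =>
    rw [subdivPow_succ]
    refine map_mem_of_chains _ ?_ ih
    rintro l ⟨h1, h2⟩
    refine (AddSubgroup.closure_mono (Set.image_mono ?_))
      (subdiv_mem (N := q) (by positivity) h1.le h2)
    rintro l' ⟨h3, -, h4⟩
    exact ⟨h3.trans h1, by rwa [pow_succ']⟩

end Diameter

/-! ## Small simplices -/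

variable {X X' : Type*} [TopologicalSpace X] [TopologicalSpace X'] {p q : ℕ}

/-- Total cochains which vanish on the simplices contained in a member of `𝒴`. -/
def relF (𝒴 : Set (Set X)) : AddSubgroup (Tot X) where
  carrier := {φ | ∀ (q : ℕ) (σ : Simplex q X), ∀ Y ∈ 𝒴, range σ ⊆ Y → φ q σ = 0}
  zero_mem' _ _ _ _ _ := rfl
  add_mem' ha hb q σ Y hY h := by simp [ha q σ Y hY h, hb q σ Y hY h]
  neg_mem' ha q σ Y hY h := by simp [ha q σ Y hY h]

theorem ev_eq_zero_of_range {K : Type*} [TopologicalSpace K] [ConvSp K] {𝒴 : Set (Set X)}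
    {φ : Tot X} (hφ : φ ∈ relF 𝒴) {Y : Set X} (hY : Y ∈ 𝒴) {g : C(K, X)}
    {S : Set K} (hS : AffClosed S) (hg : S ⊆ g ⁻¹' Y) {l : List K} (h : ∀ x ∈ l, x ∈ S) :
    ev φ g (of l) = 0 := by
  obtain rfl | ⟨q, v, rfl⟩ := list_cases l
  · simp
  · rw [ev_ofFn]
    refine hφ q _ Y hY ?_
    rintro _ ⟨x, rfl⟩
    exact hg (hS q v x fun i => h _ (List.mem_ofFn.2 ⟨i, rfl⟩))

theorem ev_eq_zero {K : Type*} [TopologicalSpace K] [ConvSp K] {𝒴 : Set (Set X)}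
    {φ : Tot X} (hφ : φ ∈ relF 𝒴) {Y : Set X} (hY : Y ∈ 𝒴) {g : C(K, X)} (hg : range g ⊆ Y)
    (c : Aff K) : ev φ g c = 0 := by
  have : ev φ g = 0 := by
    ext l
    exact ev_eq_zero_of_range hφ hY (S := univ) (fun _ _ _ _ => mem_univ _)
      (fun x _ => hg ⟨x, rfl⟩) fun _ _ => mem_univ _
  simp [this]

theorem d_mem_relF {𝒴 : Set (Set X)} {φ : Tot X} (hφ : φ ∈ relF 𝒴) : d φ ∈ relF 𝒴 := by
  intro q σ Y hY h
  rw [← ev_idChain (d φ)]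
  refine (ev_bd φ σ _).trans ?_
  exact ev_eq_zero hφ hY h _

/-- A Lebesgue number of the covering pulled back to the standard simplex is eventually larger than
the diameters. A small closed ball about one vertex serves as the convex set containing the whole
simplex, which keeps the smallness stable under `subdivHom`. -/
theorem exists_subdiv_small {𝒰 : Set (Set X)} (h𝒰 : ∀ x, ∃ U ∈ 𝒰, x ∈ interior U)
    (σ : Simplex q X) : ∃ m, ∀ k ≥ m, subdivPow k (idChain q) ∈
      chains {l | ∃ S, AffClosed S ∧ (∃ U ∈ 𝒰, S ⊆ σ ⁻¹' U) ∧ ∀ x ∈ l, x ∈ S} := by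
  obtain ⟨δ, hδ, h⟩ := lebesgue_number_lemma_of_metric (s := univ)
    (c := fun U : 𝒰 => σ ⁻¹' interior U.1) isCompact_univ
    (fun U => isOpen_interior.preimage σ.continuous) (fun x _ => by
      obtain ⟨U, hU, hx⟩ := h𝒰 (σ x)
      exact mem_iUnion.2 ⟨⟨U, hU⟩, hx⟩)
  have hlt : (q : ℝ) / (q + 1) < 1 := by
    rw [div_lt_one (by positivity)]
    linarith
  obtain ⟨m, hm⟩ := exists_pow_lt_of_lt_one hδ hlt
  refine ⟨m, fun k hk => ?_⟩
  refine (AddSubgroup.closure_mono (Set.image_mono ?_)) (subdivPow_idChain_mem k)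
  rintro l ⟨h1, h2⟩
  cases l with
  | nil => simp at h1
  | cons v l =>
    obtain ⟨U, hU⟩ := h v (mem_univ _)
    refine ⟨Metric.closedBall v (((q : ℝ) / (q + 1)) ^ k), affClosed_closedBall _ _,
      ⟨U.1, U.2, fun y hy => (interior_subset : interior U.1 ⊆ U.1) (hU ?_)⟩,
      fun x hx => h2 x hx v (by simp)⟩
    refine lt_of_le_of_lt (Metric.mem_closedBall.1 hy) (lt_of_le_of_lt ?_ hm)
    exact pow_le_pow_of_le_one (by positivity) hlt.le hk

theorem ev_eq_zero_of_small {𝒰 : Set (Set X)} {φ : Tot X} (hφ : φ ∈ relF 𝒰) {σ : Simplex q X}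
    {c : Aff (stdSimplex ℝ (Fin (q + 1)))}
    (hc : c ∈ chains {l | ∃ S, AffClosed S ∧ (∃ U ∈ 𝒰, S ⊆ σ ⁻¹' U) ∧ ∀ x ∈ l, x ∈ S}) :
    ev φ σ c = 0 := by
  have := map_mem_of_chains (ev φ σ) (R := ⊥) ?_ hc
  · simpa using this
  · rintro l ⟨S, hS, ⟨U, hU, hSU⟩, hl⟩
    exact ev_eq_zero_of_range hφ hU hS hSU hl

/-- All vertices created by the homotopy are barycentres of given vertices, so they stay in the same
convex set. -/
theorem subdivHom_small {𝒰 : Set (Set X)} {σ : Simplex q X}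
    {c : Aff (stdSimplex ℝ (Fin (q + 1)))}
    (hc : c ∈ chains {l | ∃ S, AffClosed S ∧ (∃ U ∈ 𝒰, S ⊆ σ ⁻¹' U) ∧ ∀ x ∈ l, x ∈ S}) :
    subdivHom c ∈ chains {l | ∃ S, AffClosed S ∧ (∃ U ∈ 𝒰, S ⊆ σ ⁻¹' U) ∧ ∀ x ∈ l, x ∈ S} := by
  refine map_mem_of_chains _ ?_ hc
  rintro l ⟨S, hS, hU, hl⟩
  refine AddSubgroup.closure_mono (Set.image_mono ?_) (subdivHom_mem hS hl)
  exact fun l' hl' => ⟨S, hS, hU, hl'⟩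

theorem reindex_id (σ : Simplex q X) : reindex σ id = σ := by
  ext x
  simp [reindex]

/-- Cochains which vanish on small simplices form an acyclic complex. -/
theorem acyclic_relF {𝒰 : Set (Set X)} (h𝒰 : ∀ x, ∃ U ∈ 𝒰, x ∈ interior U) (𝒱 : Set (Set X)) :
    Acyclic (relF 𝒰 ⊓ relF 𝒱) := by
  rintro φ ⟨hφ, hφ'⟩ hdφ
  choose m₀ hm₀ using fun (x : Σ q, Simplex q X) => exists_subdiv_small h𝒰 x.2
  -- The number of subdivisions has to depend on the simplex. The maximum over all simplices
  -- obtained by reindexing in dimensions up to `q` is monotone under passing to faces and still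
  -- finite.
  let m : ∀ q, Simplex q X → ℕ := fun q σ => Finset.sup (Finset.range (q + 1)) fun p =>
    Finset.sup Finset.univ fun f : Fin (p + 1) → Fin (q + 1) => m₀ ⟨p, reindex σ f⟩
  have hm : ∀ (q p : ℕ) (σ : Simplex q X) (f : Fin (p + 1) → Fin (q + 1)), p ≤ q →
      m₀ ⟨p, reindex σ f⟩ ≤ m q σ := fun q p σ f hp =>
    (Finset.le_sup (f := fun f : Fin (p + 1) → Fin (q + 1) => m₀ ⟨p, reindex σ f⟩)
      (Finset.mem_univ f)).trans (Finset.le_sup (f := fun p => Finset.sup Finset.univ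
        fun f : Fin (p + 1) → Fin (q + 1) => m₀ ⟨p, reindex σ f⟩) (Finset.mem_range.2 (by omega)))
  -- From `m q σ` on, every further term of the iterated homotopy is a combination of small
  -- simplices, where `φ` vanishes. Thus `φ` of the iterated homotopy stabilises.
  have hm' : ∀ (q : ℕ) (σ : Simplex q X) (k : ℕ), m q σ ≤ k → ev φ σ (subdivHomIter k (idChain q)) =
      ev φ σ (subdivHomIter (m q σ) (idChain q)) := by
    intro q σ k hk
    induction k, hk using Nat.le_induction with
    | base => rfl
    | succ k hk ih =>
      have h0 : m₀ ⟨q, σ⟩ ≤ k := by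
        have := hm q q σ id le_rfl
        rw [reindex_id] at this
        exact this.trans hk
      rw [subdivHomIter_succ, map_add, ih, ev_eq_zero_of_small hφ
        (subdivHom_small (hm₀ ⟨q, σ⟩ k h0)), add_zero]
  refine ⟨fun q σ => ev φ σ (subdivHomIter (m q σ) (idChain q)),
    ⟨fun q σ Y hY h => ev_eq_zero hφ hY h _, fun q σ Y hY h => ev_eq_zero hφ' hY h _⟩, ?_⟩
  ext q σ
  have h1 := bd_subdivHomIter (m q σ) (idChain q)
  have h2 := congrArg (ev φ σ) h1
  rw [← ev_bd, map_sub, map_sub, ev_idChain,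
    ev_eq_zero_of_small hφ (hm₀ ⟨q, σ⟩ (m q σ) (by simpa [reindex_id] using hm q q σ id le_rfl)),
    show totD φ = 0 from hdφ] at h2
  have h3 : ev (0 : Tot X) σ (subdivHomIter (m q σ) (idChain q)) = 0 :=
    ev_eq_zero (zero_mem (relF {univ})) rfl (subset_univ _) _
  rw [h3, sub_zero, eq_comm, sub_eq_zero] at h2
  rw [h2]
  -- By stabilisation, the value on a face may be computed with the number of subdivisions belonging
  -- to `σ`. The coboundary becomes `φ` on the homotopy of the boundary of `σ`, so the usual
  -- correction terms for differing numbers do not arise.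
  refine totD_apply_eq_sum _ σ ((ev φ σ).comp (subdivHomIter (m q σ)))
    (by simp [subdivHomIter_nil]) fun p f hp => ?_
  have hle : m p (reindex σ f) ≤ m q σ := by
    refine Finset.sup_le fun r hr => Finset.sup_le fun g _ => ?_
    rw [reindex_reindex]
    exact hm q r σ _ (by have := Finset.mem_range.1 hr; omega)
  rw [← hm' p (reindex σ f) _ hle, of_vertices_eq_push, AddMonoidHom.comp_apply,
    ← push_subdivHomIter (isAff_faceMap f), ev_push _ _ (isAff_faceMap f)]
  rfl

end SingCoh

end

noncomputable section

open Function Set DiffGroup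

namespace SingCoh

variable {X X' : Type*} [TopologicalSpace X] [TopologicalSpace X'] {p q : ℕ}

/-! ## Functoriality of relative cochains -/

theorem totMap_mem {f : C(X, X')} {𝒴 : Set (Set X)} {𝒴' : Set (Set X')}
    (h : ∀ Y ∈ 𝒴, ∃ Y' ∈ 𝒴', MapsTo f Y Y') {φ : Tot X'} (hφ : φ ∈ relF 𝒴') :
    totMap f φ ∈ relF 𝒴 := by
  intro q σ Y hY hσ
  obtain ⟨Y', hY', hf⟩ := h Y hY
  refine hφ q _ Y' hY' ?_
  rintro _ ⟨x, rfl⟩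
  exact hf (hσ ⟨x, rfl⟩)

theorem homotopyOp_mem {F : C(X × unitInterval, X')} {𝒴 : Set (Set X)} {𝒴' : Set (Set X')}
    (h : ∀ Y ∈ 𝒴, ∃ Y' ∈ 𝒴', ∀ x ∈ Y, ∀ t, F (x, t) ∈ Y') {φ : Tot X'} (hφ : φ ∈ relF 𝒴') :
    homotopyOp F φ ∈ relF 𝒴 := by
  intro q σ Y hY hσ
  obtain ⟨Y', hY', hf⟩ := h Y hY
  refine ev_eq_zero hφ hY' ?_ _
  rintro _ ⟨x, rfl⟩
  exact hf _ (hσ ⟨x.1, rfl⟩) x.2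

theorem totMap_sub_totMap {f g : C(X, X')} {F : C(X × unitInterval, X')}
    (h0 : ∀ x, F (x, 0) = f x) (h1 : ∀ x, F (x, 1) = g x) (φ : Tot X') :
    totMap g φ - totMap f φ = d (homotopyOp F φ) + homotopyOp F (d φ) := by
  have e0 : f = F.comp ((ContinuousMap.id X).prodMk (ContinuousMap.const X 0)) :=
    ContinuousMap.ext fun x => (h0 x).symm
  have e1 : g = F.comp ((ContinuousMap.id X).prodMk (ContinuousMap.const X 1)) :=
    ContinuousMap.ext fun x => (h1 x).symm
  rw [e0, e1]
  exact homotopyOp_spec F φ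

/-- Homotopy equivalences, compatible with families of subsets, induce isomorphisms. -/
theorem qIso_of_homotopyEquiv {f : C(X, X')} {g : C(X', X)} {F : C(X × unitInterval, X)}
    {G : C(X' × unitInterval, X')} {𝒴 : Set (Set X)} {𝒴' : Set (Set X')}
    (hF0 : ∀ x, F (x, 0) = g (f x)) (hF1 : ∀ x, F (x, 1) = x)
    (hG0 : ∀ x, G (x, 0) = f (g x)) (hG1 : ∀ x, G (x, 1) = x)
    (hf : ∀ Y ∈ 𝒴, ∃ Y' ∈ 𝒴', MapsTo f Y Y') (hg : ∀ Y' ∈ 𝒴', ∃ Y ∈ 𝒴, MapsTo g Y' Y)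
    (hF : ∀ Y ∈ 𝒴, ∃ Y' ∈ 𝒴, ∀ x ∈ Y, ∀ t, F (x, t) ∈ Y')
    (hG : ∀ Y ∈ 𝒴', ∃ Y' ∈ 𝒴', ∀ x ∈ Y, ∀ t, G (x, t) ∈ Y') :
    QIso (relF 𝒴') (relF 𝒴) (totMap f) :=
  QIso.of_homotopy_inverse (g := totMap g) (homotopyOp G) (homotopyOp F)
    (totMap_d f) (fun _ => totMap_mem hf) (totMap_d g) (fun _ => totMap_mem hg)
    (fun _ => homotopyOp_mem hG) (fun _ => homotopyOp_mem hF)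
    (fun φ _ => totMap_sub_totMap (f := f.comp g) (g := ContinuousMap.id X') hG0 hG1 φ)
    (fun φ _ => totMap_sub_totMap (f := g.comp f) (g := ContinuousMap.id X) hF0 hF1 φ)

theorem qIso_of_homeomorph (f : X ≃ₜ X') {𝒴 : Set (Set X)} {𝒴' : Set (Set X')}
    (hf : ∀ Y ∈ 𝒴, ∃ Y' ∈ 𝒴', MapsTo f Y Y') (hg : ∀ Y' ∈ 𝒴', ∃ Y ∈ 𝒴, MapsTo f.symm Y' Y) :
    QIso (relF 𝒴') (relF 𝒴) (totMap (f : C(X, X'))) :=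
  qIso_of_homotopyEquiv (f := (f : C(X, X'))) (g := (f.symm : C(X', X)))
    (F := ContinuousMap.fst) (G := ContinuousMap.fst) (by simp) (by simp) (by simp) (by simp)
    hf hg (fun Y hY => ⟨Y, hY, by simp⟩) (fun Y hY => ⟨Y, hY, by simp⟩)

theorem relF_singleton_empty : relF {(∅ : Set X)} = ⊤ := by
  refine eq_top_iff.2 fun φ _ q σ Y hY h => ?_
  rw [mem_singleton_iff.1 hY] at h
  obtain ⟨x⟩ : Nonempty (stdSimplex ℝ (Fin (q + 1))) := inferInstance
  exact (h ⟨x, rfl⟩).elim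

/-! ## Extension by zero -/

theorem exists_lift {e : C(X, X')} (he : Topology.IsEmbedding e) {σ : Simplex q X'}
    (h : range σ ⊆ range e) : ∃ τ : Simplex q X, e.comp τ = σ := by
  choose g hg using fun x => h ⟨x, rfl⟩
  refine ⟨⟨g, he.isInducing.continuous_iff.2 ?_⟩, ContinuousMap.ext hg⟩
  rw [show e ∘ g = σ from funext hg]
  exact σ.continuous

theorem comp_left_injective {e : C(X, X')} (he : Topology.IsEmbedding e) {σ τ : Simplex q X}
    (h : e.comp σ = e.comp τ) : σ = τ :=
  ContinuousMap.ext fun x => he.injective (DFunLike.congr_fun h x)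

open Classical in
/-- Extension of cochains by zero. -/
def extZero (e : C(X, X')) (φ : Tot X) : Tot X' := fun q σ =>
  if h : ∃ τ : Simplex q X, e.comp τ = σ then φ q h.choose else 0

theorem totMap_extZero {e : C(X, X')} (he : Topology.IsEmbedding e) (φ : Tot X) :
    totMap e (extZero e φ) = φ := by
  ext q σ
  have h : ∃ τ : Simplex q X, e.comp τ = e.comp σ := ⟨σ, rfl⟩
  rw [totMap_apply, extZero, dif_pos h, comp_left_injective he h.choose_spec]

theorem extZero_apply_of_not {e : C(X, X')} (φ : Tot X) {σ : Simplex q X'}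
    (h : ¬ range σ ⊆ range e) : extZero e φ q σ = 0 := by
  rw [extZero, dif_neg]
  rintro ⟨τ, rfl⟩
  refine h ?_
  rintro _ ⟨x, rfl⟩
  exact ⟨_, rfl⟩

theorem extZero_mem {e : C(X, X')} {φ : Tot X} {𝒴 : Set (Set X')}
    (hφ : φ ∈ relF ((fun Y => e ⁻¹' Y) '' 𝒴)) : extZero e φ ∈ relF 𝒴 := by
  intro q σ Y hY hσ
  by_cases h : ∃ τ : Simplex q X, e.comp τ = σ
  · rw [extZero, dif_pos h]
    refine hφ q _ _ ⟨Y, hY, rfl⟩ ?_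
    rintro _ ⟨x, rfl⟩
    refine hσ ⟨x, ?_⟩
    exact (DFunLike.congr_fun h.choose_spec x).symm
  · rw [extZero, dif_neg h]

theorem totMap_eq_zero_iff {e : C(X, X')} (he : Topology.IsEmbedding e) {φ : Tot X'} :
    totMap e φ = 0 ↔ φ ∈ relF {range e} := by
  constructor
  · rintro h q σ Y rfl hσ
    obtain ⟨τ, rfl⟩ := exists_lift he hσ
    exact congrFun (congrFun h q) τ
  · intro h
    ext q σ
    refine h q _ _ rfl ?_
    rintro _ ⟨x, rfl⟩
    exact ⟨_, rfl⟩

theorem totMap_mem_image {e : C(X, X')} {φ : Tot X'} {𝒴 : Set (Set X')} (hφ : φ ∈ relF 𝒴) :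
    totMap e φ ∈ relF ((fun Y => e ⁻¹' Y) '' 𝒴) := by
  refine totMap_mem ?_ hφ
  rintro _ ⟨Y, hY, rfl⟩
  exact ⟨Y, hY, fun _ h => h⟩

/-- Excision. -/
theorem qIso_excision {e : C(X, X')} (he : Topology.IsEmbedding e) {T : Set X'}
    (h : ∀ x, x ∈ interior T ∨ x ∈ interior (range e)) :
    QIso (relF {T}) (relF {e ⁻¹' T}) (totMap e) := by
  refine QIso.of_surjective (fun _ => d_mem_relF) (totMap_d e) (fun φ hφ => ?_) (fun φ hφ => ?_) ?_
  · simpa using totMap_mem_image (e := e) hφ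
  · exact ⟨extZero e φ, extZero_mem (by simpa using hφ), totMap_extZero he φ⟩
  -- The kernel of restriction consists of the cochains vanishing on simplices inside `T` or inside
  -- the image of `e`. The interiors of these two sets cover, so it is acyclic.
  · intro φ hφ h0 hd
    have h0 : φ ∈ relF {T, range e} := by
      rintro q σ Y (rfl | hY) hσ
      · exact hφ q σ _ rfl hσ
      · exact (totMap_eq_zero_iff he).1 h0 q σ Y hY hσ
    obtain ⟨ψ, ⟨h1, -⟩, h3⟩ := acyclic_relF (𝒰 := {T, range e}) (fun x => by simpa using h x)
      {T} φ ⟨h0, hφ⟩ hd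
    refine ⟨ψ, fun q σ Y hY => h1 q σ Y (by simp [mem_singleton_iff.1 hY]), ?_, h3⟩
    exact (totMap_eq_zero_iff he).2
      fun q σ Y hY => h1 q σ Y (by simp [mem_singleton_iff.1 hY])

/-- Cochains relative to an open set may be replaced by cochains relative to an open covering. -/
theorem qIso_sUnion {𝒰 : Set (Set X)} (h𝒰 : ∀ U ∈ 𝒰, IsOpen U) :
    QIso (relF {⋃₀ 𝒰}) (relF 𝒰) (AddMonoidHom.id _) := by
  let e : C(⋃₀ 𝒰, X) := ⟨Subtype.val, continuous_subtype_val⟩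
  have he : Topology.IsEmbedding e := Topology.IsEmbedding.subtypeVal
  have hr : range e = ⋃₀ 𝒰 := Subtype.range_val
  refine QIso.of_le (fun φ hφ q σ Y hY hσ => hφ q σ _ rfl (hσ.trans (subset_sUnion_of_mem hY)))
    fun φ hφ hdφ => ?_
  -- Modulo cochains vanishing on the whole union, only the restriction to the union matters. There
  -- the members of `𝒰` form an open covering, and the restricted cochain is a cocycle vanishing on
  -- small simplices.
  obtain ⟨ψ, ⟨h1, -⟩, h2⟩ := acyclic_relF (𝒰 := (fun Y => e ⁻¹' Y) '' 𝒰) (fun x => by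
      obtain ⟨U, hU, hx⟩ := x.2
      refine ⟨_, ⟨U, hU, rfl⟩, ?_⟩
      rw [((h𝒰 U hU).preimage e.continuous).interior_eq]
      exact hx) ∅ (totMap e φ) ⟨totMap_mem_image hφ, fun _ _ _ h => h.elim⟩
    (by rw [← totMap_d, totMap_eq_zero_iff he, hr]; exact hdφ)
  refine ⟨extZero e ψ, extZero_mem h1, ?_⟩
  have h3 : φ - d (extZero e ψ) ∈ relF {range e} := by
    rw [← totMap_eq_zero_iff he, map_sub, totMap_d, totMap_extZero he, h2, sub_self]
  rwa [hr] at h3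

/-- Cochains relative to a subset which is weakly equivalent to a larger one. -/
theorem qIso_of_subset {Z : Type*} [TopologicalSpace Z] {e : C(X, X')} {i : C(Z, X)}
    (he : Topology.IsEmbedding e) (hi : Topology.IsEmbedding i) (h : QIso ⊤ ⊤ (totMap i)) :
    QIso (relF {range e}) (relF {range (e.comp i)}) (AddMonoidHom.id _) := by
  have hei : Topology.IsEmbedding (e.comp i) := he.comp hi
  refine QIso.of_le (fun φ hφ => ?_) fun φ hφ hdφ => ?_
  · rw [← totMap_eq_zero_iff hei, totMap_comp, (totMap_eq_zero_iff he).2 hφ, map_zero]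
  -- The quotient of the two relative complexes is the kernel of restriction from `X` to `Z`, which
  -- is acyclic; a primitive there is extended by zero.
  · obtain ⟨ψ, -, h1, h2⟩ := h.acyclic_ker (fun _ _ => trivial)
      (fun φ _ => ⟨extZero i φ, trivial, totMap_extZero hi φ⟩) (x := totMap e φ) trivial
      (by rw [← totMap_comp]; exact (totMap_eq_zero_iff hei).2 hφ)
      (by rw [← totMap_d]; exact (totMap_eq_zero_iff he).2 hdφ)
    refine ⟨extZero e ψ, ?_, ?_⟩
    · rw [← totMap_eq_zero_iff hei, totMap_comp, totMap_extZero he, h1]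
    · rw [← totMap_eq_zero_iff he, map_sub, totMap_d, totMap_extZero he, h2, sub_self]

/-! ## Homogeneous cochains -/

/-- A cochain as a total cochain. -/
def single (q : ℕ) : Cochain q X →+ Tot X := AddMonoidHom.single (fun q => Cochain q X) q

@[simp]
theorem single_same (φ : Cochain q X) : single q φ q = φ :=
  Pi.single_eq_same (M := fun q => Cochain q X) q φ

theorem single_of_ne (φ : Cochain q X) (h : p ≠ q) : single q φ p = 0 :=
  Pi.single_eq_of_ne (M := fun q => Cochain q X) h φ

theorem d_single (φ : Cochain q X) : d (single q φ) = single (q + 1) (coboundary q φ) := by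
  funext r
  rcases r with - | r
  · rw [single_of_ne _ (by omega)]
    rfl
  · change coboundary r (single q φ r) = _
    by_cases h : r = q
    · subst h
      simp
    · rw [single_of_ne _ h, single_of_ne _ (by omega), map_zero]

theorem d_succ (φ : Tot X) : d φ (q + 1) = coboundary q (φ q) := rfl

theorem d_zero_apply (φ : Tot X) : d φ 0 = 0 := rfl

theorem single_mem {Y : Set X} {φ : Cochain q X} (h : φ ∈ relCochains q Y) :
    single q φ ∈ relF {Y} := by
  rintro r σ _ rfl hσ
  by_cases hr : r = q
  · subst hr
    simpa using h σ hσ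
  · rw [single_of_ne _ hr]
    rfl

theorem mem_relCochains {Y : Set X} {φ : Tot X} (h : φ ∈ relF {Y}) (q : ℕ) :
    φ q ∈ relCochains q Y := fun σ hσ => h q σ Y rfl hσ

theorem d_mem_relCoboundaries {Y : Set X} {φ : Tot X} (h : φ ∈ relF {Y}) (q : ℕ) :
    d φ q ∈ relCoboundaries q Y := by
  cases q with
  | zero => exact zero_mem _
  | succ q => exact ⟨φ q, mem_relCochains h q, rfl⟩

theorem exists_d_eq_single {Y : Set X} {φ : Cochain q X} (h : φ ∈ relCoboundaries q Y) :
    ∃ ψ ∈ relF {Y}, d ψ = single q φ := by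
  cases q with
  | zero =>
    rw [show φ = 0 from h]
    exact ⟨0, zero_mem _, by simp⟩
  | succ q =>
    obtain ⟨α, hα, rfl⟩ := h
    exact ⟨single q α, single_mem hα, d_single α⟩

theorem relCoboundaries_mono {Y Y' : Set X} (h : Y ⊆ Y') :
    relCoboundaries q Y' ≤ relCoboundaries q Y :=
  fun _ hφ => cochainMap_mem_relCoboundaries (f := ContinuousMap.id X) h hφ

theorem H.mk_surjective (Y : Set X) : Surjective (H.mk q Y) := QuotientAddGroup.mk'_surjective _

theorem H.mk_eq_zero_iff {Y : Set X} {φ : relCocycles q Y} :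
    H.mk q Y φ = 0 ↔ φ.1 ∈ relCoboundaries q Y := QuotientAddGroup.eq_zero_iff _

theorem H.mk_eq_mk_iff {Y : Set X} {φ ψ : relCocycles q Y} :
    H.mk q Y φ = H.mk q Y ψ ↔ φ.1 - ψ.1 ∈ relCoboundaries q Y := by
  rw [← sub_eq_zero, ← map_sub, H.mk_eq_zero_iff]
  rfl

theorem pullback_mk (f : C(X, X')) {Y : Set X} {Y' : Set X'} (h : MapsTo f Y Y')
    (φ : relCocycles q Y') : pullback q f h (H.mk q Y' φ) =
      H.mk q Y ⟨cochainMap q f φ.1, cochainMap_mem_relCocycles h φ.2⟩ := rfl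

/-- A homomorphism of cohomology groups given on cochains by the degree `q` part of a homomorphism
of total cochains of degree `k - q`. -/
theorem bijective_of_qIso {Y : Set X} {Y' : Set X'} {k : ℕ} {G : Tot X' →+ Tot X}
    (hG : QIso (relF {Y'}) (relF {Y}) G) (g : Cochain q X' → Cochain k X)
    (hgk : ∀ φ : Tot X', G φ k = g (φ q))
    (hgs : ∀ φ : Cochain q X', G (single q φ) = single k (g φ))
    (h : H q X' Y' →+ H k X Y)
    (hh : ∀ φ, ∃ ψ, h (H.mk q Y' φ) = H.mk k Y ψ ∧ ψ.1 = g φ.1) : Bijective h := by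
  constructor
  · rw [injective_iff_map_eq_zero]
    intro x hx
    obtain ⟨φ, rfl⟩ := H.mk_surjective _ x
    obtain ⟨ψ, h1, h2⟩ := hh φ
    rw [h1, H.mk_eq_zero_iff, h2] at hx
    obtain ⟨w, hw, hw'⟩ := exists_d_eq_single hx
    obtain ⟨z, hz, hz'⟩ := hG.inj (single_mem φ.2.1)
      (by rw [d_single, show coboundary q φ.1 = 0 from φ.2.2, map_zero]) hw (by rw [hgs, hw'])
    rw [H.mk_eq_zero_iff, ← single_same φ.1, ← hz']
    exact d_mem_relCoboundaries hz q
  · intro y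
    obtain ⟨ψ, rfl⟩ := H.mk_surjective _ y
    obtain ⟨z, hz, hz', w, hw, hw'⟩ := hG.surj (single_mem ψ.2.1)
      (by rw [d_single, show coboundary k ψ.1 = 0 from ψ.2.2, map_zero])
    -- The preimage `z` may be inhomogeneous, but the differential respects degrees, so its
    -- component in degree `q` is a cocycle and alone determines the component in degree `k` of the
    -- image.
    have hc : z q ∈ relCocycles q Y' := ⟨mem_relCochains hz q, congrFun hz' (q + 1)⟩
    refine ⟨H.mk q Y' ⟨z q, hc⟩, ?_⟩
    obtain ⟨ψ', h1, h2⟩ := hh ⟨z q, hc⟩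
    rw [h1, H.mk_eq_mk_iff, h2]
    have h3 := congrFun hw' k
    rw [single_same] at h3
    rw [← h3, ← hgk]
    simpa using d_mem_relCoboundaries hw k

theorem bijective_pullback {f : C(X, X')} {Y : Set X} {Y' : Set X'} (h : MapsTo f Y Y')
    (hf : QIso (relF {Y'}) (relF {Y}) (totMap f)) (q : ℕ) : Bijective (pullback q f h) := by
  refine bijective_of_qIso hf (cochainMap q f) (fun _ => rfl) (fun φ => ?_) _
    fun φ => ⟨_, pullback_mk f h φ, rfl⟩
  funext r
  by_cases hr : r = q
  · subst hr
    rw [single_same]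
    change cochainMap r f (single r φ r) = _
    rw [single_same]
  · rw [single_of_ne _ hr]
    change cochainMap r f (single q φ r) = _
    rw [single_of_ne _ hr, map_zero]

theorem pullback_comp_apply {X'' : Type*} [TopologicalSpace X''] {f : C(X, X')} {g : C(X', X'')}
    {Y : Set X} {Y' : Set X'} {Y'' : Set X''} (hf : MapsTo f Y Y') (hg : MapsTo g Y' Y'')
    (x : H q X'' Y'') : pullback q f hf (pullback q g hg x) =
      pullback q (g.comp f) (hg.comp hf) x := by
  obtain ⟨φ, rfl⟩ := H.mk_surjective _ x
  rfl

theorem pullback_congr {f g : C(X, X')} {Y : Set X} {Y' : Set X'} (hf : MapsTo f Y Y')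
    (hg : MapsTo g Y Y') (h : f = g) : pullback q f hf = pullback q g hg := by
  subst h
  rfl

theorem pullback_id_apply {Y : Set X} (h : MapsTo (ContinuousMap.id X) Y Y) (x : H q X Y) :
    pullback q (ContinuousMap.id X) h x = x := by
  obtain ⟨φ, rfl⟩ := H.mk_surjective _ x
  rfl

theorem pullback_eq_of_homotopy {f g : C(X, X')} {F : C(X × unitInterval, X')}
    (h0 : ∀ x, F (x, 0) = f x) (h1 : ∀ x, F (x, 1) = g x) {Y : Set X} {Y' : Set X'}
    (hf : MapsTo f Y Y') (hg : MapsTo g Y Y') (hF : ∀ x ∈ Y, ∀ t, F (x, t) ∈ Y') :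
    pullback q f hf = pullback q g hg := by
  ext x
  obtain ⟨φ, rfl⟩ := H.mk_surjective _ x
  rw [pullback_mk, pullback_mk, eq_comm, H.mk_eq_mk_iff]
  have := congrFun (totMap_sub_totMap h0 h1 (single q φ.1)) q
  rw [d_single, show coboundary q φ.1 = 0 from φ.2.2, map_zero, map_zero, add_zero] at this
  have h2 : (totMap g (single q φ.1) - totMap f (single q φ.1)) q =
      cochainMap q g φ.1 - cochainMap q f φ.1 := by
    change cochainMap q g (single q φ.1 q) - cochainMap q f (single q φ.1 q) = _
    rw [single_same]
  rw [h2] at this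
  rw [this]
  refine d_mem_relCoboundaries (homotopyOp_mem ?_ (single_mem φ.2.1)) q
  rintro _ rfl
  exact ⟨Y', rfl, hF⟩

/-! ## The long exact sequence of a pair -/

section Exact

variable {e : C(X, X')}

/-- Exactness at `H^q(X')`: a primitive of the restriction is extended by zero, and subtracting the
coboundary of this extension makes the cocycle vanish on the simplices of the subspace. -/
theorem exists_rel_of_restrict_coboundary (he : Topology.IsEmbedding e)
    {φ : Cochain q X'} (hφ : φ ∈ relCocycles q (∅ : Set X'))
    (h : cochainMap q e φ ∈ relCoboundaries q (∅ : Set X)) :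
    ∃ ψ ∈ relCocycles q (range e), φ - ψ ∈ relCoboundaries q (∅ : Set X') := by
  obtain ⟨β, -, hβ⟩ := exists_d_eq_single h
  have h1 : d (extZero e β) q ∈ relCoboundaries q (∅ : Set X') :=
    d_mem_relCoboundaries (by rw [relF_singleton_empty]; trivial) q
  refine ⟨φ - d (extZero e β) q, ⟨fun σ hσ => ?_, ?_⟩, by simpa using h1⟩
  · obtain ⟨τ, rfl⟩ := exists_lift he hσ
    have h2 : totMap e (d (extZero e β)) q τ = single q (cochainMap q e φ) q τ := by
      rw [totMap_d, totMap_extZero he, hβ]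
    rw [single_same] at h2
    change φ (e.comp τ) - _ = 0
    rw [sub_eq_zero]
    exact h2.symm
  · change coboundary q _ = 0
    have h3 : coboundary q (d (extZero e β) q) = 0 := congrFun (d_d (extZero e β)) (q + 1)
    rw [map_sub, h3, show coboundary q φ = 0 from hφ.2, sub_zero]

theorem pullback_injective_of_rel (he : Topology.IsEmbedding e)
    (h : Subsingleton (H q X' (range e))) :
    Injective (pullback q e (mapsTo_empty _ _) : H q X' ∅ →+ H q X ∅) := by
  rw [injective_iff_map_eq_zero]
  intro x hx
  obtain ⟨φ, rfl⟩ := H.mk_surjective _ x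
  rw [pullback_mk, H.mk_eq_zero_iff] at hx
  obtain ⟨ψ, hψ, h1⟩ := exists_rel_of_restrict_coboundary he φ.2 hx
  have h2 : H.mk q (range e) ⟨ψ, hψ⟩ = 0 := Subsingleton.elim _ _
  rw [H.mk_eq_zero_iff] at h2
  rw [H.mk_eq_zero_iff, ← sub_add_cancel φ.1 ψ]
  exact add_mem h1 (relCoboundaries_mono (empty_subset _) h2)

/-- The coboundary of the extension by zero is a relative cocycle representing the image under the
connecting homomorphism. A relative primitive of it corrects the extension to a cocycle without
changing the restriction. -/
theorem pullback_surjective_of_rel (he : Topology.IsEmbedding e)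
    (h : Subsingleton (H (q + 1) X' (range e))) :
    Surjective (pullback q e (mapsTo_empty _ _) : H q X' ∅ →+ H q X ∅) := by
  intro y
  obtain ⟨φ, rfl⟩ := H.mk_surjective _ y
  set ψ := extZero e (single q φ.1) with hψ
  have h1 : coboundary q (ψ q) ∈ relCocycles (q + 1) (range e) := by
    refine ⟨mem_relCochains (φ := d ψ) ?_ (q + 1), congrFun (d_d ψ) (q + 2)⟩
    rw [← totMap_eq_zero_iff he, totMap_d, hψ, totMap_extZero he, d_single,
      show coboundary q φ.1 = 0 from φ.2.2, map_zero]
  have h2 : H.mk (q + 1) (range e) ⟨_, h1⟩ = 0 := Subsingleton.elim _ _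
  rw [H.mk_eq_zero_iff] at h2
  obtain ⟨α, hα, h3⟩ := h2
  refine ⟨H.mk q ∅ ⟨ψ q - α, ⟨?_, ?_⟩⟩, ?_⟩
  · exact mem_relCochains (φ := single q (ψ q - α)) (by rw [relF_singleton_empty]; trivial) q
      |> fun h => by simpa using h
  · change coboundary q _ = 0
    rw [map_sub, h3, sub_self]
  · rw [pullback_mk]
    congr 1
    ext σ
    change ψ q (e.comp σ) - α (e.comp σ) = φ.1 σ
    have h4 : α (e.comp σ) = 0 := hα _ (range_comp_subset_range σ e)
    have h5 : totMap e ψ q σ = single q φ.1 q σ := by rw [hψ, totMap_extZero he]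
    rw [single_same] at h5
    rw [h4, sub_zero]
    exact h5

theorem toAbs_surjective_of_sub (he : Topology.IsEmbedding e)
    (h : Subsingleton (H q X ∅)) :
    Surjective (pullback q (ContinuousMap.id X') (mapsTo_empty _ _) :
      H q X' (range e) →+ H q X' ∅) := by
  intro x
  obtain ⟨φ, rfl⟩ := H.mk_surjective _ x
  have h0 : pullback q e (mapsTo_empty _ _) (H.mk q ∅ φ) = (0 : H q X ∅) := Subsingleton.elim _ _
  rw [pullback_mk, H.mk_eq_zero_iff] at h0
  obtain ⟨ψ, hψ, h1⟩ := exists_rel_of_restrict_coboundary he φ.2 h0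
  refine ⟨H.mk q _ ⟨ψ, hψ⟩, ?_⟩
  rw [pullback_mk, eq_comm, H.mk_eq_mk_iff]
  exact h1

/-- An absolute primitive `α` of a relative cocycle restricts to a cocycle on the subspace. Since
that restriction is a coboundary, `α` can be changed by a coboundary until it is a relative cochain.
-/
theorem toAbs_injective_of_sub (he : Topology.IsEmbedding e)
    (h : Subsingleton (H q X ∅)) :
    Injective (pullback (q + 1) (ContinuousMap.id X') (mapsTo_empty _ _) :
      H (q + 1) X' (range e) →+ H (q + 1) X' ∅) := by
  rw [injective_iff_map_eq_zero]
  intro x hx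
  obtain ⟨φ, rfl⟩ := H.mk_surjective _ x
  rw [pullback_mk, H.mk_eq_zero_iff] at hx
  obtain ⟨α, -, hα⟩ := hx
  have hα : coboundary q α = φ.1 := hα
  have hc : cochainMap q e α ∈ relCocycles q (∅ : Set X) := by
    refine ⟨fun σ hσ => ?_, ?_⟩
    · exact mem_relCochains (φ := single q (cochainMap q e α))
        (by rw [relF_singleton_empty]; trivial) q |> fun h => by simpa using h σ hσ
    · change coboundary q _ = 0
      rw [coboundary_cochainMap, hα]
      ext σ
      exact φ.2.1 _ (range_comp_subset_range σ e)
  have h0 : H.mk q ∅ ⟨_, hc⟩ = 0 := Subsingleton.elim _ _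
  rw [H.mk_eq_zero_iff] at h0
  obtain ⟨β, -, hβ⟩ := exists_d_eq_single h0
  rw [H.mk_eq_zero_iff]
  refine ⟨α - d (extZero e β) q, fun σ hσ => ?_, ?_⟩
  · obtain ⟨τ, rfl⟩ := exists_lift he hσ
    have h2 : totMap e (d (extZero e β)) q τ = single q (cochainMap q e α) q τ := by
      rw [totMap_d, totMap_extZero he, hβ]
    rw [single_same] at h2
    change α (e.comp τ) - _ = 0
    rw [sub_eq_zero]
    exact h2.symm
  · have h3 : coboundary q (d (extZero e β) q) = 0 := congrFun (d_d (extZero e β)) (q + 1)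
    rw [map_sub, h3, hα, sub_zero]

end Exact

end SingCoh

end

noncomputable section

open Function Set DiffGroup

namespace SingCoh

variable {X X' : Type*} [TopologicalSpace X] [TopologicalSpace X'] {p q s t : ℕ}

/-! ## Cup products with a fixed cochain -/

/-- The cup product of total cochains with a cochain `τ` of degree `s`, on the right. -/
def cupR (τ : Cochain s X) : Tot X →+ Tot X where
  toFun φ := fun k σ => if h : s ≤ k then
    φ (k - s) (reindex σ fun i => ⟨i, by omega⟩) * τ (reindex σ fun i => ⟨k - s + i, by omega⟩)
    else 0
  map_zero' := by
    ext k σ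
    simp
  map_add' φ ψ := by
    ext k σ
    by_cases h : s ≤ k <;> simp [h, add_mul]

theorem cupR_apply (τ : Cochain s X) (φ : Tot X) {k : ℕ} (h : s ≤ k) (σ : Simplex k X) :
    cupR τ φ k σ = φ (k - s) (reindex σ fun i => ⟨i, by omega⟩) *
      τ (reindex σ fun i => ⟨k - s + i, by omega⟩) := dif_pos h

theorem cupR_apply_of_lt (τ : Cochain s X) (φ : Tot X) {k : ℕ} (h : k < s) :
    cupR τ φ k = 0 := by
  ext σ
  exact dif_neg (by omega)

theorem cupR_apply_of_eq (τ : Cochain s X) (φ : Tot X) {k : ℕ} (h : k = q + s) (σ : Simplex k X) :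
    cupR τ φ k σ = φ q (reindex σ fun i => ⟨i, by omega⟩) *
      τ (reindex σ fun i => ⟨q + i, by omega⟩) := by
  obtain rfl : q = k - s := by omega
  exact cupR_apply τ φ (by omega) σ

theorem cupR_add (τ : Cochain s X) (φ : Tot X) (q : ℕ) :
    cupR τ φ (q + s) = cupCochain (φ q) τ := by
  ext σ
  exact cupR_apply_of_eq τ φ rfl σ

theorem cupR_single (τ : Cochain s X) (φ : Cochain q X) :
    cupR τ (single q φ) = single (q + s) (cupCochain φ τ) := by
  funext k
  by_cases hk : k < s
  · rw [cupR_apply_of_lt _ _ hk, single_of_ne _ (by omega)]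
  · obtain ⟨j, rfl⟩ : ∃ j, k = j + s := ⟨k - s, by omega⟩
    rw [cupR_add]
    by_cases h : j = q
    · subst h
      rw [single_same, single_same]
    · rw [single_of_ne _ h, single_of_ne _ (by omega)]
      ext σ
      simp [cupCochain]

theorem totMap_cupR (f : C(X, X')) (τ : Cochain s X') (φ : Tot X') :
    totMap f (cupR τ φ) = cupR (cochainMap s f τ) (totMap f φ) := rfl

theorem cupR_mem_left {𝒴 : Set (Set X)} (τ : Cochain s X) {φ : Tot X} (h : φ ∈ relF 𝒴) :
    cupR τ φ ∈ relF 𝒴 := by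
  intro k σ Y hY hσ
  by_cases hk : s ≤ k
  · rw [cupR_apply _ _ hk, h _ _ Y hY ((range_reindex_subset σ _).trans hσ), zero_mul]
  · exact dif_neg hk

theorem cupR_mem_right {𝒴 : Set (Set X)} {τ : Cochain s X} (h : ∀ Y ∈ 𝒴, τ ∈ relCochains s Y)
    (φ : Tot X) : cupR τ φ ∈ relF 𝒴 := by
  intro k σ Y hY hσ
  by_cases hk : s ≤ k
  · rw [cupR_apply _ _ hk, h Y hY _ ((range_reindex_subset σ _).trans hσ), mul_zero]
  · exact dif_neg hk

theorem cupR_zero_left (φ : Tot X) : cupR (0 : Cochain s X) φ = 0 := by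
  ext k σ
  simp [cupR]

theorem cupR_add_left (τ τ' : Cochain s X) (φ : Tot X) :
    cupR (τ + τ') φ = cupR τ φ + cupR τ' φ := by
  ext k σ
  by_cases h : s ≤ k <;> simp [cupR, h, mul_add]

theorem cupR_one (φ : Tot X) : cupR (fun _ => 1 : Cochain 0 X) φ = φ := by
  funext k
  refine (cupR_add _ φ k).trans ?_
  ext σ
  simp only [cupCochain, mul_one]
  congr 1
  exact reindex_id σ

/-- Associativity holds exactly on cochains with front and back faces, so iterated Thom maps compose
without a homotopy. -/
theorem cupR_cupCochain (τ : Cochain s X) (τ' : Cochain t X) (φ : Tot X) :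
    cupR (cupCochain τ τ') φ = cupR τ' (cupR τ φ) := by
  ext k σ
  by_cases h : s + t ≤ k
  · obtain ⟨j, rfl⟩ : ∃ j, k = j + s + t := ⟨k - (s + t), by omega⟩
    rw [cupR_apply_of_eq (q := j) _ _ (by omega), cupR_apply_of_eq (q := j + s) _ _ rfl,
      cupR_apply_of_eq (q := j) _ _ rfl, cupCochain]
    simp only [reindex_reindex, ← mul_assoc]
    congr 3
    ext i
    simp [back]
    omega
  · by_cases h' : t ≤ k
    · rw [cupR_apply_of_lt _ _ (by omega), cupR_apply _ _ h', cupR_apply_of_lt _ _ (by omega)]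
      simp
    · rw [cupR_apply_of_lt _ _ (by omega), cupR_apply_of_lt _ _ (by omega)]

/-- The sign `(-1)^q` in degree `q`. -/
def sgn : Tot X →+ Tot X where
  toFun φ q := (-1 : ℤ) ^ q • φ q
  map_zero' := by ext; simp
  map_add' φ ψ := by ext; simp [mul_add]

theorem sgn_sgn (φ : Tot X) : sgn (sgn φ) = φ := by
  funext q
  change (-1 : ℤ) ^ q • (-1 : ℤ) ^ q • φ q = φ q
  rw [smul_smul, ← mul_pow]
  simp

theorem d_sgn (φ : Tot X) : d (sgn φ) = - sgn (d φ) := by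
  funext q
  cases q with
  | zero =>
    change (0 : Cochain 0 X) = -((-1 : ℤ) ^ 0 • (0 : Cochain 0 X))
    simp
  | succ q =>
    change coboundary q ((-1 : ℤ) ^ q • φ q) = -((-1 : ℤ) ^ (q + 1) • coboundary q (φ q))
    rw [map_zsmul, pow_succ]
    simp

theorem sgn_mem {𝒴 : Set (Set X)} {φ : Tot X} (h : φ ∈ relF 𝒴) : sgn φ ∈ relF 𝒴 := by
  intro q σ Y hY hσ
  change (-1 : ℤ) ^ q • φ q σ = 0
  rw [h q σ Y hY hσ, smul_zero]

theorem totMap_sgn (f : C(X, X')) (φ : Tot X') : totMap f (sgn φ) = sgn (totMap f φ) := rfl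

/-- The Leibniz rule. -/
theorem d_cupR (τ : Cochain s X) (φ : Tot X) :
    d (cupR τ φ) = cupR τ (d φ) + cupR (coboundary s τ) (sgn φ) := by
  ext k σ
  rw [Pi.add_apply, Pi.add_apply]
  cases k with
  | zero =>
    rw [d_zero_apply, cupR_apply_of_lt (coboundary s τ) _ (by omega)]
    by_cases h : s ≤ 0
    · obtain rfl : s = 0 := by omega
      rw [cupR_apply_of_eq (q := 0) _ _ rfl, d_zero_apply]
      simp
    · rw [cupR_apply_of_lt _ _ (by omega)]
      simp
  | succ k =>
    rw [d_succ]
    by_cases h : s ≤ k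
    · obtain ⟨j, rfl⟩ : ∃ j, k = j + s := ⟨k - s, by omega⟩
      rw [cupR_add, leibniz_apply, cupR_apply_of_eq (q := j + 1) _ _ (by omega),
        cupR_apply_of_eq (q := j) _ _ (by omega), d_succ]
      change _ = _ + (-1 : ℤ) ^ j • φ j _ * _
      rw [smul_eq_mul, mul_assoc]
      rfl
    · rw [cupR_apply_of_lt τ φ (by omega), cupR_apply_of_lt (coboundary s τ) _ (by omega), map_zero]
      by_cases h' : s = k + 1
      · rw [cupR_apply_of_eq (q := 0) _ _ (by omega), d_zero_apply]
        simp
      · rw [cupR_apply_of_lt _ _ (by omega)]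
        simp

theorem d_cupR_of_cocycle {τ : Cochain s X} (h : coboundary s τ = 0) (φ : Tot X) :
    cupR τ (d φ) = d (cupR τ φ) := by
  rw [d_cupR, h, cupR_zero_left, add_zero]

theorem cupR_coboundary (τ : Cochain s X) (φ : Tot X) :
    cupR (coboundary s τ) φ = d (cupR τ (sgn φ)) + cupR τ (sgn (d φ)) := by
  rw [d_cupR, sgn_sgn, d_sgn, map_neg]
  abel

/-! ## The Thom isomorphism of a product with a Euclidean space -/

/-- The indicator of the positive half line. -/
def posCochain : Cochain 0 ℝ := fun σ => if 0 < σ default then 1 else 0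

/-- The generating cocycle of `(ℝ, ℝ \ 0)`. -/
def lineCochain : Cochain 1 ℝ := coboundary 0 posCochain

theorem range_subset_or {f : C(stdSimplex ℝ (Fin (q + 1)), ℝ)} (h : ∀ x, f x ≠ 0) :
    (∀ x, 0 < f x) ∨ ∀ x, f x < 0 := by
  by_contra! hc
  obtain ⟨⟨a, ha⟩, ⟨b, hb⟩⟩ := hc
  obtain ⟨x, hx⟩ := mem_range_of_exists_le_of_exists_ge f.continuous ⟨a, ha⟩ ⟨b, hb⟩
  exact h x hx

/-- A simplex missing the origin lies on one side of it, by connectedness, so the indicator takes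
equal values at both ends. The indicator itself is not a relative cochain, which is why its
coboundary can be a nontrivial relative class. -/
theorem lineCochain_mem : lineCochain ∈ relCochains 1 ({0}ᶜ : Set ℝ) := by
  intro σ hσ
  have h0 : ∀ x, σ x ≠ 0 := fun x => hσ ⟨x, rfl⟩
  have : ∀ f : Fin (0 + 1) → Fin (1 + 1),
      posCochain (reindex σ f) = if 0 < σ (stdSimplex.vertex 0) then 1 else 0 := by
    intro f
    rcases range_subset_or h0 with h | h
    · simp [posCochain, reindex, h]
    · exact (if_neg (not_lt.2 (h _).le)).trans (if_neg (not_lt.2 (h _).le)).symm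
  simp only [lineCochain, coboundary, AddMonoidHom.coe_mk, ZeroHom.coe_mk, this]
  simp [Fin.sum_univ_two]

section Line

variable (𝒴 : Set (Set X))

/-- The sets `Y × ℝ`, and the complement of the zero section. -/
def lineFamily : Set (Set (X × ℝ)) :=
  insert (Prod.snd ⁻¹' {0}ᶜ) ((fun Y => Prod.fst ⁻¹' Y) '' 𝒴)

/-- The cup product with the generator of `(ℝ, ℝ \ 0)`. -/
def lineThom : Tot X →+ Tot (X × ℝ) :=
  (cupR (cochainMap 1 ContinuousMap.snd lineCochain)).comp (totMap ContinuousMap.fst)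

/-- The inclusion of a product with a subset of the line. -/
def lineIncl (X : Type*) [TopologicalSpace X] (S : Set ℝ) : C(X × S, X × ℝ) :=
  (ContinuousMap.id X).prodMap ⟨Subtype.val, continuous_subtype_val⟩

theorem isEmbedding_lineIncl (S : Set ℝ) : Topology.IsEmbedding (lineIncl X S) :=
  Topology.IsEmbedding.id.prodMap Topology.IsEmbedding.subtypeVal

theorem mem_range_lineIncl {S : Set ℝ} {x : X × ℝ} : x ∈ range (lineIncl X S) ↔ x.2 ∈ S := by
  constructor
  · rintro ⟨y, rfl⟩
    exact y.2.2
  · intro h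
    exact ⟨(x.1, ⟨x.2, h⟩), rfl⟩

/-- The straight line homotopy in a product with a convex set. -/
def lineHomotopy (X : Type*) [TopologicalSpace X] {S : Set ℝ} (hS : Convex ℝ S) (c : S) :
    C((X × S) × unitInterval, X × S) where
  toFun x := (x.1.1, ⟨(1 - (x.2 : ℝ)) • (c : ℝ) + (x.2 : ℝ) • (x.1.2 : ℝ),
    hS c.2 x.1.2.2 (by linarith [x.2.2.2]) x.2.2.1 (by ring)⟩)
  continuous_toFun := by fun_prop

theorem qIso_fst_of_convex {S : Set ℝ} (hS : Convex ℝ S) (hne : S.Nonempty) :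
    QIso (relF 𝒴) (relF ((fun Y => (Prod.fst : X × S → X) ⁻¹' Y) '' 𝒴))
      (totMap (ContinuousMap.fst : C(X × S, X))) := by
  obtain ⟨c, hc⟩ := hne
  refine qIso_of_homotopyEquiv (g := (ContinuousMap.id X).prodMk (ContinuousMap.const X ⟨c, hc⟩))
    (F := lineHomotopy X hS ⟨c, hc⟩) (G := ContinuousMap.fst) ?_ ?_ ?_ ?_ ?_ ?_ ?_ ?_
  · intro x
    simp [lineHomotopy]
  · intro x
    simp [lineHomotopy]
  · intro x
    rfl
  · intro x
    rfl
  · rintro _ ⟨Y, hY, rfl⟩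
    exact ⟨Y, hY, fun _ h => h⟩
  · intro Y hY
    exact ⟨_, ⟨Y, hY, rfl⟩, fun _ h => h⟩
  · rintro _ ⟨Y, hY, rfl⟩
    exact ⟨_, ⟨Y, hY, rfl⟩, fun x hx t => hx⟩
  · intro Y hY
    exact ⟨Y, hY, fun x hx t => hx⟩

/-- Both the line and its convex subset contract, compatibly with the projection to `X`, so
two-out-of-three applies. -/
theorem qIso_lineIncl {S : Set ℝ} (hS : Convex ℝ S) (hne : S.Nonempty) :
    QIso (relF ((fun Y => (Prod.fst : X × ℝ → X) ⁻¹' Y) '' 𝒴))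
      (relF ((fun Y => (Prod.fst : X × S → X) ⁻¹' Y) '' 𝒴)) (totMap (lineIncl X S)) := by
  have h1 := qIso_fst_of_convex 𝒴 hS hne
  have h2 : QIso (relF 𝒴) (relF ((fun Y => (Prod.fst : X × ℝ → X) ⁻¹' Y) '' 𝒴))
      (totMap (ContinuousMap.fst : C(X × ℝ, X))) := by
    refine qIso_of_homotopyEquiv (g := (ContinuousMap.id X).prodMk (ContinuousMap.const X 0))
      (F := ⟨fun x => (x.1.1, (x.2 : ℝ) * x.1.2), by fun_prop⟩) (G := ContinuousMap.fst)
      ?_ ?_ ?_ ?_ ?_ ?_ ?_ ?_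
    · intro x
      simp
    · intro x
      simp
    · intro x
      rfl
    · intro x
      rfl
    · rintro _ ⟨Y, hY, rfl⟩
      exact ⟨Y, hY, fun _ h => h⟩
    · intro Y hY
      exact ⟨_, ⟨Y, hY, rfl⟩, fun _ h => h⟩
    · rintro _ ⟨Y, hY, rfl⟩
      exact ⟨_, ⟨Y, hY, rfl⟩, fun x hx t => hx⟩
    · intro Y hY
      exact ⟨Y, hY, fun x hx t => hx⟩
  refine h2.of_comp_right (g := totMap (lineIncl X S)) h1 (totMap_d _) fun φ hφ => ?_
  refine totMap_mem ?_ hφ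
  rintro _ ⟨Y, hY, rfl⟩
  exact ⟨_, ⟨Y, hY, rfl⟩, fun _ h => h⟩

theorem cochainMap_snd_posCochain_Ioi :
    cochainMap 0 (lineIncl X (Ioi 0)) (cochainMap 0 ContinuousMap.snd posCochain) =
      fun _ => 1 := by
  ext σ
  exact if_pos (σ default).2.2

theorem cochainMap_snd_posCochain_Iio :
    cochainMap 0 (lineIncl X (Iio 0)) (cochainMap 0 ContinuousMap.snd posCochain) = 0 := by
  ext σ
  exact if_neg (not_lt.2 (le_of_lt (σ default).2.2))

theorem eq_zero_off_zero_section {φ : Tot (X × ℝ)} (h1 : totMap (lineIncl X (Ioi 0)) φ = 0)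
    (h2 : totMap (lineIncl X (Iio 0)) φ = 0) : φ ∈ relF {(Prod.snd ⁻¹' {0}ᶜ : Set (X × ℝ))} := by
  rintro q σ _ rfl hσ
  rw [totMap_eq_zero_iff (isEmbedding_lineIncl _)] at h1 h2
  rcases range_subset_or (f := ContinuousMap.snd.comp σ) (fun x => hσ ⟨x, rfl⟩) with h | h
  · refine h1 q σ _ rfl ?_
    rintro _ ⟨x, rfl⟩
    exact mem_range_lineIncl.2 (h x)
  · refine h2 q σ _ rfl ?_
    rintro _ ⟨x, rfl⟩
    exact mem_range_lineIncl.2 (h x)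

theorem totMap_lineIncl_eq_zero {S : Set ℝ} (hS : S ⊆ {0}ᶜ) {φ : Tot (X × ℝ)}
    (h : φ ∈ relF {(Prod.snd ⁻¹' {0}ᶜ : Set (X × ℝ))}) : totMap (lineIncl X S) φ = 0 := by
  rw [totMap_eq_zero_iff (isEmbedding_lineIncl _)]
  rintro q σ _ rfl hσ
  exact h q σ _ rfl fun x hx => hS (mem_range_lineIncl.1 (hσ hx))

theorem mem_lineFamily_iff {φ : Tot (X × ℝ)} : φ ∈ relF (lineFamily 𝒴) ↔
    φ ∈ relF {(Prod.snd ⁻¹' {0}ᶜ : Set (X × ℝ))} ∧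
      φ ∈ relF ((fun Y => (Prod.fst : X × ℝ → X) ⁻¹' Y) '' 𝒴) := by
  constructor
  · intro h
    exact ⟨fun q σ Y hY => h q σ Y (Or.inl hY), fun q σ Y hY => h q σ Y (Or.inr hY)⟩
  · rintro ⟨h1, h2⟩ q σ Y (hY | hY)
    · exact h1 q σ Y hY
    · exact h2 q σ Y hY

/-- A chain-level form of the suspension isomorphism. The cochain `ρ` is the indicator of the
positive side: it restricts to `1` on `X × (0, ∞)` and to `0` on `X × (-∞, 0)`. A relative cocycle
of `X × ℝ` has a primitive vanishing on the negative side, and the restriction of that primitive to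
the positive side recovers the class on `X`, up to sign. -/
theorem qIso_lineThom : QIso (relF 𝒴) (relF (lineFamily 𝒴)) (lineThom (X := X)) := by
  set ρ : Cochain 0 (X × ℝ) := cochainMap 0 ContinuousMap.snd posCochain with hρ
  have hη : cochainMap 1 ContinuousMap.snd lineCochain = coboundary 0 ρ := rfl
  set 𝒵 := (fun Y => (Prod.fst : X × ℝ → X) ⁻¹' Y) '' 𝒴 with h𝒵
  have hfst : ∀ {φ}, φ ∈ relF 𝒴 → totMap ContinuousMap.fst φ ∈ relF 𝒵 := fun {φ} hφ => by
    refine totMap_mem ?_ hφ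
    rintro _ ⟨Y, hY, rfl⟩
    exact ⟨Y, hY, fun _ h => h⟩
  have hres : ∀ (S : Set ℝ) {φ}, φ ∈ relF 𝒵 → totMap (lineIncl X S) φ ∈
      relF ((fun Y => (Prod.fst : X × S → X) ⁻¹' Y) '' 𝒴) := fun S {φ} hφ => by
    refine totMap_mem ?_ hφ
    rintro _ ⟨Y, hY, rfl⟩
    exact ⟨_, ⟨Y, hY, rfl⟩, fun _ h => h⟩
  have hext : ∀ (S : Set ℝ) {φ}, φ ∈ relF ((fun Y => (Prod.fst : X × S → X) ⁻¹' Y) '' 𝒴) →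
      extZero (lineIncl X S) φ ∈ relF 𝒵 := fun S {φ} hφ => by
    refine extZero_mem ?_
    rintro q σ _ ⟨_, ⟨Y, hY, rfl⟩, rfl⟩ hσ
    exact hφ q σ _ ⟨Y, hY, rfl⟩ hσ
  have hneg := fun {φ} => (qIso_lineIncl (X := X) 𝒴 (convex_Iio 0) ⟨-1, by simp⟩).acyclic_ker
    (fun _ => d_mem_relF) (fun φ hφ => ⟨_, hext _ hφ, totMap_extZero (isEmbedding_lineIncl _) φ⟩)
    (x := φ)
  have hpos := qIso_fst_of_convex 𝒴 (convex_Ioi (0 : ℝ)) ⟨1, by simp⟩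
  have hI : Ioi (0 : ℝ) ⊆ {0}ᶜ := fun x hx => ne_of_gt hx
  have hI' : Iio (0 : ℝ) ⊆ {0}ᶜ := fun x hx => ne_of_lt hx
  have hcup : ∀ x : Tot X, totMap (lineIncl X (Ioi 0)) (cupR ρ (totMap ContinuousMap.fst x)) =
      totMap ContinuousMap.fst x := fun x => by
    rw [totMap_cupR, cochainMap_snd_posCochain_Ioi, cupR_one]
    rfl
  have hcup' : ∀ x : Tot X, totMap (lineIncl X (Iio 0)) (cupR ρ (totMap ContinuousMap.fst x)) =
      0 := fun x => by
    rw [totMap_cupR, cochainMap_snd_posCochain_Iio, cupR_zero_left]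
  -- The image of a cocycle bounds in `X × ℝ`; the primitive restricts to the pullback of `sgn x` on
  -- the positive side and to zero on the negative side.
  have hΨ : ∀ x : Tot X, d x = 0 → lineThom x = d (cupR ρ (totMap ContinuousMap.fst (sgn x))) := by
    intro x hx
    rw [lineThom, AddMonoidHom.comp_apply, hη, cupR_coboundary, ← totMap_d, hx, totMap_sgn]
    simp
  refine QIso.of_inj_surj (fun x => ?_) (fun x hx => ?_) (fun x hx hdx y hy hxy => ?_)
    fun y hy hdy => ?_
  · rw [lineThom, AddMonoidHom.comp_apply, AddMonoidHom.comp_apply, totMap_d, d_cupR_of_cocycle]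
    have h := congrFun (d_d (single 0 ρ)) 2
    rw [d_single, d_single, single_same] at h
    exact h
  · rw [mem_lineFamily_iff]
    refine ⟨cupR_mem_right ?_ _, cupR_mem_left _ (hfst hx)⟩
    rintro _ rfl
    exact cochainMap_mem_relCochains (f := ContinuousMap.snd) (fun _ h => h) lineCochain_mem
  · rw [mem_lineFamily_iff] at hy
    -- Injectivity: the difference of the two primitives is a cocycle vanishing on the negative
    -- side, hence bounds some `b` vanishing there too. Restricting `b` to the positive side
    -- exhibits `sgn x` as a coboundary.
    rw [hΨ x hdx, ← sub_eq_zero, ← map_sub] at hxy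
    obtain ⟨b, hb, hb', hb''⟩ := hneg (sub_mem (cupR_mem_left ρ (hfst (sgn_mem hx))) hy.2)
      (by rw [map_sub, hcup', totMap_lineIncl_eq_zero hI' hy.1, sub_zero]) hxy
    have h1 := congrArg (totMap (lineIncl X (Ioi 0))) hb''
    rw [map_sub, hcup, totMap_lineIncl_eq_zero hI hy.1, sub_zero, totMap_d] at h1
    obtain ⟨z, hz, hz'⟩ := hpos.inj (sgn_mem hx) (by rw [d_sgn, hdx, map_zero, neg_zero])
      (hres _ hb) h1.symm
    refine ⟨-sgn z, neg_mem (sgn_mem hz), ?_⟩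
    rw [map_neg, d_sgn, hz', neg_neg, sgn_sgn]
  · rw [mem_lineFamily_iff] at hy
    -- Surjectivity: `y` has a primitive `b` vanishing on the negative side. On the positive side
    -- `b` is a cocycle, hence a pullback of some `x` up to the coboundary of `w`. With `w` extended
    -- by zero, `b + d w'` and the cup product of `x` with `ρ` agree off the zero section.
    obtain ⟨b, hb, hb', hb''⟩ := hneg hy.2 (totMap_lineIncl_eq_zero hI' hy.1) hdy
    obtain ⟨x, hx, hdx, w, hw, hw'⟩ := hpos.surj (hres (Ioi 0) hb)
      (by rw [← totMap_d, hb'', totMap_lineIncl_eq_zero hI hy.1])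
    set w' := extZero (lineIncl X (Ioi 0)) w with hw'd
    have hwn : totMap (lineIncl X (Iio 0)) w' = 0 := by
      ext q σ
      rw [totMap_apply, hw'd, extZero_apply_of_not]
      · rfl
      · intro h
        have h1 : (0 : ℝ) < (lineIncl X (Iio 0) (σ (stdSimplex.vertex 0))).2 :=
          mem_range_lineIncl.1 (h ⟨_, rfl⟩)
        exact lt_asymm h1 (σ (stdSimplex.vertex 0)).2.2
    refine ⟨sgn x, sgn_mem hx, by rw [d_sgn, hdx, map_zero, neg_zero],
      -(b + d w' - cupR ρ (totMap ContinuousMap.fst x)), neg_mem ?_, ?_⟩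
    · rw [mem_lineFamily_iff]
      refine ⟨eq_zero_off_zero_section ?_ ?_,
        sub_mem (add_mem hb (d_mem_relF (hext _ hw))) (cupR_mem_left _ (hfst hx))⟩
      · rw [map_sub, map_add, hcup, totMap_d, totMap_extZero (isEmbedding_lineIncl _), ← hw']
        abel
      · rw [map_sub, map_add, hcup', totMap_d, hwn, hb']
        simp
    · rw [hΨ _ (by rw [d_sgn, hdx, map_zero, neg_zero]), sgn_sgn, map_neg, map_sub,
        map_add, d_d, hb'']
      abel

end Line

end SingCoh

end

/-! ### Thom cocycles on products with `ℝ^k` -/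

noncomputable section

open Function Set DiffGroup

namespace SingCoh

variable {X X' Z U : Type*} [TopologicalSpace X] [TopologicalSpace X'] [TopologicalSpace Z]
  [TopologicalSpace U] {p q s k : ℕ}

/-- The map `φ ↦ p^* φ ⌣ τ`. -/
def thomMap (π : C(Z, U)) (τ : Cochain s Z) : Tot U →+ Tot Z := (cupR τ).comp (totMap π)

theorem thomMap_apply (π : C(Z, U)) (τ : Cochain s Z) (φ : Tot U) :
    thomMap π τ φ = cupR τ (totMap π φ) := rfl

theorem thomMap_d {π : C(Z, U)} {τ : Cochain s Z} (h : coboundary s τ = 0) (φ : Tot U) :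
    thomMap π τ (d φ) = d (thomMap π τ φ) := by
  rw [thomMap_apply, totMap_d, d_cupR_of_cocycle h, thomMap_apply]

/-- Thom classes may be changed by coboundaries. -/
theorem qIso_thomMap_congr {𝒵 : Set (Set Z)} {π : C(Z, U)} {τ τ' : Cochain s Z}
    (h : QIso ⊤ (relF 𝒵) (thomMap π τ)) (hc : coboundary s τ' = 0) {w : Tot Z}
    (hw : w ∈ relF 𝒵) (hτ : τ' = τ + d w s) : QIso ⊤ (relF 𝒵) (thomMap π τ') := by
  cases s with
  | zero =>
    rw [d_zero_apply, add_zero] at hτ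
    rwa [hτ]
  | succ s =>
    rw [d_succ] at hτ
    -- The cup product with a coboundary is null-homotopic: up to the sign `sgn`, the homotopy is
    -- the cup product with the primitive.
    have key : ∀ φ : Tot U, thomMap π τ' φ = thomMap π τ φ +
        (d (cupR (w s) (sgn (totMap π φ))) + cupR (w s) (sgn (totMap π (d φ)))) := by
      intro φ
      rw [thomMap_apply, hτ, cupR_add_left, cupR_coboundary, ← totMap_d, thomMap_apply]
    have hmem : ∀ φ : Tot Z, cupR (w s) φ ∈ relF 𝒵 := fun φ => cupR_mem_right
      (fun Y hY σ hσ => hw s σ Y hY hσ) φ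
    refine h.of_homotopy (-((cupR (w s)).comp (sgn.comp (totMap π)))) (fun φ _ => neg_mem (hmem _))
      (thomMap_d hc) (fun φ hφ => ?_) fun φ _ => ?_
    · rw [key]
      exact add_mem (h.maps φ hφ) (add_mem (d_mem_relF (hmem _)) (hmem _))
    · rw [key]
      simp only [AddMonoidHom.neg_apply, AddMonoidHom.comp_apply, map_neg]
      abel

/-- The forgetful map to the first coordinates. -/
def initMap (k : ℕ) : C(Fin (k + 1) → ℝ, Fin k → ℝ) :=
  ⟨Fin.init, continuous_pi fun i => continuous_apply i.castSucc⟩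

/-- The last coordinate. -/
def lastMap (k : ℕ) : C(Fin (k + 1) → ℝ, ℝ) := ⟨fun w => w (Fin.last k), continuous_apply _⟩

/-- The product of the generating cocycles of `(ℝ, ℝ \ 0)`. -/
def prodCochain : ∀ k, Cochain k (Fin k → ℝ)
  | 0 => fun _ => 1
  | k + 1 => cupCochain (cochainMap k (initMap k) (prodCochain k))
      (cochainMap 1 (lastMap k) lineCochain)

theorem coboundary_coboundary (φ : Cochain q X) : coboundary (q + 1) (coboundary q φ) = 0 := by
  have h := congrFun (d_d (single q φ)) (q + 2)
  rwa [d_single, d_single, single_same] at h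

theorem coboundary_prodCochain : ∀ k, coboundary k (prodCochain k) = 0
  | 0 => by
    ext σ
    simp [coboundary, prodCochain]
  | k + 1 => by
    refine coboundary_cupCochain_eq_zero ?_ ?_
    · rw [coboundary_cochainMap, coboundary_prodCochain k, map_zero]
    · rw [coboundary_cochainMap, lineCochain, coboundary_coboundary, map_zero]

/-- The complements of the coordinate hyperplanes. -/
def coordFamily (U : Type*) (k : ℕ) : Set (Set (U × (Fin k → ℝ))) :=
  range fun i => {x | x.2 i ≠ 0}

theorem relF_empty : relF (∅ : Set (Set X)) = ⊤ :=
  eq_top_iff.2 fun _ _ _ _ _ h => h.elim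

/-- Splitting off the last coordinate. -/
def snocHomeo (U : Type*) [TopologicalSpace U] (k : ℕ) :
    U × (Fin (k + 1) → ℝ) ≃ₜ (U × (Fin k → ℝ)) × ℝ where
  toFun x := ((x.1, Fin.init x.2), x.2 (Fin.last k))
  invFun x := (x.1.1, Fin.snoc x.1.2 x.2)
  left_inv x := by simp
  right_inv x := by simp
  continuous_toFun := by
    exact (continuous_fst.prodMk ((initMap k).continuous.comp continuous_snd)).prodMk
      ((lastMap k).continuous.comp continuous_snd)
  continuous_invFun := by
    refine (continuous_fst.comp continuous_fst).prodMk (continuous_pi fun i => ?_)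
    induction i using Fin.lastCases with
    | last => simpa using continuous_snd
    | cast i =>
      simp only [Fin.snoc_castSucc]
      fun_prop

/-- Induction on `k`, each new coordinate contributing one application of `qIso_lineThom`. Working
relative to the family of complements of the hyperplanes, not to their union, lets the isomorphisms
compose directly. -/
theorem qIso_prodCochain (U : Type*) [TopologicalSpace U] : ∀ k, QIso (⊤ : AddSubgroup (Tot U))
    (relF (coordFamily U k))
    (thomMap ContinuousMap.fst (cochainMap k ContinuousMap.snd (prodCochain k)))
  | 0 => by
    have h : coordFamily U 0 = ∅ := by simp [coordFamily]
    have h1 := qIso_of_homotopyEquiv (f := (ContinuousMap.fst : C(U × (Fin 0 → ℝ), U)))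
      (g := (ContinuousMap.id U).prodMk (ContinuousMap.const U 0)) (𝒴 := ∅) (𝒴' := ∅)
      (F := ContinuousMap.fst) (G := ContinuousMap.fst)
      (fun x => Prod.ext rfl (Subsingleton.elim _ _)) (fun _ => rfl) (fun _ => rfl) (fun _ => rfl)
      (by simp) (by simp) (by simp) (by simp)
    rw [relF_empty] at h1
    rw [h]
    convert h1 using 1
    ext1 φ
    exact cupR_one _
  | k + 1 => by
    have h1 := (qIso_lineThom (coordFamily U k)).comp (qIso_prodCochain U k)
    have h2 : QIso (relF (lineFamily (coordFamily U k))) (relF (coordFamily U (k + 1)))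
        (totMap (snocHomeo U k : C(U × (Fin (k + 1) → ℝ), (U × (Fin k → ℝ)) × ℝ))) := by
      refine qIso_of_homeomorph (snocHomeo U k) ?_ ?_
      · rintro _ ⟨i, rfl⟩
        induction i using Fin.lastCases with
        | last => exact ⟨_, Or.inl rfl, fun x hx => hx⟩
        | cast i => exact ⟨_, Or.inr ⟨_, ⟨i, rfl⟩, rfl⟩, fun x hx => hx⟩
      · rintro _ (rfl | ⟨_, ⟨i, rfl⟩, rfl⟩)
        · refine ⟨_, ⟨Fin.last k, rfl⟩, fun x hx => ?_⟩
          change Fin.snoc (α := fun _ => ℝ) x.1.2 x.2 (Fin.last k) ≠ 0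
          rw [Fin.snoc_last]
          exact hx
        · refine ⟨_, ⟨i.castSucc, rfl⟩, fun x hx => ?_⟩
          change Fin.snoc (α := fun _ => ℝ) x.1.2 x.2 i.castSucc ≠ 0
          rw [Fin.snoc_castSucc]
          exact hx
    convert h2.comp h1 using 1
    ext1 φ
    simp only [AddMonoidHom.comp_apply, lineThom, thomMap_apply, totMap_cupR, ← totMap_comp]
    exact cupR_cupCochain (cochainMap k (ContinuousMap.snd.comp (ContinuousMap.fst.comp
      (snocHomeo U k : C(U × (Fin (k + 1) → ℝ), (U × (Fin k → ℝ)) × ℝ)))) (prodCochain k))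
      (cochainMap 1 (ContinuousMap.snd.comp
        (snocHomeo U k : C(U × (Fin (k + 1) → ℝ), (U × (Fin k → ℝ)) × ℝ))) lineCochain)
      (totMap ContinuousMap.fst φ)

theorem sUnion_coordFamily (U : Type*) (k : ℕ) :
    ⋃₀ coordFamily U k = (Prod.snd ⁻¹' {0}ᶜ : Set (U × (Fin k → ℝ))) := by
  ext x
  simp [coordFamily, funext_iff]

theorem isOpen_coordFamily {k : ℕ} : ∀ S ∈ coordFamily U k, IsOpen S := by
  rintro _ ⟨i, rfl⟩
  exact isOpen_ne_fun ((continuous_apply i).comp continuous_snd) continuous_const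

/-- The product cocycle vanishes only on simplices missing some coordinate hyperplane. Small
simplices allow it to be changed by a coboundary into a cocycle vanishing on all simplices of `ℝ^k ∖
0`. -/
theorem exists_genCochain (k : ℕ) : ∃ θ ∈ relCocycles k ({0}ᶜ : Set (Fin k → ℝ)),
    ∃ w : Tot (Fin k → ℝ), w ∈ relF (range fun i => {x : Fin k → ℝ | x i ≠ 0}) ∧
      θ = prodCochain k + d w k := by
  set 𝒰 : Set (Set (Fin k → ℝ)) := range fun i => {x : Fin k → ℝ | x i ≠ 0} with h𝒰
  have h0 : ⋃₀ 𝒰 = {0}ᶜ := by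
    ext x
    simp [h𝒰, funext_iff]
  -- Over a one-point base the product cocycle is the image of the constant `1` under the Thom map,
  -- which takes values in relative cochains.
  have hpc : single k (prodCochain k) ∈ relF 𝒰 := by
    have h := (qIso_prodCochain Unit k).maps (single 0 fun _ => 1) trivial
    intro j σ Y hY hσ
    by_cases hj : j = k
    · subst hj
      obtain ⟨i, rfl⟩ := hY
      have := h j (((ContinuousMap.const _ ()).prodMk (ContinuousMap.id _)).comp σ) _ ⟨i, rfl⟩ ?_
      · rw [thomMap_apply, cupR_apply_of_eq (q := 0) _ _ (by omega)] at this
        rw [single_same]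
        have h2 : totMap ContinuousMap.fst (single 0 fun _ => 1 : Tot Unit) 0 =
          (fun _ => 1 : Cochain 0 (Unit × (Fin j → ℝ))) := by
          ext τ
          rw [totMap_apply, single_same]
        rw [h2, one_mul] at this
        convert this using 1
        change _ = prodCochain j (ContinuousMap.snd.comp _)
        congr 1
        simp only [zero_add]
        exact (reindex_id σ).symm
      · rintro _ ⟨x, rfl⟩
        exact hσ ⟨x, rfl⟩
    · rw [single_of_ne _ hj]
      rfl
  obtain ⟨z, hz, hdz, w, hw, h⟩ := (qIso_sUnion (𝒰 := 𝒰) (by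
    rintro _ ⟨i, rfl⟩
    exact isOpen_ne_fun (continuous_apply i) continuous_const)).surj hpc
    (by rw [d_single, coboundary_prodCochain, map_zero])
  rw [h0] at hz
  refine ⟨z k, ⟨mem_relCochains hz k, congrFun hdz (k + 1)⟩, w, hw, ?_⟩
  have := congrFun h k
  rw [single_same] at this
  rw [← this]
  simp

/-- A cocycle representing a generator of `H^k(ℝ^k, ℝ^k \ 0)`. -/
def genCochain (k : ℕ) : Cochain k (Fin k → ℝ) := (exists_genCochain k).choose

theorem genCochain_mem (k : ℕ) : genCochain k ∈ relCocycles k ({0}ᶜ : Set (Fin k → ℝ)) :=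
  (exists_genCochain k).choose_spec.1

/-- `τ` is a Thom cocycle: the cup product with `τ` is an isomorphism onto the cohomology relative
to `Z₀`. -/
def IsThom (π : C(Z, U)) (Z₀ : Set Z) (τ : Cochain s Z) : Prop :=
  QIso ⊤ (relF {Z₀}) (thomMap π τ)

theorem IsThom.congr {π : C(Z, U)} {Z₀ : Set Z} {τ τ' : Cochain s Z} (h : IsThom π Z₀ τ)
    (hτ' : coboundary s τ' = 0) (hτ : τ' - τ ∈ relCoboundaries s Z₀) : IsThom π Z₀ τ' := by
  obtain ⟨w, hw, hw'⟩ := exists_d_eq_single hτ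
  refine qIso_thomMap_congr h hτ' hw ?_
  rw [hw', single_same]
  abel

theorem isThom_genCochain (U : Type*) [TopologicalSpace U] (k : ℕ) :
    IsThom (ContinuousMap.fst : C(U × (Fin k → ℝ), U)) (Prod.snd ⁻¹' {0}ᶜ)
      (cochainMap k ContinuousMap.snd (genCochain k)) := by
  obtain ⟨hc, w, hw, h⟩ := (exists_genCochain k).choose_spec
  have h1 := qIso_sUnion (isOpen_coordFamily (U := U) (k := k))
  rw [sUnion_coordFamily] at h1
  have hcc : coboundary k (cochainMap k ContinuousMap.snd (genCochain k) :
      Cochain k (U × (Fin k → ℝ))) = 0 := by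
    rw [coboundary_cochainMap, show coboundary k (genCochain k) = 0 from (genCochain_mem k).2,
      map_zero]
  refine h1.of_comp_left (f := thomMap _ _) ?_ (thomMap_d hcc) fun φ _ => ?_
  · refine qIso_thomMap_congr (qIso_prodCochain U k) hcc (w := totMap ContinuousMap.snd w) ?_ ?_
    · refine totMap_mem ?_ hw
      rintro _ ⟨i, rfl⟩
      exact ⟨_, ⟨i, rfl⟩, fun x hx => hx⟩
    · rw [← totMap_d, genCochain, h, map_add]
      rfl
  · refine cupR_mem_right ?_ _
    rintro _ rfl
    exact cochainMap_mem_relCochains (f := ContinuousMap.snd) (fun _ h => h) (genCochain_mem k).1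

/-- Homeomorphisms over the base. -/
theorem IsThom.of_homeomorph {Z' : Type*} [TopologicalSpace Z'] (h : Z ≃ₜ Z') {π : C(Z, U)}
    {π' : C(Z', U)} (hπ : ∀ z, π' (h z) = π z) {Z₀ : Set Z} {Z₀' : Set Z'}
    (h0 : h ⁻¹' Z₀' = Z₀) {τ : Cochain s Z'} (hτ : IsThom π' Z₀' τ) :
    IsThom π Z₀ (cochainMap s (h : C(Z, Z')) τ) := by
  have h1 : QIso (relF {Z₀'}) (relF {Z₀}) (totMap (h : C(Z, Z'))) := by
    refine qIso_of_homeomorph h ?_ ?_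
    · rintro _ rfl
      exact ⟨_, rfl, by rw [← h0]; exact fun x hx => hx⟩
    · rintro _ rfl
      refine ⟨_, rfl, fun x hx => ?_⟩
      rw [← h0]
      simpa using hx
  have h2 := h1.comp hτ
  have e : π = π'.comp (h : C(Z, Z')) := ContinuousMap.ext fun z => (hπ z).symm
  rw [IsThom, e]
  exact h2

theorem cupR_self (τ : Cochain s X) (φ : Tot X) (σ : Simplex s X) :
    cupR τ φ s σ = φ 0 (reindex σ fun _ => 0) * τ σ := by
  rw [cupR_apply_of_eq (q := 0) _ _ (by omega)]
  congr 2
  · congr 1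
    ext i
    simp
  · simp only [zero_add]
    exact reindex_id σ

theorem coboundary_zero_apply (φ : Cochain 0 X) (σ : Simplex 1 X) :
    coboundary 0 φ σ = φ (reindex σ fun _ => 1) - φ (reindex σ fun _ => 0) := by
  have h : ∀ i : Fin 2, (i.succAbove : Fin 1 → Fin 2) = fun _ => 1 - i := by decide
  simp only [coboundary, AddMonoidHom.coe_mk, ZeroHom.coe_mk, h]
  simp [sub_eq_add_neg]

theorem coboundary_const (n : ℤ) : coboundary 0 (fun _ => n : Cochain 0 X) = 0 := by
  ext σ
  simp [coboundary_zero_apply]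

/-- `ℝ^k` over the point. -/
theorem isThom_genCochain_point (k : ℕ) :
    IsThom (ContinuousMap.const (Fin k → ℝ) ()) {0}ᶜ (genCochain k) :=
  IsThom.of_homeomorph (Z' := Unit × (Fin k → ℝ)) (Homeomorph.punitProd (Fin k → ℝ)).symm
    (fun _ => rfl) rfl (isThom_genCochain Unit k)

theorem cupR_const (τ : Cochain s X) (n : ℤ) :
    cupR τ (single 0 fun _ => n) = single s (n • τ) := by
  funext j
  by_cases hj : j = s
  · subst hj
    ext σ
    rw [cupR_self, single_same, single_same]
    rfl
  · rw [single_of_ne _ hj]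
    by_cases hj' : j < s
    · exact cupR_apply_of_lt _ _ hj'
    · obtain ⟨i, rfl⟩ : ∃ i, j = i + s := ⟨j - s, by omega⟩
      rw [cupR_add, single_of_ne _ (by omega)]
      ext σ
      simp [cupCochain]

/-- The multiple is the image of the constant `n` on a point; by injectivity of the Thom map this
constant is a coboundary in degree zero, where the only coboundary is zero. -/
theorem eq_zero_of_smul_genCochain {n : ℤ}
    (h : n • genCochain k ∈ relCoboundaries k ({0}ᶜ : Set (Fin k → ℝ))) : n = 0 := by
  obtain ⟨w, hw, hw'⟩ := exists_d_eq_single h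
  have e : totMap (ContinuousMap.const (Fin k → ℝ) ()) (single 0 fun _ => n) =
      single 0 fun _ => n := by
    funext j
    rcases j with - | j
    · ext σ
      rw [totMap_apply, single_same, single_same]
    · ext σ
      rw [totMap_apply, single_of_ne _ (by omega), single_of_ne _ (by omega)]
      rfl
  obtain ⟨z, -, hz⟩ := (isThom_genCochain_point k).inj (x := single 0 fun _ => n) trivial
    (by rw [d_single, coboundary_const, map_zero]) hw (by rw [thomMap_apply, e, cupR_const, hw'])
  have := congrFun hz 0
  rw [d_zero_apply, single_same] at this
  exact (congrFun this (ContinuousMap.const _ ())).symm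

/-- A point has one simplex in each degree, and the alternating sum of its faces makes the
coboundary zero out of even degrees and the identity out of odd ones. -/
theorem point_coboundary {z : Cochain (q + 1) Unit} (hz : coboundary (q + 1) z = 0) :
    ∃ α, coboundary q α = z := by
  have key : ∀ (r : ℕ) (φ : Cochain r Unit) (σ : Simplex (r + 1) Unit),
      coboundary r φ σ = (if Even r then 0 else 1) * φ (ContinuousMap.const _ ()) := by
    intro r φ σ
    have h1 : ∀ i : Fin (r + 2), φ (reindex σ i.succAbove) = φ (ContinuousMap.const _ ()) :=
      fun i => congrArg φ (Subsingleton.elim _ _)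
    simp only [coboundary, AddMonoidHom.coe_mk, ZeroHom.coe_mk, h1]
    rw [← Finset.sum_mul, Fin.sum_neg_one_pow]
    simp [Nat.even_add]
  by_cases hq : Even q
  · refine ⟨0, ?_⟩
    have := congrFun hz (ContinuousMap.const _ ())
    rw [key, if_neg (by simpa [Nat.even_add_one] using hq), one_mul] at this
    rw [map_zero]
    ext σ
    rw [Subsingleton.elim σ (ContinuousMap.const _ ())]
    exact this.symm
  · refine ⟨fun _ => z (ContinuousMap.const _ ()), ?_⟩
    ext σ
    rw [key, if_neg hq, one_mul]
    exact congrArg z (Subsingleton.elim _ _)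

theorem mem_relCochains_empty (φ : Cochain q X) : φ ∈ relCochains q (∅ : Set X) := by
  have h : single q φ ∈ relF {(∅ : Set X)} := by
    rw [relF_singleton_empty]
    trivial
  have := mem_relCochains h q
  rwa [single_same] at this

/-- Every relative class is a Thom image from a point. Below degree `k` such an image is zero, and
above it the class on the point has positive degree and is a coboundary. -/
theorem subsingleton_H_euclidean (h : q ≠ k) :
    Subsingleton (H q (Fin k → ℝ) ({0}ᶜ : Set (Fin k → ℝ))) := by
  refine subsingleton_of_forall_eq 0 fun x => ?_
  obtain ⟨φ, rfl⟩ := H.mk_surjective _ x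
  obtain ⟨z, -, hdz, w, hw, h1⟩ := (isThom_genCochain_point k).surj (single_mem φ.2.1)
    (by rw [d_single, show coboundary q φ.1 = 0 from φ.2.2, map_zero])
  rw [H.mk_eq_zero_iff]
  have h2 := congrFun h1 q
  rw [single_same] at h2
  rw [← h2]
  refine sub_mem ?_ (d_mem_relCoboundaries hw q)
  by_cases hlt : q < k
  · rw [thomMap_apply, cupR_apply_of_lt _ _ hlt]
    exact zero_mem _
  · obtain ⟨j, rfl⟩ : ∃ j, q = (j + 1) + k := ⟨q - k - 1, by omega⟩
    rw [thomMap_apply, cupR_add]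
    obtain ⟨α, hα⟩ := point_coboundary (z := z (j + 1)) (congrFun hdz (j + 2))
    refine cupCochain_left_mem_relCoboundaries ?_ (genCochain_mem k)
    refine ⟨cochainMap j (ContinuousMap.const _ ()) α, mem_relCochains_empty _, ?_⟩
    rw [coboundary_cochainMap, hα]
    rfl

theorem zmultiples_genCochain :
    AddSubgroup.zmultiples (H.mk k ({0}ᶜ : Set (Fin k → ℝ)) ⟨genCochain k, genCochain_mem k⟩) =
      ⊤ := by
  refine eq_top_iff.2 fun x _ => ?_
  obtain ⟨φ, rfl⟩ := H.mk_surjective _ x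
  obtain ⟨z, -, hdz, w, hw, h1⟩ := (isThom_genCochain_point k).surj (single_mem φ.2.1)
    (by rw [d_single, show coboundary k φ.1 = 0 from φ.2.2, map_zero])
  refine AddSubgroup.mem_zmultiples_iff.2 ⟨z 0 (ContinuousMap.const _ ()), ?_⟩
  rw [← map_zsmul, H.mk_eq_mk_iff]
  have h2 := congrFun h1 k
  rw [single_same] at h2
  rw [← h2]
  have h3 : thomMap (ContinuousMap.const (Fin k → ℝ) ()) (genCochain k) z k =
      z 0 (ContinuousMap.const _ ()) • genCochain k := by
    ext σ
    rw [thomMap_apply, cupR_self]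
    congr 1
  change _ - (thomMap _ _ z k - d w k) ∈ _
  rw [h3]
  convert d_mem_relCoboundaries hw k using 1
  exact sub_sub_cancel _ _

/-- A cocycle on `U × ℝ^k` which restricts to a generator on each fibre is a Thom cocycle. -/
theorem isThom_of_fibre {τ : Cochain k (U × (Fin k → ℝ))}
    (hτ : τ ∈ relCocycles k (Prod.snd ⁻¹' {0}ᶜ : Set (U × (Fin k → ℝ))))
    (h : ∀ x : U, ∃ c : ℤ, genCochain k -
      c • cochainMap k ((ContinuousMap.const _ x).prodMk (ContinuousMap.id _)) τ ∈
        relCoboundaries k ({0}ᶜ : Set (Fin k → ℝ))) :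
    IsThom ContinuousMap.fst (Prod.snd ⁻¹' {0}ᶜ) τ := by
  have hstd := isThom_genCochain U k
  set θ : Cochain k (U × (Fin k → ℝ)) := cochainMap k ContinuousMap.snd (genCochain k) with hθ
  -- The Thom isomorphism for the standard cocycle `θ` writes `τ`, up to a relative coboundary, as a
  -- multiple of `θ` by the degree-zero cocycle `z 0`.
  obtain ⟨z, -, hdz, w, hw, h1⟩ := hstd.surj (single_mem hτ.1)
    (by rw [d_single, show coboundary k τ = 0 from hτ.2, map_zero])
  have h2 : τ = thomMap ContinuousMap.fst θ z k - d w k := by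
    have h2 := congrFun h1 k
    rw [single_same] at h2
    exact h2.symm
  have hz0 : coboundary 0 (z 0) = 0 := congrFun hdz 1
  -- On the fibre over a point, `τ` is cohomologous to `z 0` times the generator. The generator has
  -- infinite order, so the hypothesis makes this value a unit of `ℤ`, hence `±1`.
  have hsq : ∀ σ : Simplex 0 U, z 0 σ * z 0 σ = 1 := by
    intro σ
    obtain ⟨c, hc⟩ := h (σ default)
    set i : C(Fin k → ℝ, U × (Fin k → ℝ)) :=
      (ContinuousMap.const _ (σ default)).prodMk (ContinuousMap.id _) with hi
    have h3 : cochainMap k i τ = z 0 σ • genCochain k - d (totMap i w) k := by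
      rw [h2, map_sub, ← totMap_d]
      congr 1
      ext σ'
      change thomMap _ _ z k (i.comp σ') = _
      rw [thomMap_apply, cupR_self]
      change z 0 _ * genCochain k (ContinuousMap.snd.comp (i.comp σ')) = z 0 σ * genCochain k σ'
      congr 2
      ext x
      rw [Subsingleton.elim x default]
      rfl
    have h4 : d (totMap i w) k ∈ relCoboundaries k ({0}ᶜ : Set (Fin k → ℝ)) := by
      refine d_mem_relCoboundaries (totMap_mem ?_ hw) k
      rintro _ rfl
      exact ⟨_, rfl, fun x hx => hx⟩
    have h5 : (1 - c * z 0 σ) • genCochain k ∈ relCoboundaries k ({0}ᶜ : Set (Fin k → ℝ)) := by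
      rw [h3] at hc
      convert sub_mem hc (zsmul_mem h4 c) using 1
      rw [sub_smul, one_smul, mul_smul, smul_sub]
      abel
    have h6 : c * z 0 σ = 1 := by
      have := eq_zero_of_smul_genCochain h5
      linarith
    exact Int.isUnit_mul_self (IsUnit.of_mul_eq_one c (by rw [mul_comm]; exact h6))
  -- Since `z 0` takes values `±1`, multiplication by it is its own inverse. The Thom map of `τ` is,
  -- up to homotopy, this automorphism followed by the standard Thom map.
  have hmul : QIso (⊤ : AddSubgroup (Tot U)) ⊤ (cupR (z 0)) := by
    have hinv : ∀ φ, cupR (z 0) (cupR (z 0) φ) = φ := by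
      intro φ
      have h1 : cupCochain (z 0) (z 0) = fun _ => 1 := by
        ext σ
        refine Eq.trans ?_ (hsq σ)
        change z 0 _ * z 0 _ = _
        have hfn : ∀ f : Fin (0 + 1) → Fin (0 + 0 + 1), reindex σ f = σ := fun f =>
          (congrArg (reindex σ) (funext fun i => Fin.ext (by simp) : f = id)).trans (reindex_id σ)
        rw [hfn, hfn]
      rw [← cupR_cupCochain, h1]
      exact cupR_one φ
    refine QIso.of_inj_surj (d_cupR_of_cocycle hz0) (fun _ _ => trivial)
      (fun x _ hx y _ hxy => ⟨cupR (z 0) y, trivial, ?_⟩) fun y _ hy =>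
        ⟨cupR (z 0) y, trivial, ?_, 0, trivial, ?_⟩
    · rw [← d_cupR_of_cocycle hz0, ← hxy, hinv]
    · rw [← d_cupR_of_cocycle hz0, hy, map_zero]
    · rw [hinv, map_zero, sub_zero]
  have hτ' : IsThom ContinuousMap.fst (Prod.snd ⁻¹' {0}ᶜ) (thomMap ContinuousMap.fst θ z k) := by
    rw [IsThom]
    convert hstd.comp hmul using 1
    ext1 φ
    funext j
    by_cases hj : j < k
    · simp only [thomMap_apply, AddMonoidHom.comp_apply]
      rw [cupR_apply_of_lt _ _ hj, cupR_apply_of_lt _ _ hj]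
    · obtain ⟨i, rfl⟩ : ∃ i, j = i + k := ⟨j - k, by omega⟩
      simp only [thomMap_apply, AddMonoidHom.comp_apply]
      rw [cupR_add, cupR_add]
      ext σ
      simp only [cupCochain]
      rw [cupR_self, totMap_apply, totMap_apply, totMap_apply,
        cupR_apply_of_eq (q := i) _ _ (by omega), mul_assoc]
      congr 1
      · congr 1
        exact (reindex_id _).symm
      · congr 2
        change ContinuousMap.fst.comp _ = ContinuousMap.fst.comp (reindex (reindex σ (front i k)) _)
        rw [reindex_reindex, reindex_reindex]
        congr 2
        ext j
        simp [front, back]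
  refine hτ'.congr hτ.2 ?_
  rw [h2]
  simpa using neg_mem (d_mem_relCoboundaries hw k)

end SingCoh

end

noncomputable section

open Function Set DiffGroup

namespace SingCoh

variable {X X₁ X₂ X₃ Z U : Type*} [TopologicalSpace X] [TopologicalSpace X₁] [TopologicalSpace X₂]
  [TopologicalSpace X₃] [TopologicalSpace Z] [TopologicalSpace U] {p q s k : ℕ}

/-! ## The Mayer–Vietoris argument -/

theorem totMap_mem_preimage {X' : Type*} [TopologicalSpace X'] {e : C(X, X')} {Y : Set X'}
    {φ : Tot X'} (hφ : φ ∈ relF {Y}) : totMap e φ ∈ relF {e ⁻¹' Y} := by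
  simpa using totMap_mem_image (e := e) hφ

/-- The space `X` is the union of the interiors of `X₁` and `X₂`, and `X₃` is their intersection. -/
structure IsCoverSquare (e₁ : C(X₁, X)) (e₂ : C(X₂, X)) (i₁ : C(X₃, X₁)) (i₂ : C(X₃, X₂)) :
    Prop where
  left : Topology.IsEmbedding e₁
  right : Topology.IsEmbedding e₂
  inter : Topology.IsEmbedding i₁
  comm : e₁.comp i₁ = e₂.comp i₂
  range_inter : range e₁ ∩ range e₂ ⊆ range (e₁.comp i₁)
  cover : ∀ x, x ∈ interior (range e₁) ∨ x ∈ interior (range e₂)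

namespace IsCoverSquare

variable {e₁ : C(X₁, X)} {e₂ : C(X₂, X)} {i₁ : C(X₃, X₁)} {i₂ : C(X₃, X₂)}

theorem comm_totMap (h : IsCoverSquare e₁ e₂ i₁ i₂) (φ : Tot X) :
    totMap i₁ (totMap e₁ φ) = totMap i₂ (totMap e₂ φ) := by
  rw [← totMap_comp, ← totMap_comp, h.comm]

/-- The sum of the two extensions by zero counts the simplices of the intersection twice;
subtracting the extension from the intersection corrects this and leaves the relative condition
intact. -/
theorem glue (h : IsCoverSquare e₁ e₂ i₁ i₂) {Y : Set X} {x : Tot X₁} (hx : x ∈ relF {e₁ ⁻¹' Y})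
    {y : Tot X₂} (hy : y ∈ relF {e₂ ⁻¹' Y}) (hxy : totMap i₁ x = totMap i₂ y) :
    ∃ z ∈ relF {Y}, totMap e₁ z = x ∧ totMap e₂ z = y := by
  have h3 : Topology.IsEmbedding (e₁.comp i₁) := h.left.comp h.inter
  have hm : extZero (e₁.comp i₁) (totMap i₁ x) ∈ relF {Y} := by
    refine extZero_mem ?_
    have := totMap_mem_image (e := i₁) hx
    rw [image_singleton] at this ⊢
    exact this
  refine ⟨extZero e₁ x + (extZero e₂ y - extZero (e₁.comp i₁) (totMap i₁ x)),
    add_mem (extZero_mem (by rwa [image_singleton]))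
      (sub_mem (extZero_mem (by rwa [image_singleton])) hm), ?_, ?_⟩
  · rw [map_add, totMap_extZero h.left, map_sub, add_eq_left, sub_eq_zero]
    ext q σ
    rw [totMap_apply, totMap_apply]
    by_cases hσ : range (e₁.comp σ) ⊆ range e₂
    · obtain ⟨ρ, hρ⟩ := exists_lift h3 (σ := e₁.comp σ)
        (fun x hx => h.range_inter ⟨by obtain ⟨y, rfl⟩ := hx; exact ⟨_, rfl⟩, hσ hx⟩)
      rw [← hρ]
      have e1 := congrFun (congrFun (totMap_extZero h3 (totMap i₁ x)) q) ρ
      rw [totMap_apply] at e1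
      rw [e1, h.comm]
      have e2 := congrFun (congrFun (totMap_extZero h.right y) q) (i₂.comp ρ)
      rw [totMap_apply] at e2
      exact e2.trans (congrFun (congrFun hxy q) ρ).symm
    · rw [extZero_apply_of_not _ hσ, extZero_apply_of_not]
      refine fun hh => hσ (hh.trans ?_)
      rw [h.comm]
      rintro _ ⟨y, rfl⟩
      exact ⟨_, rfl⟩
  · rw [map_add, map_sub, totMap_extZero h.right, add_comm, sub_add, sub_eq_self, sub_eq_zero]
    ext q σ
    rw [totMap_apply, totMap_apply]
    by_cases hσ : range (e₂.comp σ) ⊆ range e₁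
    · obtain ⟨ρ, hρ⟩ := exists_lift h3 (σ := e₂.comp σ)
        (fun x hx => h.range_inter ⟨hσ hx, by obtain ⟨y, rfl⟩ := hx; exact ⟨_, rfl⟩⟩)
      rw [← hρ]
      have e1 := congrFun (congrFun (totMap_extZero h3 (totMap i₁ x)) q) ρ
      rw [totMap_apply] at e1
      rw [e1]
      have e2 := congrFun (congrFun (totMap_extZero h.left x) q) (i₁.comp ρ)
      rw [totMap_apply] at e2
      exact e2.symm
    · rw [extZero_apply_of_not _ hσ, extZero_apply_of_not]
      refine fun hh => hσ (hh.trans ?_)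
      rintro _ ⟨y, rfl⟩
      exact ⟨_, rfl⟩

/-- Restriction to the two pieces is not injective on cochains, since a simplex may lie in neither;
its kernel consists of the cochains vanishing on small simplices and is therefore acyclic. -/
theorem acyclic (h : IsCoverSquare e₁ e₂ i₁ i₂) {Y : Set X} {x : Tot X} (hx : x ∈ relF {Y})
    (h1 : totMap e₁ x = 0) (h2 : totMap e₂ x = 0) (hd : d x = 0) :
    ∃ y ∈ relF {Y}, totMap e₁ y = 0 ∧ totMap e₂ y = 0 ∧ d y = x := by
  have hac := acyclic_relF (𝒰 := {range e₁, range e₂}) (fun x => by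
    rcases h.cover x with hx | hx
    · exact ⟨_, Or.inl rfl, hx⟩
    · exact ⟨_, Or.inr rfl, hx⟩) {Y}
  rw [totMap_eq_zero_iff h.left] at h1
  rw [totMap_eq_zero_iff h.right] at h2
  obtain ⟨y, ⟨hy1, hy2⟩, hy3⟩ := hac x ⟨fun q σ S hS hσ => by
    rcases hS with rfl | rfl
    · exact h1 q σ _ rfl hσ
    · exact h2 q σ _ rfl hσ, hx⟩ hd
  refine ⟨y, hy2, ?_, ?_, hy3⟩
  · exact (totMap_eq_zero_iff h.left).2 fun q σ S hS hσ => hy1 q σ S (Or.inl hS) hσ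
  · exact (totMap_eq_zero_iff h.right).2 fun q σ S hS hσ => hy1 q σ S (Or.inr hS) hσ

variable {X' X₁' X₂' X₃' : Type*} [TopologicalSpace X'] [TopologicalSpace X₁']
  [TopologicalSpace X₂'] [TopologicalSpace X₃'] {e₁' : C(X₁', X')} {e₂' : C(X₂', X')}
  {i₁' : C(X₃', X₁')} {i₂' : C(X₃', X₂')}

theorem qIso (h : IsCoverSquare e₁ e₂ i₁ i₂) (h' : IsCoverSquare e₁' e₂' i₁' i₂')
    {Y : Set X} {Y' : Set X'} {f : Tot X →+ Tot X'} {f₁ : Tot X₁ →+ Tot X₁'}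
    {f₂ : Tot X₂ →+ Tot X₂'} {f₃ : Tot X₃ →+ Tot X₃'}
    (comm : ∀ x, f (d x) = d (f x)) (maps : ∀ x ∈ relF {Y}, f x ∈ relF {Y'})
    (hf₁ : QIso (relF {e₁ ⁻¹' Y}) (relF {e₁' ⁻¹' Y'}) f₁)
    (hf₂ : QIso (relF {e₂ ⁻¹' Y}) (relF {e₂' ⁻¹' Y'}) f₂)
    (hf₃ : QIso (relF {e₁.comp i₁ ⁻¹' Y}) (relF {e₁'.comp i₁' ⁻¹' Y'}) f₃)
    (ne₁ : ∀ x, f₁ (totMap e₁ x) = totMap e₁' (f x))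
    (ne₂ : ∀ x, f₂ (totMap e₂ x) = totMap e₂' (f x))
    (ni₁ : ∀ x, f₃ (totMap i₁ x) = totMap i₁' (f₁ x))
    (ni₂ : ∀ x, f₃ (totMap i₂ x) = totMap i₂' (f₂ x)) : QIso (relF {Y}) (relF {Y'}) f := by
  refine QIso.of_mayerVietoris f f₁ f₂ f₃ (totMap e₁) (totMap e₂) (totMap i₁) (totMap i₂)
    (totMap e₁') (totMap e₂') (totMap i₁') (totMap i₂') (fun _ => d_mem_relF) (fun _ => d_mem_relF)
    (fun _ => d_mem_relF) (fun _ => d_mem_relF) comm maps hf₁ hf₂ hf₃ (totMap_d _) (totMap_d _)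
    (totMap_d _) (totMap_d _) (totMap_d _) (totMap_d _) (totMap_d _) (totMap_d _)
    (fun x hx => totMap_mem_preimage hx)
    (fun x hx => totMap_mem_preimage hx)
    (fun x hx => totMap_mem_preimage hx)
    (fun x hx => by
      rw [h.comm]
      exact totMap_mem_preimage hx)
    (fun x hx => totMap_mem_preimage hx)
    (fun x hx => totMap_mem_preimage hx)
    (fun x hx => totMap_mem_preimage hx)
    (fun x hx => by
      rw [h'.comm]
      exact totMap_mem_preimage hx)
    ne₁ ne₂ ni₁ ni₂ h.comm_totMap h'.comm_totMap
    (fun x hx y hy hxy => h.glue hx hy hxy) (fun x hx y hy hxy => h'.glue hx hy hxy)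
    (fun x hx => ⟨extZero i₁ x, extZero_mem (by rwa [image_singleton]), totMap_extZero h.inter x⟩)
    (fun x hx => ⟨extZero i₁' x, extZero_mem (by rwa [image_singleton]),
      totMap_extZero h'.inter x⟩)
    (fun x hx h1 h2 hd => h.acyclic hx h1 h2 hd) fun x hx h1 h2 hd => ?_
  obtain ⟨y, hy, -, -, hy'⟩ := h'.acyclic hx h1 h2 hd
  exact ⟨y, hy, hy'⟩

end IsCoverSquare

theorem isCoverSquare_of_isOpen {V₁ V₂ : Set X} (h1 : IsOpen V₁) (h2 : IsOpen V₂) {A : Set X}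
    (hA : A ⊆ V₁ ∪ V₂) :
    IsCoverSquare (ContinuousMap.inclusion (inter_subset_left : A ∩ V₁ ⊆ A))
      (ContinuousMap.inclusion (inter_subset_left : A ∩ V₂ ⊆ A))
      (ContinuousMap.inclusion (fun _ h => ⟨h.1, h.2.1⟩ : A ∩ (V₁ ∩ V₂) ⊆ A ∩ V₁))
      (ContinuousMap.inclusion (fun _ h => ⟨h.1, h.2.2⟩ : A ∩ (V₁ ∩ V₂) ⊆ A ∩ V₂)) := by
  have hr : ∀ V : Set X, range (ContinuousMap.inclusion (inter_subset_left : A ∩ V ⊆ A)) =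
      Subtype.val ⁻¹' V := by
    intro V
    ext x
    constructor
    · rintro ⟨y, rfl⟩
      exact y.2.2
    · intro hx
      exact ⟨⟨x.1, x.2, hx⟩, rfl⟩
  refine ⟨Topology.IsEmbedding.inclusion inter_subset_left,
    Topology.IsEmbedding.inclusion inter_subset_left,
    Topology.IsEmbedding.inclusion (inter_subset_inter_right A inter_subset_left), rfl, ?_,
    fun x => ?_⟩
  · rw [hr, hr]
    rintro x ⟨hx1, hx2⟩
    exact ⟨⟨x.1, x.2, hx1, hx2⟩, rfl⟩
  · rw [hr, hr, (h1.preimage continuous_subtype_val).interior_eq,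
      (h2.preimage continuous_subtype_val).interior_eq]
    exact hA x.2

/-! ## Thom cocycles over subsets of the base -/

/-- The restriction of `π` over a subset of the base. -/
def overMap (π : C(Z, U)) (A : Set U) : C(π ⁻¹' A, A) := π.restrictPreimage A

/-- `τ` is a Thom cocycle over `A`. -/
def IsThomOn (π : C(Z, U)) (Z₀ : Set Z) (τ : Cochain s Z) (A : Set U) : Prop :=
  IsThom (overMap π A) (Subtype.val ⁻¹' Z₀)
    (cochainMap s (⟨Subtype.val, continuous_subtype_val⟩ : C(π ⁻¹' A, Z)) τ)

variable {π : C(Z, U)} {Z₀ : Set Z} {τ : Cochain s Z}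

theorem cochain_eq_zero_of_isEmpty [IsEmpty X] (φ : Cochain q X) : φ = 0 := by
  ext σ
  obtain ⟨x⟩ : Nonempty (stdSimplex ℝ (Fin (q + 1))) := inferInstance
  exact isEmptyElim (σ x)

theorem tot_eq_of_isEmpty [IsEmpty X] (φ ψ : Tot X) : φ = ψ :=
  funext fun q => (cochain_eq_zero_of_isEmpty (φ q)).trans (cochain_eq_zero_of_isEmpty (ψ q)).symm

theorem isThomOn_empty : IsThomOn π Z₀ τ ∅ := by
  have : IsEmpty (π ⁻¹' (∅ : Set U)) := ⟨fun x => x.2⟩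
  refine ⟨fun x => tot_eq_of_isEmpty _ _, fun x _ => ?_, fun x _ y _ _ _ =>
    ⟨0, trivial, 0, zero_mem _, tot_eq_of_isEmpty _ _, tot_eq_of_isEmpty _ _⟩⟩
  rw [tot_eq_of_isEmpty (thomMap _ _ x) 0]
  exact zero_mem _

/-- The Thom map commutes with restriction, so it is a morphism between the Mayer–Vietoris sequences
of `A` and of its preimage. Only the traces of open sets on `A` are used, so `A` may be arbitrary.
-/
theorem IsThomOn.union (hτ : τ ∈ relCocycles s Z₀) {V₁ V₂ : Set U} (h1 : IsOpen V₁)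
    (h2 : IsOpen V₂) {A : Set U} (hA : A ⊆ V₁ ∪ V₂) (hA₁ : IsThomOn π Z₀ τ (A ∩ V₁))
    (hA₂ : IsThomOn π Z₀ τ (A ∩ V₂)) (hA₃ : IsThomOn π Z₀ τ (A ∩ (V₁ ∩ V₂))) :
    IsThomOn π Z₀ τ A := by
  have sq := isCoverSquare_of_isOpen h1 h2 hA
  have sq' := isCoverSquare_of_isOpen (h1.preimage π.continuous) (h2.preimage π.continuous)
    (A := π ⁻¹' A) (fun x hx => hA hx)
  rw [IsThomOn, IsThom, ← relF_singleton_empty] at hA₁ hA₂ hA₃ ⊢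
  refine sq.qIso sq' (Y := ∅) (thomMap_d ?_) (fun φ _ => cupR_mem_right ?_ _) hA₁ hA₂ hA₃
    (fun _ => rfl) (fun _ => rfl) (fun _ => rfl) (fun _ => rfl)
  · rw [coboundary_cochainMap, show coboundary s τ = 0 from hτ.2, map_zero]
  · rintro _ rfl
    exact cochainMap_mem_relCochains (f := ⟨Subtype.val, continuous_subtype_val⟩)
      (fun _ h => h) hτ.1

/-- A cocycle which is a Thom cocycle locally is a Thom cocycle. -/
theorem isThomOn_of_cover {ι : Type*} [Finite ι] (hτ : τ ∈ relCocycles s Z₀) (V : ι → Set U)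
    (hV : ∀ i, IsOpen (V i)) (hcov : ∀ x, ∃ i, x ∈ V i)
    (h : ∀ i, ∀ A ⊆ V i, IsThomOn π Z₀ τ A) (A : Set U) : IsThomOn π Z₀ τ A := by
  classical
  have := Fintype.ofFinite ι
  -- The induction is over all subsets of the partial union at once, because the intersection with
  -- the next open set is needed too.
  have key : ∀ F : Finset ι, ∀ A ⊆ ⋃ i ∈ F, V i, IsThomOn π Z₀ τ A := by
    intro F
    induction F using Finset.induction_on with
    | empty =>
      intro A hA
      obtain rfl : A = ∅ := by simpa using hA
      exact isThomOn_empty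
    | insert i F _ ih =>
      intro A hA
      rw [Finset.set_biUnion_insert] at hA
      exact IsThomOn.union hτ (hV i) (isOpen_biUnion fun j _ => hV j) hA
        (h i _ inter_subset_right) (ih _ inter_subset_right)
        (h i _ (inter_subset_right.trans inter_subset_left))
  refine key Finset.univ A fun x _ => ?_
  obtain ⟨i, hi⟩ := hcov x
  exact mem_biUnion (Finset.mem_univ i) hi

/-- A local trivialisation of `π` over `V` with fibre `ℝ^k`, under which `Z₀` corresponds to the
complement of the zero section. -/
structure IsTrivialization (π : C(Z, U)) (Z₀ : Set Z) (V : Set U) (c : Z → Fin k → ℝ)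
    (g : U × (Fin k → ℝ) → Z) : Prop where
  continuousOn_coord : ContinuousOn c (π ⁻¹' V)
  continuousOn_inv : ContinuousOn g (V ×ˢ univ)
  proj : ∀ u ∈ V, ∀ w, π (g (u, w)) = u
  coord : ∀ u ∈ V, ∀ w, c (g (u, w)) = w
  inv : ∀ z, π z ∈ V → g (π z, c z) = z
  mem : ∀ z, π z ∈ V → (z ∈ Z₀ ↔ c z ≠ 0)

namespace IsTrivialization

variable {V : Set U} {c : Z → Fin k → ℝ} {g : U × (Fin k → ℝ) → Z}

/-- The trivialisation over subsets. -/
def homeo (h : IsTrivialization π Z₀ V c g) {A : Set U} (hA : A ⊆ V) :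
    π ⁻¹' A ≃ₜ A × (Fin k → ℝ) where
  toFun z := (⟨π z, z.2⟩, c z)
  invFun x := ⟨g (x.1, x.2), by
    rw [mem_preimage, h.proj _ (hA x.1.2)]
    exact x.1.2⟩
  left_inv z := Subtype.ext (h.inv _ (hA z.2))
  right_inv x := Prod.ext (Subtype.ext (h.proj _ (hA x.1.2) _)) (h.coord _ (hA x.1.2) _)
  continuous_toFun := by
    refine ((π.continuous.comp continuous_subtype_val).subtype_mk _).prodMk ?_
    exact h.continuousOn_coord.comp_continuous continuous_subtype_val fun z => hA z.2
  continuous_invFun := by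
    refine Continuous.subtype_mk ?_ _
    exact h.continuousOn_inv.comp_continuous (by fun_prop) fun x => ⟨hA x.1.2, trivial⟩

/-- The inclusion of a fibre. -/
def fibre (h : IsTrivialization π Z₀ V c g) {x : U} (hx : x ∈ V) : C(Fin k → ℝ, Z) :=
  ⟨fun w => g (x, w), h.continuousOn_inv.comp_continuous (by fun_prop) fun _ => ⟨hx, trivial⟩⟩

/-- The trivialisation carries the problem to the product `A × ℝ^k`, where `isThom_of_fibre` asks
only for the behaviour on fibres. -/
theorem isThomOn (h : IsTrivialization π Z₀ V c g) {τ : Cochain k Z} (hτ : τ ∈ relCocycles k Z₀)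
    (hfib : ∀ x (hx : x ∈ V), ∃ n : ℤ, genCochain k - n • cochainMap k (h.fibre hx) τ ∈
      relCoboundaries k ({0}ᶜ : Set (Fin k → ℝ))) {A : Set U} (hA : A ⊆ V) :
    IsThomOn π Z₀ τ A := by
  set e := h.homeo hA with he
  let j : C(π ⁻¹' A, Z) := ⟨Subtype.val, continuous_subtype_val⟩
  let e' : C(A × (Fin k → ℝ), π ⁻¹' A) := (e.symm : C(A × (Fin k → ℝ), π ⁻¹' A))
  have hmem : MapsTo (j.comp e') (Prod.snd ⁻¹' {0}ᶜ) Z₀ := by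
    intro x hx
    refine (h.mem _ ?_).2 ?_
    · exact hA (e' x).2
    · change c (g (x.1, x.2)) ≠ 0
      rw [h.coord _ (hA x.1.2)]
      exact hx
  have h1 := isThom_of_fibre (τ := cochainMap k (j.comp e') τ)
    (cochainMap_mem_relCocycles hmem hτ) fun x => hfib x.1 (hA x.2)
  have h2 := IsThom.of_homeomorph e (π := overMap π A) (fun _ => rfl)
    (Z₀ := Subtype.val ⁻¹' Z₀) ?_ h1
  · rw [IsThomOn]
    convert h2 using 1
    change _ = cochainMap k ((j.comp e').comp (e : C(π ⁻¹' A, A × (Fin k → ℝ)))) τ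
    congr 2
    ext z
    exact congrArg Subtype.val (e.symm_apply_apply z).symm
  · ext z
    exact (h.mem _ (hA z.2)).symm

end IsTrivialization

end SingCoh

end

noncomputable section

open Function Set DiffGroup SingCoh

set_option linter.unusedSectionVars false

open scoped LinearAlgebra.Projectivization

namespace ProjJoin

/-! ## The topology of projective spaces -/

variable {V V' W Y T : Type*} [NormedAddCommGroup V] [NormedSpace ℂ V] [NormedAddCommGroup V']
  [NormedSpace ℂ V'] [NormedAddCommGroup W] [NormedSpace ℂ W] [TopologicalSpace Y]
  [TopologicalSpace T]

/-- The saturation of an open set is the union of its translates by nonzero scalars. -/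
theorem isOpenQuotientMap_mk' :
    IsOpenQuotientMap (Projectivization.mk' ℂ : {v : V // v ≠ 0} → ℙ ℂ V) := by
  have hq : Topology.IsQuotientMap (Projectivization.mk' ℂ : {v : V // v ≠ 0} → ℙ ℂ V) :=
    isQuotientMap_quotient_mk'
  refine ⟨hq.surjective, hq.continuous, fun O hO => ?_⟩
  rw [← hq.isOpen_preimage]
  have h : (Projectivization.mk' ℂ : {v : V // v ≠ 0} → ℙ ℂ V) ⁻¹' (Projectivization.mk' ℂ '' O) =
      ⋃ c : ℂˣ, (fun v : {v : V // v ≠ 0} =>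
        (⟨c • v.1, (smul_ne_zero_iff_ne c).2 v.2⟩ : {v : V // v ≠ 0})) ⁻¹' O := by
    ext v
    simp only [mem_preimage, mem_image, mem_iUnion]
    constructor
    · rintro ⟨w, hw, h⟩
      obtain ⟨c, hc⟩ := (Projectivization.mk_eq_mk_iff ℂ w.1 v.1 w.2 v.2).1 h
      exact ⟨c, by convert hw⟩
    · rintro ⟨c, hc⟩
      exact ⟨_, hc, (Projectivization.mk_eq_mk_iff ℂ _ _ _ v.2).2 ⟨c, rfl⟩⟩
  rw [h]
  refine isOpen_iUnion fun c => hO.preimage (Continuous.subtype_mk ?_ _)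
  exact continuous_subtype_val.const_smul c

/-- Openness of the quotient map is what matters: an open quotient map stays a quotient map after
restriction to preimages and after products, so homotopies can be checked on homogeneous
coordinates. -/
theorem continuous_iff_mk {S : Set (ℙ ℂ V)} {f : S × Y → T} : Continuous f ↔
    Continuous fun p : ((Projectivization.mk' ℂ : {v : V // v ≠ 0} → ℙ ℂ V) ⁻¹' S) × Y =>
      f (⟨Projectivization.mk' ℂ p.1.1, p.1.2⟩, p.2) :=
  ((isOpenQuotientMap_mk'.restrictPreimage S).prodMap IsOpenQuotientMap.id).continuous_comp_iff.symm

theorem continuous_mk {f : T → V} (hf : Continuous f) (h : ∀ x, f x ≠ 0) :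
    Continuous fun x => Projectivization.mk ℂ (f x) (h x) :=
  isOpenQuotientMap_mk'.continuous.comp (hf.subtype_mk h)

/-- The map `([v], y) ↦ [f(v, y)]` given by a homogeneous function `f`, on a subset on which `f`
does not vanish. -/
def projMap (S : Set (ℙ ℂ V)) (f : V → Y → W)
    (h0 : ∀ v (hv : v ≠ 0), Projectivization.mk ℂ v hv ∈ S → ∀ y, f v y ≠ 0)
    (hc : Continuous (uncurry f)) (hs : ∀ (c : ℂ) v y, f (c • v) y = c • f v y) :
    C(S × Y, ℙ ℂ W) where
  toFun p := Projectivization.mk ℂ (f p.1.1.rep p.2) (h0 _ p.1.1.rep_nonzero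
    (by rw [Projectivization.mk_rep]; exact p.1.2) _)
  continuous_toFun := by
    rw [continuous_iff_mk]
    have h : ∀ p : ((Projectivization.mk' ℂ : {v : V // v ≠ 0} → ℙ ℂ V) ⁻¹' S) × Y,
        f p.1.1.1 p.2 ≠ 0 := fun p => h0 _ p.1.1.2 p.1.2 _
    convert continuous_mk (f := fun p : ((Projectivization.mk' ℂ : {v : V // v ≠ 0} → ℙ ℂ V) ⁻¹' S)
      × Y => f p.1.1.1 p.2) (hc.comp (by fun_prop : Continuous fun p :
        ((Projectivization.mk' ℂ : {v : V // v ≠ 0} → ℙ ℂ V) ⁻¹' S) × Y => (p.1.1.1, p.2))) h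
          using 2 with p
    rw [Projectivization.mk_eq_mk_iff]
    obtain ⟨c, hc⟩ := Projectivization.exists_smul_eq_mk_rep ℂ p.1.1.1 p.1.1.2
    refine ⟨c, ?_⟩
    change c.1 • _ = f (Projectivization.mk ℂ p.1.1.1 p.1.1.2).rep p.2
    rw [← hc, ← hs]
    rfl

theorem projMap_mk {S : Set (ℙ ℂ V)} {f : V → Y → W}
    {h0 : ∀ v (hv : v ≠ 0), Projectivization.mk ℂ v hv ∈ S → ∀ y, f v y ≠ 0}
    {hc : Continuous (uncurry f)} {hs : ∀ (c : ℂ) v y, f (c • v) y = c • f v y} {v : V}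
    (hv : v ≠ 0) (h : Projectivization.mk ℂ v hv ∈ S) (y : Y) :
    projMap S f h0 hc hs (⟨Projectivization.mk ℂ v hv, h⟩, y) =
      Projectivization.mk ℂ (f v y) (h0 v hv h y) := by
  change Projectivization.mk ℂ _ _ = _
  rw [Projectivization.mk_eq_mk_iff]
  obtain ⟨c, hc⟩ := Projectivization.exists_smul_eq_mk_rep ℂ v hv
  refine ⟨c, ?_⟩
  change c.1 • _ = f (Projectivization.mk ℂ v hv).rep y
  rw [← hc, ← hs]
  rfl

/-- The points at which a linear map does not vanish. -/
def neSet (f : V →ₗ[ℂ] V') : Set (ℙ ℂ V) := {x | f x.rep ≠ 0}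

theorem mk_mem_neSet {f : V →ₗ[ℂ] V'} {v : V} {hv : v ≠ 0} :
    Projectivization.mk ℂ v hv ∈ neSet f ↔ f v ≠ 0 := by
  obtain ⟨c, hc⟩ := Projectivization.exists_smul_eq_mk_rep ℂ v hv
  change f (Projectivization.mk ℂ v hv).rep ≠ 0 ↔ _
  rw [← hc, ← (smul_ne_zero_iff_ne c : _ ↔ f v ≠ 0)]
  exact not_congr (by rw [show f (c • v) = c • f v from f.map_smul c.1 v])

section FiniteDimensional

variable [FiniteDimensional ℂ V]

/-- The map of projective spaces induced by an injective linear map. -/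
def linMap (φ : V →ₗ[ℂ] W) (hφ : Injective φ) : C(ℙ ℂ V, ℙ ℂ W) :=
  ⟨Projectivization.map φ hφ, by
    rw [← isOpenQuotientMap_mk'.continuous_comp_iff]
    exact continuous_mk (f := fun v : {v : V // v ≠ 0} => φ v.1)
      (φ.continuous_of_finiteDimensional.comp continuous_subtype_val)
      fun v h => v.2 (hφ (by rw [h, map_zero]))⟩

theorem linMap_mk (φ : V →ₗ[ℂ] W) (hφ : Injective φ) (v : V) (hv : v ≠ 0) :
    linMap φ hφ (Projectivization.mk ℂ v hv) =
      Projectivization.mk ℂ (φ v) fun h => hv (hφ (by rw [h, map_zero])) := rfl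

/-- Linear isomorphisms induce homeomorphisms. -/
def linHomeo [FiniteDimensional ℂ W] (φ : V ≃ₗ[ℂ] W) : ℙ ℂ V ≃ₜ ℙ ℂ W where
  toFun := linMap φ.toLinearMap φ.injective
  invFun := linMap φ.symm.toLinearMap φ.symm.injective
  left_inv x := by
    induction x using Projectivization.ind with
    | h v hv => simp [linMap_mk]
  right_inv x := by
    induction x using Projectivization.ind with
    | h v hv => simp [linMap_mk]
  continuous_toFun := (linMap _ _).continuous
  continuous_invFun := (linMap _ _).continuous

theorem isOpen_neSet (f : V →ₗ[ℂ] V') : IsOpen (neSet f) := by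
  rw [← isOpenQuotientMap_mk'.isQuotientMap.isOpen_preimage]
  have h : (Projectivization.mk' ℂ : {v : V // v ≠ 0} → ℙ ℂ V) ⁻¹' neSet f =
      {v | f v.1 ≠ 0} := by
    ext v
    exact mk_mem_neSet (hv := v.2)
  rw [h]
  exact isOpen_ne_fun (f.continuous_of_finiteDimensional.comp continuous_subtype_val)
    continuous_const

/-- The partially defined map of projective spaces induced by a linear map. -/
def partialMap (f : V →ₗ[ℂ] V') : C(neSet f, ℙ ℂ V') :=
  (projMap (neSet f) (fun v (_ : Unit) => f v) (fun _ _ h _ => mk_mem_neSet.1 h)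
    (f.continuous_of_finiteDimensional.comp continuous_fst) fun _ _ _ => map_smul _ _ _).comp
    ((ContinuousMap.id _).prodMk (ContinuousMap.const _ ()))

theorem partialMap_mk (f : V →ₗ[ℂ] V') {v : V} (hv : v ≠ 0)
    (h : Projectivization.mk ℂ v hv ∈ neSet f) :
    partialMap f ⟨Projectivization.mk ℂ v hv, h⟩ =
      Projectivization.mk ℂ (f v) (mk_mem_neSet.1 h) := by
  rw [partialMap, ContinuousMap.comp_apply]
  exact projMap_mk hv h ()

end FiniteDimensional

/-! ## The two parts of `ℙ(V × W)` -/

variable (V W) in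
/-- The complement of `ℙ(W)` in `ℙ(V × W)`. -/
def bundle : Set (ℙ ℂ (V × W)) := neSet (LinearMap.fst ℂ V W)

variable (V W) in
/-- The complement of `ℙ(V)` in `ℙ(V × W)`. -/
def outer : Set (ℙ ℂ (V × W)) := neSet (LinearMap.snd ℂ V W)

theorem mk_mem_bundle {v : V × W} {hv : v ≠ 0} :
    Projectivization.mk ℂ v hv ∈ bundle V W ↔ v.1 ≠ 0 := mk_mem_neSet

theorem mk_mem_outer {v : V × W} {hv : v ≠ 0} :
    Projectivization.mk ℂ v hv ∈ outer V W ↔ v.2 ≠ 0 := mk_mem_neSet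

theorem mem_bundle_or_outer (x : ℙ ℂ (V × W)) : x ∈ outer V W ∨ x ∈ bundle V W := by
  induction x using Projectivization.ind with
  | h v hv =>
    rw [mk_mem_bundle, mk_mem_outer]
    by_contra! h
    exact hv (Prod.ext h.2 h.1)

variable (V W) [FiniteDimensional ℂ V] [FiniteDimensional ℂ W]

/-- The projection `[v : w] ↦ [v]`. -/
def bundleProj : C(bundle V W, ℙ ℂ V) := partialMap _

/-- The projection `[v : w] ↦ [w]`. -/
def outerProj : C(outer V W, ℙ ℂ W) := partialMap _

/-- The inclusion of `ℙ(V)`. -/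
def inlP : C(ℙ ℂ V, ℙ ℂ (V × W)) := linMap (LinearMap.inl ℂ V W) LinearMap.inl_injective

/-- The inclusion of `ℙ(W)`. -/
def inrP : C(ℙ ℂ W, ℙ ℂ (V × W)) := linMap (LinearMap.inr ℂ V W) LinearMap.inr_injective

variable {V W} in
theorem bundleProj_mk {v : V × W} (hv : v ≠ 0) (h : Projectivization.mk ℂ v hv ∈ bundle V W) :
    bundleProj V W ⟨Projectivization.mk ℂ v hv, h⟩ =
      Projectivization.mk ℂ v.1 (mk_mem_bundle.1 h) := partialMap_mk _ _ _

variable {V W} in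
theorem outerProj_mk {v : V × W} (hv : v ≠ 0) (h : Projectivization.mk ℂ v hv ∈ outer V W) :
    outerProj V W ⟨Projectivization.mk ℂ v hv, h⟩ =
      Projectivization.mk ℂ v.2 (mk_mem_outer.1 h) := partialMap_mk _ _ _

theorem inlP_mk (v : V) (hv : v ≠ 0) : inlP V W (Projectivization.mk ℂ v hv) =
    Projectivization.mk ℂ (v, 0) fun h => hv (congrArg Prod.fst h) := rfl

theorem inrP_mk (w : W) (hw : w ≠ 0) : inrP V W (Projectivization.mk ℂ w hw) =
    Projectivization.mk ℂ (0, w) fun h => hw (congrArg Prod.snd h) := rfl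

theorem inrP_mem_outer (x : ℙ ℂ W) : inrP V W x ∈ outer V W := by
  induction x using Projectivization.ind with
  | h w hw => exact mk_mem_outer.2 hw

/-- The inclusion of `ℙ(W)` in the complement of `ℙ(V)`. -/
def inrOuter : C(ℙ ℂ W, outer V W) :=
  ⟨fun x => ⟨inrP V W x, inrP_mem_outer V W x⟩, (inrP V W).continuous.subtype_mk _⟩

/-- The contraction `[v : w] ↦ [tv : w]`. -/
def outerHomotopy : C(outer V W × unitInterval, ℙ ℂ (V × W)) :=
  projMap _ (fun x t => (((t : ℝ) : ℂ) • x.1, x.2))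
    (fun _ _ h _ h' => mk_mem_neSet.1 h (congrArg Prod.snd h')) (by
      simp only [uncurry_def]
      fun_prop) fun c v t => by
        simp [smul_comm c]

/-- The contraction `[v : w] ↦ [v : tw]`. -/
def bundleHomotopy : C(bundle V W × unitInterval, ℙ ℂ (V × W)) :=
  projMap _ (fun x t => (x.1, ((t : ℝ) : ℂ) • x.2))
    (fun _ _ h _ h' => mk_mem_neSet.1 h (congrArg Prod.fst h')) (by
      simp only [uncurry_def]
      fun_prop) fun c v t => by
        simp [smul_comm c]

variable {V W}

theorem outerHomotopy_mk {v : V × W} (hv : v ≠ 0) (h : Projectivization.mk ℂ v hv ∈ outer V W)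
    (t : unitInterval) : outerHomotopy V W (⟨Projectivization.mk ℂ v hv, h⟩, t) =
      Projectivization.mk ℂ (((t : ℝ) : ℂ) • v.1, v.2)
        fun h' => mk_mem_outer.1 h (congrArg Prod.snd h') := projMap_mk _ _ _

theorem bundleHomotopy_mk {v : V × W} (hv : v ≠ 0) (h : Projectivization.mk ℂ v hv ∈ bundle V W)
    (t : unitInterval) : bundleHomotopy V W (⟨Projectivization.mk ℂ v hv, h⟩, t) =
      Projectivization.mk ℂ (v.1, ((t : ℝ) : ℂ) • v.2)
        fun h' => mk_mem_bundle.1 h (congrArg Prod.fst h') := projMap_mk _ _ _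

theorem outerHomotopy_zero (x : outer V W) :
    outerHomotopy V W (x, 0) = inrP V W (outerProj V W x) := by
  obtain ⟨x, hx⟩ := x
  induction x using Projectivization.ind with
  | h v hv =>
    rw [outerHomotopy_mk, outerProj_mk, inrP_mk]
    simp

theorem outerHomotopy_one (x : outer V W) : outerHomotopy V W (x, 1) = x := by
  obtain ⟨x, hx⟩ := x
  induction x using Projectivization.ind with
  | h v hv =>
    rw [outerHomotopy_mk]
    simp

theorem outerHomotopy_mem (x : outer V W) (t : unitInterval) :
    outerHomotopy V W (x, t) ∈ outer V W := by
  obtain ⟨x, hx⟩ := x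
  induction x using Projectivization.ind with
  | h v hv =>
    rw [outerHomotopy_mk, mk_mem_outer]
    exact (mk_mem_outer (hv := hv)).1 hx

theorem bundleHomotopy_zero (x : bundle V W) :
    bundleHomotopy V W (x, 0) = inlP V W (bundleProj V W x) := by
  obtain ⟨x, hx⟩ := x
  induction x using Projectivization.ind with
  | h v hv =>
    rw [bundleHomotopy_mk, bundleProj_mk, inlP_mk]
    simp

theorem bundleHomotopy_one (x : bundle V W) : bundleHomotopy V W (x, 1) = x := by
  obtain ⟨x, hx⟩ := x
  induction x using Projectivization.ind with
  | h v hv =>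
    rw [bundleHomotopy_mk]
    simp

theorem outerProj_inrOuter (x : ℙ ℂ W) : outerProj V W (inrOuter V W x) = x := by
  induction x using Projectivization.ind with
  | h w hw => exact outerProj_mk (V := V) (v := (0, w)) _ _

theorem isEmbedding_inrOuter : Topology.IsEmbedding (inrOuter V W) :=
  Topology.IsEmbedding.of_leftInverse outerProj_inrOuter (outerProj V W).continuous
    (inrOuter V W).continuous

theorem isEmbedding_inrP : Topology.IsEmbedding (inrP V W) :=
  Topology.IsEmbedding.subtypeVal.comp isEmbedding_inrOuter

/-- The contraction of the complement of `ℙ(V)` onto `ℙ(W)`. -/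
theorem qIso_inrOuter : QIso ⊤ ⊤ (totMap (inrOuter V W)) := by
  have h := qIso_of_homotopyEquiv (f := inrOuter V W) (g := outerProj V W)
    (F := ContinuousMap.fst)
    (G := ⟨fun x => ⟨outerHomotopy V W x, outerHomotopy_mem x.1 x.2⟩,
      (outerHomotopy V W).continuous.subtype_mk _⟩)
    (𝒴 := ∅) (𝒴' := ∅) (fun x => (outerProj_inrOuter x).symm) (fun _ => rfl)
    (fun x => Subtype.ext (outerHomotopy_zero x)) (fun x => Subtype.ext (outerHomotopy_one x))
    (by simp) (by simp) (by simp) (by simp)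
  rwa [relF_empty, relF_empty] at h

/-- The homotopy `[tv : w]` retracts the complement of `ℙ(V)` onto `ℙ(W)`. Replacing `ℙ(W)` by this
open neighbourhood makes excision available. -/
theorem qIso_outer :
    QIso (relF {outer V W}) (relF {range (inrP V W)}) (AddMonoidHom.id (Tot (ℙ ℂ (V × W)))) := by
  have h := qIso_of_subset (e := (⟨Subtype.val, continuous_subtype_val⟩ :
    C(outer V W, ℙ ℂ (V × W)))) (i := inrOuter V W) Topology.IsEmbedding.subtypeVal
    isEmbedding_inrOuter qIso_inrOuter
  rw [show range (⟨Subtype.val, continuous_subtype_val⟩ : C(outer V W, ℙ ℂ (V × W))) =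
    outer V W from Subtype.range_val] at h
  exact h

end ProjJoin

end

/-! ### Cells and low-degree cohomology of complex projective spaces -/

noncomputable section

open Function Set DiffGroup SingCoh Module

set_option linter.unusedSectionVars false

open scoped LinearAlgebra.Projectivization

namespace ProjJoin

variable {V V' W : Type} [NormedAddCommGroup V] [NormedSpace ℂ V] [NormedAddCommGroup V']
  [NormedSpace ℂ V'] [NormedAddCommGroup W] [NormedSpace ℂ W] [FiniteDimensional ℂ V]
  [FiniteDimensional ℂ V'] [FiniteDimensional ℂ W] {d q : ℕ}

theorem continuousOn_iff_mk {T : Type*} [TopologicalSpace T] {S : Set (ℙ ℂ V)} {f : ℙ ℂ V → T} :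
    ContinuousOn f S ↔
      Continuous fun v : (Projectivization.mk' ℂ : {v : V // v ≠ 0} → ℙ ℂ V) ⁻¹' S =>
        f (Projectivization.mk' ℂ v.1) := by
  rw [continuousOn_iff_continuous_domRestrict,
    ← (isOpenQuotientMap_mk'.restrictPreimage S).continuous_comp_iff]
  rfl

/-- The coordinate `[v : w] ↦ w / ℓ(v)`. -/
def chartCoord (ℓ : V →ₗ[ℂ] ℂ) (x : ℙ ℂ (V × W)) : W := (ℓ x.rep.1)⁻¹ • x.rep.2

theorem chartCoord_mk (ℓ : V →ₗ[ℂ] ℂ) {v : V × W} (hv : v ≠ 0) :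
    chartCoord ℓ (Projectivization.mk ℂ v hv) = (ℓ v.1)⁻¹ • v.2 := by
  obtain ⟨c, hc⟩ := Projectivization.exists_smul_eq_mk_rep ℂ v hv
  rw [chartCoord, ← hc]
  change (ℓ (c.1 • v.1))⁻¹ • c.1 • v.2 = _
  rw [map_smul, smul_smul, smul_eq_mul, mul_inv, mul_comm c.1⁻¹, mul_assoc,
    inv_mul_cancel₀ c.ne_zero, mul_one]

theorem continuousOn_chartCoord (ℓ : V →ₗ[ℂ] ℂ) :
    ContinuousOn (chartCoord ℓ : ℙ ℂ (V × W) → W) (neSet (ℓ.comp (LinearMap.fst ℂ V W))) := by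
  rw [continuousOn_iff_mk]
  have h : ∀ v : (Projectivization.mk' ℂ : {v : V × W // v ≠ 0} → ℙ ℂ (V × W)) ⁻¹'
      neSet (ℓ.comp (LinearMap.fst ℂ V W)), ℓ v.1.1.1 ≠ 0 := fun v =>
    (mk_mem_neSet (f := ℓ.comp (LinearMap.fst ℂ V W)) (hv := v.1.2)).1 v.2
  have he : (fun v : (Projectivization.mk' ℂ : {v : V × W // v ≠ 0} → ℙ ℂ (V × W)) ⁻¹'
      neSet (ℓ.comp (LinearMap.fst ℂ V W)) => chartCoord ℓ (Projectivization.mk' ℂ v.1)) =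
      fun v => (ℓ v.1.1.1)⁻¹ • v.1.1.2 := funext fun v => chartCoord_mk ℓ v.1.2
  rw [he]
  refine Continuous.smul (Continuous.inv₀ ?_ h) (by fun_prop)
  exact ℓ.continuous_of_finiteDimensional.comp (by fun_prop)

/-- The inclusion `w ↦ [v : w]` of a fibre of the projection `[v : w] ↦ [v]`. -/
def fibreMap (W : Type) [NormedAddCommGroup W] [NormedSpace ℂ W] (v : V) (hv : v ≠ 0) :
    C(W, ℙ ℂ (V × W)) :=
  ⟨fun w => Projectivization.mk ℂ (v, w) fun h => hv (congrArg Prod.fst h),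
    continuous_mk (by fun_prop) _⟩

theorem range_fibreMap_one : range (fibreMap W (1 : ℂ) one_ne_zero) = bundle ℂ W := by
  ext x
  constructor
  · rintro ⟨w, rfl⟩
    exact mk_mem_bundle.2 one_ne_zero
  · intro hx
    induction x using Projectivization.ind with
    | h v hv =>
      rw [mk_mem_bundle] at hx
      refine ⟨v.1⁻¹ • v.2, (Projectivization.mk_eq_mk_iff' ℂ _ _ _ _).2 ⟨v.1⁻¹, ?_⟩⟩
      ext
      · simp [hx]
      · rfl

theorem isEmbedding_fibreMap_one :
    Topology.IsEmbedding (fibreMap W (1 : ℂ) one_ne_zero) := by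
  have hm : ∀ w, fibreMap W (1 : ℂ) one_ne_zero w ∈ neSet (LinearMap.id.comp
    (LinearMap.fst ℂ ℂ W)) := fun w => mk_mem_neSet.2 one_ne_zero
  have h : Topology.IsEmbedding fun w => (⟨fibreMap W (1 : ℂ) one_ne_zero w, hm w⟩ :
      neSet (LinearMap.id.comp (LinearMap.fst ℂ ℂ W))) := by
    refine Topology.IsEmbedding.of_leftInverse
      (f := fun x => chartCoord LinearMap.id x.1) (fun w => ?_)
      (continuousOn_iff_continuous_domRestrict.1 (continuousOn_chartCoord _))
      ((fibreMap W (1 : ℂ) one_ne_zero).continuous.subtype_mk hm)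
    change chartCoord LinearMap.id (Projectivization.mk ℂ ((1 : ℂ), w) _) = w
    rw [chartCoord_mk]
    simp
  exact Topology.IsEmbedding.subtypeVal.comp h

/-- A complex vector space is a real one of twice the dimension. -/
def euclid (hd : 2 * finrank ℂ W = d) : W ≃L[ℝ] (Fin d → ℝ) :=
  ContinuousLinearEquiv.ofFinrankEq (by rw [finrank_real_of_complex, hd, finrank_fin_fun])

/-- The map `ℝ^d → ℙ(V × W)`, `w ↦ [v : w]`. -/
def fibreCoord (hd : 2 * finrank ℂ W = d) (v : V) (hv : v ≠ 0) : C(Fin d → ℝ, ℙ ℂ (V × W)) :=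
  (fibreMap W v hv).comp ⟨(euclid hd).symm, (euclid hd).symm.continuous⟩

theorem fibreCoord_apply (hd : 2 * finrank ℂ W = d) (v : V) (hv : v ≠ 0) (x : Fin d → ℝ) :
    fibreCoord hd v hv x =
      Projectivization.mk ℂ (v, (euclid hd).symm x) fun h => hv (congrArg Prod.fst h) := rfl

theorem preimage_fibreCoord (hd : 2 * finrank ℂ W = d) (v : V) (hv : v ≠ 0) :
    fibreCoord hd v hv ⁻¹' outer V W = {0}ᶜ := by
  ext x
  rw [mem_preimage, fibreCoord_apply, mk_mem_outer]
  simp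

theorem isOpen_bundle : IsOpen (bundle V W) := isOpen_neSet _

theorem isOpen_outer : IsOpen (outer V W) := isOpen_neSet _

/-- The pair `(ℙ(ℂ × W), ℙ(W))` is a relative cell. -/
theorem qIso_cell (hd : 2 * finrank ℂ W = d) : QIso (relF {outer ℂ W})
    (relF {({0}ᶜ : Set (Fin d → ℝ))}) (totMap (fibreCoord hd (1 : ℂ) one_ne_zero)) := by
  have h := qIso_excision (e := fibreCoord hd (1 : ℂ) one_ne_zero) (T := outer ℂ W)
    (isEmbedding_fibreMap_one.comp (euclid hd).symm.toHomeomorph.isEmbedding) fun x => by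
      have hr : range (fibreCoord hd (1 : ℂ) one_ne_zero) = bundle ℂ W := by
        rw [← range_fibreMap_one]
        exact (euclid hd).symm.surjective.range_comp (fibreMap W (1 : ℂ) one_ne_zero)
      rw [hr, isOpen_bundle.interior_eq, isOpen_outer.interior_eq]
      exact mem_bundle_or_outer x
  rwa [preimage_fibreCoord] at h

theorem mapsTo_range_inrP :
    MapsTo (ContinuousMap.id (ℙ ℂ (V × W))) (range (inrP V W)) (outer V W) := by
  rintro _ ⟨x, rfl⟩
  exact inrP_mem_outer V W x

theorem mapsTo_fibreCoord (hd : 2 * finrank ℂ W = d) (v : V) (hv : v ≠ 0) :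
    MapsTo (fibreCoord hd v hv) {0}ᶜ (outer V W) := (preimage_fibreCoord hd v hv).ge

theorem bijective_outer (q : ℕ) : Bijective (pullback q (ContinuousMap.id (ℙ ℂ (V × W)))
    (mapsTo_range_inrP (V := V) (W := W))) :=
  bijective_pullback _ qIso_outer q

theorem bijective_cell (hd : 2 * finrank ℂ W = d) (q : ℕ) :
    Bijective (pullback q (fibreCoord hd (1 : ℂ) one_ne_zero)
      (mapsTo_fibreCoord hd (1 : ℂ) one_ne_zero)) :=
  bijective_pullback _ (qIso_cell hd) q

/-- `ℙ(ℂ × W)` arises from `ℙ(W)` by attaching the affine space `[1 : w]`, a cell of real dimension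
`d`. -/
theorem subsingleton_H_cell (hd : 2 * finrank ℂ W = d) (hq : q ≠ d) :
    Subsingleton (H q (ℙ ℂ (ℂ × W)) (range (inrP ℂ W))) := by
  have := subsingleton_H_euclidean hq
  have h1 : Subsingleton (H q (ℙ ℂ (ℂ × W)) (outer ℂ W)) := (bijective_cell hd q).1.subsingleton
  exact (bijective_outer q).2.subsingleton

theorem bijective_homeomorph {X X' : Type*} [TopologicalSpace X] [TopologicalSpace X']
    (h : X ≃ₜ X') (q : ℕ) :
    Bijective (pullback q (h : C(X, X')) (mapsTo_empty _ _) : H q X' ∅ →+ H q X ∅) := by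
  refine bijective_pullback _ (qIso_of_homeomorph h ?_ ?_) q
  · rintro _ rfl
    exact ⟨_, rfl, mapsTo_empty _ _⟩
  · rintro _ rfl
    exact ⟨_, rfl, mapsTo_empty _ _⟩

theorem subsingleton_H_of_isEmpty {X : Type*} [TopologicalSpace X] [IsEmpty X] (Y : Set X) :
    Subsingleton (H q X Y) := by
  refine subsingleton_of_forall_eq 0 fun x => ?_
  obtain ⟨φ, rfl⟩ := H.mk_surjective _ x
  rw [H.mk_eq_zero_iff, cochain_eq_zero_of_isEmpty φ.1]
  exact zero_mem _

theorem exists_equiv_prod (h : finrank ℂ V = d + 1) :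
    Nonempty (V ≃ₗ[ℂ] ℂ × (Fin d → ℂ)) :=
  ⟨LinearEquiv.ofFinrankEq _ _ (by
    rw [finrank_prod, finrank_self, finrank_fin_fun, h, add_comm])⟩

/-- The bound says `q > 2 (d - 1)`, the real dimension, written without subtraction so that `d = 0`,
the empty space, is a valid start. Each step attaches a cell of dimension `2 d < q`. -/
theorem subsingleton_H_proj : ∀ {d : ℕ} {V : Type} [NormedAddCommGroup V] [NormedSpace ℂ V]
    [FiniteDimensional ℂ V] {q : ℕ}, finrank ℂ V = d → 2 * d < q + 2 →
      Subsingleton (H q (ℙ ℂ V) ∅) := by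
  intro d
  induction d with
  | zero =>
    intro V _ _ _ q hV _
    have : Subsingleton V := finrank_zero_iff.1 hV
    have : IsEmpty (ℙ ℂ V) := inferInstance
    exact subsingleton_H_of_isEmpty _
  | succ d ih =>
    intro V _ _ _ q hV hq
    obtain ⟨e⟩ := exists_equiv_prod hV
    have h1 : Subsingleton (H q (ℙ ℂ (Fin d → ℂ)) ∅) := ih (finrank_fin_fun ℂ) (by omega)
    have h2 := (pullback_injective_of_rel isEmbedding_inrP
      (subsingleton_H_cell (W := Fin d → ℂ) (q := q) rfl
        (by rw [finrank_fin_fun]; omega))).subsingleton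
    exact (bijective_homeomorph (linHomeo e) q).2.subsingleton

theorem linMap_comp (φ : V →ₗ[ℂ] V') (hφ : Injective φ) (ψ : V' →ₗ[ℂ] W) (hψ : Injective ψ) :
    (linMap ψ hψ).comp (linMap φ hφ) = linMap (ψ.comp φ) (hψ.comp hφ) := by
  ext x
  induction x using Projectivization.ind with
  | h v hv => rfl

/-- The attached cell has real dimension at least `4`, so the relative groups in degrees `2` and `3`
vanish. -/
theorem bijective_H2_inrP (h : 2 ≤ finrank ℂ W) :
    Bijective (pullback 2 (inrP ℂ W) (mapsTo_empty _ _) :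
      H 2 (ℙ ℂ (ℂ × W)) ∅ →+ H 2 (ℙ ℂ W) ∅) :=
  ⟨pullback_injective_of_rel isEmbedding_inrP (subsingleton_H_cell rfl (by omega)),
    pullback_surjective_of_rel isEmbedding_inrP (subsingleton_H_cell rfl (by omega))⟩

/-- Induction on the codimension, each step inserting a hyperplane which contains the image.
Two-dimensional source spaces, whose projectivisation is `ℂP^1`, are the smallest for which this
holds. -/
theorem bijective_H2_linMap : ∀ {k : ℕ} {V W : Type} [NormedAddCommGroup V] [NormedSpace ℂ V]
    [FiniteDimensional ℂ V] [NormedAddCommGroup W] [NormedSpace ℂ W] [FiniteDimensional ℂ W]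
    (φ : V →ₗ[ℂ] W) (hφ : Injective φ), finrank ℂ W = finrank ℂ V + k → 2 ≤ finrank ℂ V →
      Bijective (pullback 2 (linMap φ hφ) (mapsTo_empty _ _) :
        H 2 (ℙ ℂ W) ∅ →+ H 2 (ℙ ℂ V) ∅) := by
  intro k
  induction k with
  | zero =>
    intro V W _ _ _ _ _ _ φ hφ hk _
    exact bijective_homeomorph (linHomeo (LinearEquiv.ofInjectiveOfFinrankEq φ hφ
      (by rw [hk, add_zero]))) 2
  | succ k ih =>
    intro V W _ _ _ _ _ _ φ hφ hk h2
    -- The image is proper, so it lies in a hyperplane `K = ker ℓ`; a vector `w` with `ℓ w = 1`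
    -- splits `W` as `ℂ × K` and reduces to `bijective_H2_inrP`.
    have hlt : LinearMap.range φ < ⊤ := by
      refine lt_top_iff_ne_top.2 fun h => ?_
      have := LinearMap.finrank_range_of_inj hφ
      rw [h, finrank_top] at this
      omega
    obtain ⟨ℓ, hℓ, hle⟩ := Submodule.exists_le_ker_of_lt_top _ hlt
    obtain ⟨w, hw⟩ : ∃ w, ℓ w = 1 := LinearMap.surjective hℓ 1
    set K := LinearMap.ker ℓ with hK
    let φ' : V →ₗ[ℂ] K := φ.codRestrict K fun v => hle ⟨v, rfl⟩
    have hφ' : Injective φ' := fun a b h => hφ (congrArg Subtype.val h)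
    let ψ : ℂ × K →ₗ[ℂ] W := (LinearMap.toSpanSingleton ℂ W w).coprod K.subtype
    have hψ : Injective ψ := by
      rw [← LinearMap.ker_eq_bot, LinearMap.ker_eq_bot']
      rintro ⟨c, x⟩ h
      have h1 : c • w + x.1 = 0 := h
      have h3 := congrArg ℓ h1
      rw [map_add, map_smul, hw, show ℓ x.1 = 0 from x.2, map_zero] at h3
      have hc : c = 0 := by simpa using h3
      subst hc
      refine Prod.ext rfl (Subtype.ext ?_)
      simpa using h1
    have hKd : finrank ℂ K + 1 = finrank ℂ W := by
      have := LinearMap.finrank_range_add_finrank_ker ℓ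
      rw [LinearMap.range_eq_top.2 (LinearMap.surjective hℓ), finrank_top, finrank_self] at this
      rw [hK]
      omega
    have hcomp : linMap φ hφ = (linMap ψ hψ).comp ((inrP ℂ K).comp (linMap φ' hφ')) := by
      rw [inrP, linMap_comp, linMap_comp]
      congr 1
      ext v
      simp [ψ, φ']
    have b1 := ih φ' hφ' (by omega) h2
    have b2 := bijective_H2_inrP (W := K) (by omega)
    have b3 : Bijective (pullback 2 (linMap ψ hψ) (mapsTo_empty _ _) :
        H 2 (ℙ ℂ W) ∅ →+ H 2 (ℙ ℂ (ℂ × K)) ∅) :=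
      bijective_homeomorph (linHomeo (LinearEquiv.ofInjectiveOfFinrankEq ψ hψ
        (by rw [finrank_prod, finrank_self, add_comm, hKd]))) 2
    convert (b1.comp b2).comp b3 using 1
    funext x
    rw [comp_apply, comp_apply, pullback_comp_apply, pullback_comp_apply]
    exact DFunLike.congr_fun (pullback_congr _ _ hcomp) x

end ProjJoin

end

/-! ### The Thom isomorphism in cohomology, and naturality of cup products -/

noncomputable section

open Function Set DiffGroup SingCoh Module

namespace SingCoh

variable {X X' Z U : Type*} [TopologicalSpace X] [TopologicalSpace X'] [TopologicalSpace Z]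
  [TopologicalSpace U] {p q s k : ℕ}

theorem totMap_single (f : C(X, X')) (φ : Cochain q X') :
    totMap f (single q φ) = single q (cochainMap q f φ) := by
  funext r
  by_cases hr : r = q
  · subst hr
    ext σ
    rw [totMap_apply, single_same, single_same]
    rfl
  · ext σ
    rw [totMap_apply, single_of_ne _ hr, single_of_ne _ hr]
    rfl

/-- The Thom isomorphism. -/
theorem IsThom.bijective {π : C(Z, U)} {Z₀ : Set Z} {τ : Cochain s Z} (h : IsThom π Z₀ τ)
    (hτ : τ ∈ relCocycles s Z₀) (j : ℕ) :
    Bijective (((cup j s Z₀).flip (H.mk s Z₀ ⟨τ, hτ⟩)).comp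
      (pullback j π (mapsTo_empty _ _) : H j U ∅ →+ H j Z ∅)) := by
  rw [IsThom, ← relF_singleton_empty] at h
  refine bijective_of_qIso h (fun φ => cupCochain (cochainMap j π φ) τ) (fun φ => ?_) (fun φ => ?_)
    _ fun φ => ⟨_, rfl, rfl⟩
  · rw [thomMap_apply, cupR_add]
    rfl
  · rw [thomMap_apply, totMap_single, cupR_single]

/-- Relative classes are cup products with a class of degree `s` up to coboundaries, and such
products vanish in lower degrees. -/
theorem IsThom.subsingleton {π : C(Z, U)} {Z₀ : Set Z} {τ : Cochain s Z} (h : IsThom π Z₀ τ)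
    (hq : q < s) : Subsingleton (H q Z Z₀) := by
  refine subsingleton_of_forall_eq 0 fun x => ?_
  obtain ⟨φ, rfl⟩ := H.mk_surjective _ x
  obtain ⟨z, -, -, w, hw, h1⟩ := h.surj (single_mem φ.2.1)
    (by rw [d_single, show coboundary q φ.1 = 0 from φ.2.2, map_zero])
  rw [H.mk_eq_zero_iff]
  have h2 := congrFun h1 q
  rw [single_same] at h2
  rw [← h2]
  refine sub_mem ?_ (d_mem_relCoboundaries hw q)
  rw [thomMap_apply, cupR_apply_of_lt _ _ hq]
  exact zero_mem _

/-- Thom cocycles are preserved by homeomorphisms. -/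
theorem IsThom.of_homeomorph_base {Z' U' : Type*} [TopologicalSpace Z'] [TopologicalSpace U']
    (h : Z ≃ₜ Z') (b : U ≃ₜ U') {π : C(Z, U)} {π' : C(Z', U')} (hπ : ∀ z, π' (h z) = b (π z))
    {Z₀ : Set Z} {Z₀' : Set Z'} (h0 : h ⁻¹' Z₀' = Z₀) {τ : Cochain s Z'}
    (hτ : coboundary s τ = 0) (hτ' : τ ∈ relCochains s Z₀') (ht : IsThom π' Z₀' τ) :
    IsThom π Z₀ (cochainMap s (h : C(Z, Z')) τ) := by
  have h1 := IsThom.of_homeomorph (π := (b : C(U, U')).comp π) h (fun z => hπ z) h0 ht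
  have h2 : QIso ⊤ ⊤ (totMap (b : C(U, U'))) := by
    have := qIso_of_homeomorph b (𝒴 := ∅) (𝒴' := ∅) (by simp) (by simp)
    rwa [relF_empty, relF_empty] at this
  have hc : coboundary s (cochainMap s (h : C(Z, Z')) τ) = 0 := by
    rw [coboundary_cochainMap, hτ, map_zero]
  refine h2.of_comp_right h1 (thomMap_d hc) fun φ _ => cupR_mem_right ?_ _
  rintro _ rfl
  exact cochainMap_mem_relCochains (f := (h : C(Z, Z'))) h0.ge hτ'

theorem IsThomOn.isThom {π : C(Z, U)} {Z₀ : Set Z} {τ : Cochain s Z}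
    (hτ : τ ∈ relCocycles s Z₀) (h : IsThomOn π Z₀ τ univ) : IsThom π Z₀ τ := by
  let e : Z ≃ₜ π ⁻¹' univ := (Homeomorph.Set.univ Z).symm
  exact IsThom.of_homeomorph_base (π' := overMap π univ) e
    (Homeomorph.Set.univ U).symm (fun _ => rfl) (Z₀ := Z₀) rfl
    (by rw [coboundary_cochainMap, show coboundary s τ = 0 from hτ.2, map_zero])
    (cochainMap_mem_relCochains (f := (⟨Subtype.val, continuous_subtype_val⟩ :
      C(π ⁻¹' univ, Z))) (fun _ h => h) hτ.1) h

/-! ## Naturality of the cup product -/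

theorem pullback_cup (f : C(X, X')) {Y : Set X} {Y' : Set X'} (h : MapsTo f Y Y')
    (x : H p X' ∅) (y : H q X' Y') : pullback (p + q) f h (cup p q Y' x y) =
      cup p q Y (pullback p f (mapsTo_empty _ _) x) (pullback q f h y) := by
  obtain ⟨φ, rfl⟩ := H.mk_surjective _ x
  obtain ⟨ψ, rfl⟩ := H.mk_surjective _ y
  rfl

theorem pullback_cupPow (f : C(X, X')) (u : H 2 X' ∅) : ∀ k,
    pullback (2 * k) f (mapsTo_empty _ _) (cupPow u k) =
      (cupPow (pullback 2 f (mapsTo_empty _ _) u) k : H (2 * k) X ∅)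
  | 0 => rfl
  | k + 1 => by
    have h := pullback_cup f (mapsTo_empty f ∅) (cupPow u k) u
    rw [pullback_cupPow f u k] at h
    exact h

theorem cupPow_one (u : H 2 X ∅) : (cupPow u 1 : H 2 X ∅) = u := by
  obtain ⟨φ, rfl⟩ := H.mk_surjective _ u
  refine H.mk_eq_mk_iff.2 ?_
  rw [show ∀ a b : Cochain 2 X, a = b → a - b = 0 from fun a b => sub_eq_zero.2]
  · exact zero_mem _
  ext σ
  refine (one_mul _).trans (congrArg φ.1 ?_)
  refine Eq.trans (congrArg (reindex σ) ?_) (reindex_id σ)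
  ext i
  simp [back]

/-! ## Generators of cyclic groups -/

theorem zmultiples_map_eq_top {G K : Type*} [AddGroup G] [AddGroup K] {f : G →+ K}
    (hf : Surjective f) {x : G} (hx : AddSubgroup.zmultiples x = ⊤) :
    AddSubgroup.zmultiples (f x) = ⊤ := by
  rw [← AddMonoidHom.map_zmultiples, hx, ← AddMonoidHom.range_eq_map,
    AddMonoidHom.range_eq_top.2 hf]

theorem zmultiples_eq_top_of_map {G K : Type*} [AddGroup G] [AddGroup K] {f : G →+ K}
    (hf : Injective f) {x : G} (hx : AddSubgroup.zmultiples (f x) = ⊤) :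
    AddSubgroup.zmultiples x = ⊤ := by
  refine eq_top_iff.2 fun y _ => ?_
  have h : f y ∈ AddSubgroup.zmultiples (f x) := by
    rw [hx]
    trivial
  obtain ⟨n, hn⟩ := AddSubgroup.mem_zmultiples_iff.1 h
  exact AddSubgroup.mem_zmultiples_iff.2 ⟨n, hf (by rw [map_zsmul, hn])⟩

theorem toAbs_injective_of_sub_pred {e : C(X, X')} (he : Topology.IsEmbedding e) (hq : q ≠ 0)
    (h : Subsingleton (H (q - 1) X ∅)) :
    Injective (pullback q (ContinuousMap.id X') (mapsTo_empty _ _) :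
      H q X' (range e) →+ H q X' ∅) := by
  obtain ⟨q, rfl⟩ := Nat.exists_eq_succ_of_ne_zero hq
  exact toAbs_injective_of_sub he h

end SingCoh

set_option linter.unusedSectionVars false

open scoped LinearAlgebra.Projectivization

/-! ### Powers of the generator and Thom classes of `ℙ(V × W) ∖ ℙ(W) → ℙ(V)` -/

namespace ProjJoin

variable {V W : Type} [NormedAddCommGroup V] [NormedSpace ℂ V] [NormedAddCommGroup W]
  [NormedSpace ℂ W] [FiniteDimensional ℂ V] [FiniteDimensional ℂ W] {d q k : ℕ}

variable (V W) in
/-- The inclusion of the complement of `ℙ(W)`. -/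
def bundleIncl : C(bundle V W, ℙ ℂ (V × W)) := ⟨Subtype.val, continuous_subtype_val⟩

theorem mapsTo_bundleIncl :
    MapsTo (bundleIncl V W) (Subtype.val ⁻¹' outer V W) (outer V W) := fun _ h => h

theorem cochainMap_bundleIncl_mem {τ : Cochain k (ℙ ℂ (V × W))}
    (hτ : τ ∈ relCocycles k (outer V W)) :
    cochainMap k (bundleIncl V W) τ ∈ relCocycles k (Subtype.val ⁻¹' outer V W) :=
  cochainMap_mem_relCocycles mapsTo_bundleIncl hτ

/-- The map `([v], w) ↦ [v : ℓ(v) w]`. -/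
def chartMap (hk : 2 * finrank ℂ W = k) (ℓ : V →ₗ[ℂ] ℂ) :
    C(↥(univ : Set (ℙ ℂ V)) × (Fin k → ℝ), ℙ ℂ (V × W)) :=
  projMap univ (fun v y => (v, ℓ v • (euclid hk).symm y))
    (fun _ hv _ _ h => hv (congrArg Prod.fst h)) (by
      have h := ℓ.continuous_of_finiteDimensional
      have h' := (euclid hk).symm.continuous
      simp only [uncurry_def]
      exact continuous_fst.prodMk ((h.comp continuous_fst).smul (h'.comp continuous_snd)))
    fun c v y => by simp [mul_smul]

theorem chartMap_mk (hk : 2 * finrank ℂ W = k) (ℓ : V →ₗ[ℂ] ℂ) (v : V) (hv : v ≠ 0)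
    (y : Fin k → ℝ) : chartMap hk ℓ (⟨Projectivization.mk ℂ v hv, trivial⟩, y) =
      Projectivization.mk ℂ (v, ℓ v • (euclid hk).symm y) fun h => hv (congrArg Prod.fst h) :=
  projMap_mk _ _ _

theorem chartMap_mem (hk : 2 * finrank ℂ W = k) (ℓ : V →ₗ[ℂ] ℂ) (x : ℙ ℂ V) (y : Fin k → ℝ) :
    chartMap hk ℓ (⟨x, trivial⟩, y) ∈ bundle V W := by
  induction x using Projectivization.ind with
  | h v hv =>
    rw [chartMap_mk, mk_mem_bundle]
    exact hv

/-- The inverse of the chart of the projection `[v : w] ↦ [v]` over `ℓ ≠ 0`. -/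
def chartInv (hk : 2 * finrank ℂ W = k) (ℓ : V →ₗ[ℂ] ℂ) (x : ℙ ℂ V × (Fin k → ℝ)) :
    bundle V W := ⟨chartMap hk ℓ (⟨x.1, trivial⟩, x.2), chartMap_mem hk ℓ x.1 x.2⟩

theorem chartInv_mk (hk : 2 * finrank ℂ W = k) (ℓ : V →ₗ[ℂ] ℂ) (v : V) (hv : v ≠ 0)
    (y : Fin k → ℝ) : (chartInv hk ℓ (Projectivization.mk ℂ v hv, y)).1 =
      Projectivization.mk ℂ (v, ℓ v • (euclid hk).symm y) fun h => hv (congrArg Prod.fst h) :=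
  chartMap_mk hk ℓ v hv y

theorem continuous_chartInv (hk : 2 * finrank ℂ W = k) (ℓ : V →ₗ[ℂ] ℂ) :
    Continuous (chartInv (V := V) hk ℓ) :=
  Continuous.subtype_mk ((chartMap hk ℓ).continuous.comp
    ((continuous_fst.subtype_mk _).prodMk continuous_snd)) _

theorem isTrivialization_chart (hk : 2 * finrank ℂ W = k) (ℓ : V →ₗ[ℂ] ℂ) :
    IsTrivialization (bundleProj V W) (Subtype.val ⁻¹' outer V W) (neSet ℓ)
      (fun x => euclid hk (chartCoord ℓ x.1)) (chartInv hk ℓ) := by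
  have hmem : ∀ z : bundle V W, bundleProj V W z ∈ neSet ℓ →
      z.1 ∈ neSet (ℓ.comp (LinearMap.fst ℂ V W)) := by
    rintro ⟨z, hz⟩ h
    induction z using Projectivization.ind with
    | h v hv =>
      rw [bundleProj_mk, mk_mem_neSet] at h
      exact (mk_mem_neSet (f := ℓ.comp (LinearMap.fst ℂ V W)) (hv := hv)).2 h
  refine ⟨?_, (continuous_chartInv hk ℓ).continuousOn, ?_, ?_, ?_, ?_⟩
  · exact (euclid hk).continuous.comp_continuousOn ((continuousOn_chartCoord ℓ).comp
      continuous_subtype_val.continuousOn hmem)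
  · intro x hx y
    induction x using Projectivization.ind with
    | h v hv =>
      have h : chartInv hk ℓ (Projectivization.mk ℂ v hv, y) = ⟨_, mk_mem_bundle.2 hv⟩ :=
        Subtype.ext (chartInv_mk hk ℓ v hv y)
      rw [h, bundleProj_mk]
  · intro x hx y
    induction x using Projectivization.ind with
    | h v hv =>
      rw [mk_mem_neSet] at hx
      rw [chartInv_mk, chartCoord_mk, smul_smul, inv_mul_cancel₀ hx, one_smul]
      exact (euclid hk).apply_symm_apply y
  · rintro ⟨z, hz⟩ h
    induction z using Projectivization.ind with
    | h v hv =>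
      rw [bundleProj_mk] at h ⊢
      rw [mk_mem_neSet] at h
      refine Subtype.ext ?_
      rw [chartInv_mk, chartCoord_mk]
      congr 1
      rw [ContinuousLinearEquiv.symm_apply_apply, smul_smul, mul_inv_cancel₀ h, one_smul]
  · rintro ⟨z, hz⟩ h
    induction z using Projectivization.ind with
    | h v hv =>
      rw [bundleProj_mk, mk_mem_neSet] at h
      rw [mem_preimage, mk_mem_outer, chartCoord_mk]
      simp [h]

/-- The Thom isomorphism for the projection `[v : w] ↦ [v]`. -/
theorem isThomOn_bundle (hk : 2 * finrank ℂ W = k) {τ : Cochain k (ℙ ℂ (V × W))}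
    (hτ : τ ∈ relCocycles k (outer V W))
    (hfib : ∀ v (hv : v ≠ 0), ∃ n : ℤ, genCochain k - n • cochainMap k (fibreCoord hk v hv) τ ∈
      relCoboundaries k ({0}ᶜ : Set (Fin k → ℝ))) (A : Set (ℙ ℂ V)) :
    IsThomOn (bundleProj V W) (Subtype.val ⁻¹' outer V W) (cochainMap k (bundleIncl V W) τ) A := by
  have hτ' := cochainMap_bundleIncl_mem hτ
  let b := finBasis ℂ V
  refine isThomOn_of_cover hτ' (fun i => neSet (b.coord i)) (fun i => isOpen_neSet _)
    (fun x => ?_) (fun i A hA => ?_) A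
  · induction x using Projectivization.ind with
    | h v hv =>
      by_contra! h
      refine hv (b.ext_elem fun i => ?_)
      have := h i
      rw [mk_mem_neSet, not_not] at this
      simpa using this
  · refine (isTrivialization_chart hk (b.coord i)).isThomOn hτ' (fun x hx => ?_) hA
    induction x using Projectivization.ind with
    | h v hv =>
      have hv' := mk_mem_neSet.1 hx
      -- In the chart of the coordinate `ℓ`, the fibre over `[v]` is parametrised by `w ↦ [v : ℓ(v)
      -- w] = [v / ℓ(v) : w]`, which is the fibre map for the representative with `ℓ = 1`.
      obtain ⟨n, hn⟩ := hfib ((b.coord i v)⁻¹ • v) (smul_ne_zero (inv_ne_zero hv') hv)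
      refine ⟨n, ?_⟩
      convert hn using 4
      change cochainMap k ((bundleIncl V W).comp
        ((isTrivialization_chart hk (b.coord i)).fibre hx)) τ = _
      congr 2
      ext y
      refine (chartInv_mk hk _ v hv y).trans ?_
      rw [fibreCoord_apply, Projectivization.mk_eq_mk_iff']
      refine ⟨b.coord i v, ?_⟩
      rw [Prod.smul_mk, smul_smul, mul_inv_cancel₀ hv', one_smul]

/-- The linear map `(s, w) ↦ (s v, w)`. -/
def fibreLin (W : Type) [NormedAddCommGroup W] [NormedSpace ℂ W] (v : V) : ℂ × W →ₗ[ℂ] V × W :=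
  (LinearMap.toSpanSingleton ℂ V v).prodMap LinearMap.id

theorem fibreLin_injective {v : V} (hv : v ≠ 0) : Injective (fibreLin W v) := by
  rintro ⟨a, w⟩ ⟨a', w'⟩ h
  have h1 : a • v = a' • v := congrArg Prod.fst h
  have h2 : w = w' := congrArg Prod.snd h
  rw [smul_left_injective ℂ hv h1, h2]

theorem mapsTo_linMap_fibreLin {v : V} (hv : v ≠ 0) :
    MapsTo (linMap (fibreLin W v) (fibreLin_injective hv)) (outer ℂ W) (outer V W) := by
  intro x hx
  induction x using Projectivization.ind with
  | h a ha =>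
    rw [mk_mem_outer] at hx
    rw [linMap_mk, mk_mem_outer]
    exact hx

variable (V W) in
/-- The homomorphism `H^q(ℙ(V × W), ℙ(V × W) \ ℙ(V)) → H^q(ℙ(V × W))`. -/
def outerToAbs (q : ℕ) : H q (ℙ ℂ (V × W)) (outer V W) →+ H q (ℙ ℂ (V × W)) ∅ :=
  pullback q (ContinuousMap.id _) (mapsTo_empty _ _)

theorem outerToAbs_eq (q : ℕ) (x : H q (ℙ ℂ (V × W)) (outer V W)) : outerToAbs V W q x =
    pullback q (ContinuousMap.id _) (mapsTo_empty _ (range (inrP V W)))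
      (pullback q (ContinuousMap.id (ℙ ℂ (V × W)))
        (mapsTo_range_inrP (V := V) (W := W)) x) := by
  rw [pullback_comp_apply]
  rfl

/-- The complement of `ℙ(V)` retracts onto `ℙ(W)`, and the bound places `q` above the real dimension
of `ℙ(W)`. Injectivity below needs the same one degree lower. -/
theorem outerToAbs_surjective (h : 2 * finrank ℂ W < q + 2) :
    Surjective (outerToAbs V W q) := by
  have h1 := toAbs_surjective_of_sub (isEmbedding_inrP (V := V) (W := W))
    (subsingleton_H_proj (q := q) rfl h)
  intro y
  obtain ⟨z, rfl⟩ := h1 y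
  obtain ⟨x, rfl⟩ := (bijective_outer q).2 z
  exact ⟨x, outerToAbs_eq q x⟩

theorem outerToAbs_injective (hq : q ≠ 0) (h : 2 * finrank ℂ W < q + 1) :
    Injective (outerToAbs V W q) := by
  have h1 := toAbs_injective_of_sub_pred (isEmbedding_inrP (V := V) (W := W)) hq
    (subsingleton_H_proj (q := q - 1) rfl (by omega))
  intro x y hxy
  rw [outerToAbs_eq, outerToAbs_eq] at hxy
  exact (bijective_outer q).1 (h1 hxy)

/-- The fibre over `[v]` is the open cell of the projective subspace `ℙ(ℂ v × W)`. In the top degree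
the absolute, the relative and the cell cohomology of this subspace agree, so a class which is an
absolute generator there restricts to a generator on the fibre. -/
theorem exists_fibre_multiple (hk : 2 * finrank ℂ W = k) (hk0 : k ≠ 0)
    {τ : Cochain k (ℙ ℂ (V × W))} (hτ : τ ∈ relCocycles k (outer V W)) (v : V) (hv : v ≠ 0)
    (hgen : AddSubgroup.zmultiples (pullback k (linMap (fibreLin W v) (fibreLin_injective hv))
      (mapsTo_empty _ _) (outerToAbs V W k (H.mk k _ ⟨τ, hτ⟩)) : H k (ℙ ℂ (ℂ × W)) ∅) = ⊤) :
    ∃ n : ℤ, genCochain k - n • cochainMap k (fibreCoord hk v hv) τ ∈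
      relCoboundaries k ({0}ᶜ : Set (Fin k → ℝ)) := by
  have h1 : AddSubgroup.zmultiples (pullback k (linMap (fibreLin W v) (fibreLin_injective hv))
      (mapsTo_linMap_fibreLin hv) (H.mk k _ ⟨τ, hτ⟩)) = ⊤ :=
    zmultiples_eq_top_of_map (outerToAbs_injective hk0 (by omega)) hgen
  have h2 := zmultiples_map_eq_top (bijective_cell hk k).2 h1
  have h3 : H.mk k ({0}ᶜ : Set (Fin k → ℝ)) ⟨genCochain k, genCochain_mem k⟩ ∈
      AddSubgroup.zmultiples (pullback k (fibreCoord hk (1 : ℂ) one_ne_zero)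
        (mapsTo_fibreCoord hk (1 : ℂ) one_ne_zero)
        (pullback k (linMap (fibreLin W v) (fibreLin_injective hv))
          (mapsTo_linMap_fibreLin hv) (H.mk k _ ⟨τ, hτ⟩))) := by
    rw [h2]
    trivial
  obtain ⟨n, hn⟩ := AddSubgroup.mem_zmultiples_iff.1 h3
  rw [eq_comm, pullback_mk, pullback_mk, ← map_zsmul, H.mk_eq_mk_iff] at hn
  refine ⟨n, ?_⟩
  convert hn using 3
  change _ = n • cochainMap k ((linMap (fibreLin W v) (fibreLin_injective hv)).comp
    (fibreCoord hk (1 : ℂ) one_ne_zero)) τ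
  congr 3
  ext y
  rw [ContinuousMap.comp_apply, fibreCoord_apply, fibreCoord_apply, linMap_mk]
  congr 1
  simp [fibreLin]

/-- The inclusion of the complement of `ℙ(W)` contracts to the projection to `ℙ(V)`. -/
theorem pullback_bundleIncl (q : ℕ) (x : H q (ℙ ℂ (V × W)) ∅) :
    pullback q (bundleIncl V W) (mapsTo_empty _ ∅) x =
      pullback q (bundleProj V W) (mapsTo_empty _ ∅)
        (pullback q (inlP V W) (mapsTo_empty _ ∅) x) := by
  rw [pullback_comp_apply]
  exact (DFunLike.congr_fun (pullback_eq_of_homotopy (f := (inlP V W).comp (bundleProj V W))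
    (g := bundleIncl V W) (F := bundleHomotopy V W) (fun x => bundleHomotopy_zero x)
    (fun x => bundleHomotopy_one x) (mapsTo_empty _ _) (mapsTo_empty _ _) (by simp)) x).symm

theorem bijective_bundleIncl (q : ℕ) : Bijective (pullback q (bundleIncl V W)
    (mapsTo_bundleIncl (V := V) (W := W))) := by
  refine bijective_pullback _ (qIso_excision Topology.IsEmbedding.subtypeVal fun x => ?_) q
  rw [isOpen_outer.interior_eq, show range (bundleIncl V W) = bundle V W from Subtype.range_val,
    isOpen_bundle.interior_eq]
  exact mem_bundle_or_outer x

/-- Here `ℙ(ℂ)` is a point, so `u` lifts to a relative class `s`, which is a Thom class of the line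
bundle over `ℙ(V)` because `u` generates on every projective line. The Thom isomorphism takes the
generator `u^n` of the top group of `ℙ(V)` to the product of `u^n` with `s`, whose absolute image is
`u^{n+1}`. -/
theorem zmultiples_cupPow_prod {n : ℕ} (hn : 1 ≤ n) (hV : finrank ℂ V = n + 1)
    (ih : ∀ u : H 2 (ℙ ℂ V) ∅, AddSubgroup.zmultiples u = ⊤ →
      AddSubgroup.zmultiples (cupPow u n) = ⊤) (u : H 2 (ℙ ℂ (V × ℂ)) ∅)
    (hu : AddSubgroup.zmultiples u = ⊤) : AddSubgroup.zmultiples (cupPow u (n + 1)) = ⊤ := by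
  have h1 : finrank ℂ ℂ = 1 := finrank_self ℂ
  obtain ⟨s, rfl⟩ := outerToAbs_surjective (V := V) (W := ℂ) (q := 2) (by omega) u
  obtain ⟨⟨τ, hτ⟩, rfl⟩ := H.mk_surjective _ s
  set s := H.mk 2 (outer V ℂ) ⟨τ, hτ⟩ with hs
  set u := outerToAbs V ℂ 2 s with hu'
  have hthom := (isThomOn_bundle (by rw [h1]) hτ (fun v hv =>
    exists_fibre_multiple (by rw [h1]) two_ne_zero hτ v hv
      (zmultiples_map_eq_top (bijective_H2_linMap (k := n) (fibreLin ℂ v) (fibreLin_injective hv)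
        (by rw [finrank_prod, finrank_prod]; omega) (by rw [finrank_prod]; omega)).2 hu))
    univ).isThom (cochainMap_bundleIncl_mem hτ)
  have hbij := hthom.bijective (cochainMap_bundleIncl_mem hτ) (2 * n)
  have huV : AddSubgroup.zmultiples (pullback 2 (inlP V ℂ) (mapsTo_empty _ ∅) u) = ⊤ :=
    zmultiples_map_eq_top (bijective_H2_linMap (k := 1) _ LinearMap.inl_injective
      (by rw [finrank_prod, h1]) (by omega)).2 hu
  have h2 := zmultiples_map_eq_top hbij.2 (ih _ huV)
  have h3 : AddSubgroup.zmultiples (cup (2 * n) 2 (outer V ℂ) (cupPow u n) s) = ⊤ := by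
    refine zmultiples_eq_top_of_map (bijective_bundleIncl (2 * n + 2)).1 ?_
    rw [pullback_cup, pullback_bundleIncl, pullback_cupPow (inlP V ℂ)]
    exact h2
  have h4 := zmultiples_map_eq_top (outerToAbs_surjective (q := 2 * n + 2) (by omega)) h3
  rw [outerToAbs, pullback_cup, pullback_id_apply] at h4
  exact h4

/-- The top power of a generator of `H²(ℂP^n)` is a generator of `H^{2n}(ℂP^n)`. -/
theorem zmultiples_cupPow {n : ℕ} (hn : 1 ≤ n) : ∀ {V : Type} [NormedAddCommGroup V]
    [NormedSpace ℂ V] [FiniteDimensional ℂ V], finrank ℂ V = n + 1 → ∀ u : H 2 (ℙ ℂ V) ∅,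
      AddSubgroup.zmultiples u = ⊤ → AddSubgroup.zmultiples (cupPow u n) = ⊤ := by
  induction n, hn using Nat.le_induction with
  | base =>
    intro V _ _ _ _ u hu
    have := cupPow_one u
    exact (congrArg AddSubgroup.zmultiples this).trans hu
  | succ n hn ih =>
    intro V _ _ _ hV u hu
    let e : V ≃ₗ[ℂ] (Fin (n + 1) → ℂ) × ℂ := LinearEquiv.ofFinrankEq _ _ (by
      rw [hV, finrank_prod, finrank_fin_fun, finrank_self])
    obtain ⟨u', rfl⟩ := (bijective_homeomorph (linHomeo e) 2).2 u
    have hu' := zmultiples_eq_top_of_map (bijective_homeomorph (linHomeo e) 2).1 hu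
    have h := zmultiples_cupPow_prod hn (finrank_fin_fun ℂ) (ih (finrank_fin_fun ℂ)) u' hu'
    have h2 := zmultiples_map_eq_top (bijective_homeomorph (linHomeo e) (2 * (n + 1))).2 h
    rwa [pullback_cupPow] at h2

/-- The Thom isomorphism defined by `u^d`. -/
theorem isThomOn_of_cupPow (hd : finrank ℂ W = d) (hd1 : 1 ≤ d) (hV : 1 ≤ finrank ℂ V)
    {u : H 2 (ℙ ℂ (V × W)) ∅} (hu : AddSubgroup.zmultiples u = ⊤)
    {τ : Cochain (2 * d) (ℙ ℂ (V × W))} (hτ : τ ∈ relCocycles (2 * d) (outer V W))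
    (h : outerToAbs V W (2 * d) (H.mk (2 * d) _ ⟨τ, hτ⟩) = cupPow u d) (A : Set (ℙ ℂ V)) :
    IsThomOn (bundleProj V W) (Subtype.val ⁻¹' outer V W) (cochainMap (2 * d) (bundleIncl V W) τ)
      A := by
  refine isThomOn_bundle (by rw [hd]) hτ (fun v hv => ?_) A
  refine exists_fibre_multiple (by rw [hd]) (by omega) hτ v hv ?_
  rw [h, pullback_cupPow]
  refine zmultiples_cupPow hd1 (by rw [finrank_prod, finrank_self, hd, add_comm]) _ ?_
  -- The fibre closes up to a copy of `ℂP^d`, of complex dimension at least one, to which `u`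
  -- restricts as a generator; its top power is `u^d`.
  exact zmultiples_map_eq_top (bijective_H2_linMap (k := finrank ℂ V - 1) (fibreLin W v)
    (fibreLin_injective hv) (by rw [finrank_prod, finrank_prod, finrank_self]; omega)
    (by rw [finrank_prod, finrank_self]; omega)).2 hu

end ProjJoin

end

noncomputable section

open Function Set DiffGroup SingCoh Module

set_option linter.unusedSectionVars false

open scoped LinearAlgebra.Projectivization

namespace ProjJoin

variable {m n : ℕ}

/-! ## Membership in the join -/

/-- Replaces the three-part description of the join by the single condition `a = 0` or `[a] ∈ A`. -/
theorem mk_mem_joinCP_iff {A : Set (CP m)} {v : (Fin (m + 1) → ℂ) × (Fin (n + 1) → ℂ)}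
    {hv : v ≠ 0} : Projectivization.mk ℂ v hv ∈ joinCP A n ↔
      ∀ h : v.1 ≠ 0, Projectivization.mk ℂ v.1 h ∈ A := by
  constructor
  · intro hx h
    have hv' : Projectivization.mk ℂ v hv ∈ (CPn m n)ᶜ := fun h' =>
      h ((mk_mem_CPn_iff v hv).1 h')
    rw [← fstProj_mk v hv hv' h]
    exact fstProj_mem _ ⟨hx, hv'⟩
  · intro h
    by_cases h1 : v.1 = 0
    · exact CPn_subset_joinCP A ((mk_mem_CPn_iff v hv).2 h1)
    · by_cases h2 : v.2 = 0
      · refine Or.inl (Or.inl ⟨_, h h1, ?_⟩)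
        rw [inlCP, Projectivization.map_mk, Projectivization.mk_eq_mk_iff']
        exact ⟨1, by ext <;> simp [h2]⟩
      · exact Or.inr ⟨v.1, v.2, h1, h2, h h1, trivial, rfl⟩

theorem compl_CPn : (CPn m n)ᶜ = bundle (Fin (m + 1) → ℂ) (Fin (n + 1) → ℂ) := by
  ext x
  induction x using Projectivization.ind with
  | h v hv => rw [mem_compl_iff, mk_mem_CPn_iff, mk_mem_bundle]

theorem CPn_subset_outer : CPn m n ⊆ outer (Fin (m + 1) → ℂ) (Fin (n + 1) → ℂ) := by
  rintro _ ⟨x, rfl⟩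
  exact inrP_mem_outer _ _ x

theorem fstProj_eq_bundleProj (x : CPSum m n) (hx : x ∈ (CPn m n)ᶜ)
    (hx' : x ∈ bundle (Fin (m + 1) → ℂ) (Fin (n + 1) → ℂ)) :
    fstProj ⟨x, hx⟩ = bundleProj _ _ ⟨x, hx'⟩ := by
  induction x using Projectivization.ind with
  | h v hv => rw [bundleProj_mk, fstProj_mk v hv hx (mk_mem_bundle.1 hx')]

theorem outerHomotopy_mem_joinCP {A : Set (CP m)} (x : outer (Fin (m + 1) → ℂ) (Fin (n + 1) → ℂ))
    (hx : x.1 ∈ joinCP A n) (t : unitInterval) : outerHomotopy _ _ (x, t) ∈ joinCP A n := by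
  obtain ⟨x, hx'⟩ := x
  induction x using Projectivization.ind with
  | h v hv =>
    rw [outerHomotopy_mk, mk_mem_joinCP_iff]
    intro h
    obtain ⟨h1, h2⟩ := smul_ne_zero_iff.1 h
    convert mk_mem_joinCP_iff.1 hx h2 using 1
    rw [Projectivization.mk_eq_mk_iff']
    exact ⟨_, rfl⟩

theorem outerHomotopy_outerHomotopy {V W : Type} [NormedAddCommGroup V] [NormedSpace ℂ V]
    [NormedAddCommGroup W] [NormedSpace ℂ W] [FiniteDimensional ℂ V] [FiniteDimensional ℂ W]
    (x : outer V W) (s t : unitInterval) :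
    outerHomotopy V W (⟨outerHomotopy V W (x, s), outerHomotopy_mem x s⟩, t) =
      outerHomotopy V W (x, s * t) := by
  obtain ⟨x, hx⟩ := x
  induction x using Projectivization.ind with
  | h v hv =>
    have h : (⟨outerHomotopy V W (⟨Projectivization.mk ℂ v hv, hx⟩, s),
        outerHomotopy_mem _ s⟩ : outer V W) =
        ⟨Projectivization.mk ℂ (((s : ℝ) : ℂ) • v.1, v.2)
          fun h' => mk_mem_outer.1 hx (congrArg Prod.snd h'),
          mk_mem_outer.2 ((mk_mem_outer (hv := hv)).1 hx)⟩ :=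
      Subtype.ext (outerHomotopy_mk hv hx s)
    rw [h, outerHomotopy_mk, outerHomotopy_mk]
    congr 1
    rw [smul_smul, mul_comm]
    push_cast
    rfl

theorem outerHomotopy_of_mem_CPn {x : CPSum m n} (hx : x ∈ CPn m n) (t : unitInterval) :
    outerHomotopy _ _ (⟨x, CPn_subset_outer hx⟩, t) = x := by
  obtain ⟨y, rfl⟩ := hx
  induction y using Projectivization.ind with
  | h w hw =>
    refine (outerHomotopy_mk (v := ((0 : Fin (m + 1) → ℂ), w)) _ _ t).trans ?_
    simp only [smul_zero]
    rfl

/-! ## Tubular neighbourhoods -/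

/-- The points of the join which are contracted to `ℂP^n` inside `U`. -/
def tube (A : Set (CP m)) (U : Set (CPSum m n)) : Set (CPSum m n) :=
  {x | ∃ hx : x ∈ outer _ _, x ∈ joinCP A n ∧ ∀ t, outerHomotopy _ _ (⟨x, hx⟩, t) ∈ U}

theorem tube_subset {A : Set (CP m)} {U : Set (CPSum m n)} : tube A U ⊆ U ∩ joinCP A n := by
  rintro x ⟨hx, hx', h⟩
  refine ⟨?_, hx'⟩
  have := h 1
  rwa [outerHomotopy_one] at this

theorem tube_univ (A : Set (CP m)) : tube A (univ : Set (CPSum m n)) = joinCP A n ∩ outer _ _ := by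
  ext x
  constructor
  · rintro ⟨hx, hx', -⟩
    exact ⟨hx', hx⟩
  · rintro ⟨hx, hx'⟩
    exact ⟨hx', hx, fun _ => trivial⟩

/-- Requiring the whole contraction path to stay in `U` makes the tube invariant under the
contraction `[ta : b]`, because contractions compose by multiplying their parameters. -/
theorem isTubularNbhd_tube (A : Set (CP m)) {U : Set (CPSum m n)} (hU : IsOpen U)
    (hU' : CPn m n ⊆ U) : IsTubularNbhd A n (tube A U) where
  subset_join := fun x hx => hx.2.1
  CPn_subset := fun x hx => ⟨CPn_subset_outer hx, CPn_subset_joinCP A hx, fun t => by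
    rw [outerHomotopy_of_mem_CPn hx]
    exact hU' hx⟩
  nhds := by
    refine ⟨Subtype.val '' {x : outer (Fin (m + 1) → ℂ) (Fin (n + 1) → ℂ) |
      ∀ t, outerHomotopy _ _ (x, t) ∈ U}, ?_, ?_, ?_⟩
    · refine isOpen_outer.isOpenMap_subtype_val _ ?_
      -- The bad points form the image of a closed set under projection along the compact interval,
      -- hence a closed set.
      have h : {x : outer (Fin (m + 1) → ℂ) (Fin (n + 1) → ℂ) |
          ∀ t, outerHomotopy _ _ (x, t) ∈ U} =
          (Prod.fst '' ((outerHomotopy (Fin (m + 1) → ℂ) (Fin (n + 1) → ℂ)) ⁻¹' Uᶜ))ᶜ := by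
        ext x
        simp
      rw [h, isOpen_compl_iff]
      exact isClosedMap_fst_of_compactSpace _ (hU.isClosed_compl.preimage
        (ContinuousMap.continuous _))
    · intro x hx
      refine ⟨⟨x, CPn_subset_outer hx⟩, fun t => ?_, rfl⟩
      rw [outerHomotopy_of_mem_CPn hx]
      exact hU' hx
    · rintro _ ⟨⟨x, hx, rfl⟩, hx'⟩
      exact ⟨x.2, hx', hx⟩
  retract := by
    let j : C(tube A U, outer (Fin (m + 1) → ℂ) (Fin (n + 1) → ℂ)) :=
      ⟨fun x => ⟨x.1, x.2.1⟩, continuous_subtype_val.subtype_mk _⟩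
    let h := outerHomotopy (Fin (m + 1) → ℂ) (Fin (n + 1) → ℂ)
    have h0 : ∀ x, h (x, 0) ∈ CPn m n := fun x => by
      rw [outerHomotopy_zero]
      exact ⟨outerProj _ _ x, rfl⟩
    have hmem : ∀ (x : tube A U) t, h (j x, t) ∈ tube A U := fun x t =>
      ⟨outerHomotopy_mem _ t, outerHomotopy_mem_joinCP _ x.2.2.1 t, fun s => by
        rw [outerHomotopy_outerHomotopy]
        exact x.2.2.2 _⟩
    refine ⟨⟨fun x => ⟨h (j x, 0), h0 _⟩, by fun_prop⟩, ?_, ⟨⟨⟨fun x => ⟨h (j x.2, x.1), hmem _ _⟩,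
      by fun_prop⟩, fun x => ?_, fun x => ?_⟩⟩⟩
    · ext x
      exact outerHomotopy_of_mem_CPn x.2 0
    · rfl
    · exact Subtype.ext (outerHomotopy_one _)

theorem tube_mono (A : Set (CP m)) (U : Set (CPSum m n)) : tube A U ⊆ tube A univ := by
  rintro x ⟨hx, hx', -⟩
  exact ⟨hx, hx', fun _ => trivial⟩

/-! ## The identifications of the cohomology groups -/

theorem range_continuousMap_inclusion {X : Type*} [TopologicalSpace X] {S T : Set X} (h : S ⊆ T) :
    range (ContinuousMap.inclusion h) = Subtype.val ⁻¹' S := by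
  ext x
  constructor
  · rintro ⟨y, rfl⟩
    exact y.2
  · intro hx
    exact ⟨⟨x.1, hx⟩, rfl⟩

section

variable {A : Set (CP m)} {T : Set (CPSum m n)}

theorem IsTubularNbhd.qIso_inclusion (hT : IsTubularNbhd A n T) :
    QIso ⊤ ⊤ (totMap (ContinuousMap.inclusion hT.CPn_subset)) := by
  obtain ⟨r, hr, ⟨F⟩⟩ := hT.retract
  have h := qIso_of_homotopyEquiv (f := ContinuousMap.inclusion hT.CPn_subset) (g := r)
    (F := ContinuousMap.fst)
    (G := F.toContinuousMap.comp (ContinuousMap.snd.prodMk ContinuousMap.fst))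
    (𝒴 := ∅) (𝒴' := ∅) (fun x => (DFunLike.congr_fun hr x).symm) (fun _ => rfl)
    (fun x => F.map_zero_left x) (fun x => F.map_one_left x)
    (by simp) (by simp) (by simp) (by simp)
  rwa [relF_empty, relF_empty] at h

theorem bijective_resTube (hT : IsTubularNbhd A n T) (q : ℕ) : Bijective (resTube hT q) := by
  have h := qIso_of_subset (e := ContinuousMap.inclusion hT.subset_join)
    (i := ContinuousMap.inclusion hT.CPn_subset) (Topology.IsEmbedding.inclusion hT.subset_join)
    (Topology.IsEmbedding.inclusion hT.CPn_subset) hT.qIso_inclusion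
  rw [range_continuousMap_inclusion, show (ContinuousMap.inclusion hT.subset_join).comp
    (ContinuousMap.inclusion hT.CPn_subset) = ContinuousMap.inclusion (CPn_subset_joinCP A) from
      rfl, range_continuousMap_inclusion] at h
  exact bijective_pullback (f := ContinuousMap.inclusion subset_rfl)
    (Y := Subtype.val ⁻¹' CPn m n) (Y' := Subtype.val ⁻¹' T) (fun _ hx => hT.CPn_subset hx) h q

/-- `T` need not be open: points of `ℂP^n` are interior to `T` by the neighbourhood condition, and
all others lie in the open subset `E_A` of the join. -/
theorem bijective_resExc (hT : IsTubularNbhd A n T) (q : ℕ) : Bijective (resExc hT q) := by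
  have hs : joinBundle A n ⊆ joinCP A n := sdiff_subset
  have h := qIso_excision (e := ContinuousMap.inclusion hs) (T := Subtype.val ⁻¹' T)
    (Topology.IsEmbedding.inclusion hs) fun x => by
      by_cases hx : x.1 ∈ CPn m n
      · obtain ⟨U, hU, hU', hUT⟩ := hT.nhds
        refine Or.inl (mem_interior.2 ⟨Subtype.val ⁻¹' U, fun y hy => hUT ⟨hy, y.2⟩,
          hU.preimage continuous_subtype_val, hU' hx⟩)
      · refine Or.inr (mem_interior.2 ⟨Subtype.val ⁻¹' bundle _ _, fun y hy => ?_,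
          isOpen_bundle.preimage continuous_subtype_val, ?_⟩)
        · rw [← compl_CPn] at hy
          exact ⟨⟨y.1, y.2, hy⟩, rfl⟩
        · rw [← compl_CPn]
          exact hx
  have he : ContinuousMap.inclusion hs ⁻¹' (Subtype.val ⁻¹' T) =
      (Subtype.val ⁻¹' (T \ CPn m n) : Set (joinBundle A n)) := by
    ext x
    exact ⟨fun hx => ⟨hx, x.2.2⟩, fun hx => hx.1⟩
  rw [he] at h
  exact bijective_pullback (fun _ hx => hx.1) h q

end

theorem subsingleton_H_CPn {q : ℕ} (h : 2 * n < q) : Subsingleton (HAbs q (CPn m n)) := by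
  have h1 : Subsingleton (H q (CP n) ∅) :=
    subsingleton_H_proj (finrank_fin_fun ℂ) (by omega)
  exact (bijective_homeomorph (isEmbedding_inrP (V := Fin (m + 1) → ℂ)
    (W := Fin (n + 1) → ℂ)).toHomeomorph q).1.subsingleton

/-- In this range both `H^{q-1}(ℂP^n)` and `H^q(ℂP^n)` vanish. -/
theorem bijective_toAbs {S : Set (CPSum m n)} (hS : CPn m n ⊆ S) {q : ℕ} (h : 2 * n + 1 < q) :
    Bijective (toAbs q S (CPn m n)) := by
  have h1 := toAbs_injective_of_sub_pred (Topology.IsEmbedding.inclusion hS)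
    (e := ContinuousMap.inclusion hS) (q := q) (by omega) (subsingleton_H_CPn (by omega))
  have h2 := toAbs_surjective_of_sub (Topology.IsEmbedding.inclusion hS)
    (e := ContinuousMap.inclusion hS) (q := q) (subsingleton_H_CPn (by omega))
  rw [range_continuousMap_inclusion] at h1 h2
  exact ⟨h1, h2⟩

/-! ## Generators of the second cohomology group -/

/-- The generator comes from the cell of a projective line. Part 1 mentions no class `u`, but its
proof needs some Thom class. -/
theorem exists_generator (m n : ℕ) :
    ∃ u : H 2 (CPSum m n) ∅, AddSubgroup.zmultiples u = ⊤ := by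
  have h1 : finrank ℂ ℂ = 1 := finrank_self ℂ
  obtain ⟨x, hx⟩ := (bijective_cell (W := ℂ) (d := 2) (by rw [h1]) 2).2
    (H.mk 2 _ ⟨genCochain 2, genCochain_mem 2⟩)
  have h2 : AddSubgroup.zmultiples x = ⊤ := zmultiples_eq_top_of_map
    (bijective_cell (W := ℂ) (d := 2) (by rw [h1]) 2).1 (by rw [hx]; exact zmultiples_genCochain)
  have h3 := zmultiples_map_eq_top (outerToAbs_surjective (V := ℂ) (W := ℂ) (q := 2) (by omega)) h2
  let φ : ℂ × ℂ →ₗ[ℂ] (Fin (m + 1) → ℂ) × (Fin (n + 1) → ℂ) :=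
    (LinearMap.toSpanSingleton ℂ (Fin (m + 1) → ℂ) 1).prodMap
      (LinearMap.toSpanSingleton ℂ (Fin (n + 1) → ℂ) 1)
  have hφ : Injective φ := by
    rintro ⟨a, b⟩ ⟨a', b'⟩ h
    have e1 : a • (1 : Fin (m + 1) → ℂ) = a' • 1 := congrArg Prod.fst h
    have e2 : b • (1 : Fin (n + 1) → ℂ) = b' • 1 := congrArg Prod.snd h
    rw [smul_left_injective ℂ one_ne_zero e1, smul_left_injective ℂ one_ne_zero e2]
  obtain ⟨u, hu⟩ := (bijective_H2_linMap (k := m + n) φ hφ (by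
    simp only [finrank_prod, finrank_fin_fun, h1]
    omega) (by rw [finrank_prod]; omega)).2 (outerToAbs ℂ ℂ 2 x)
  refine ⟨u, zmultiples_eq_top_of_map (bijective_H2_linMap (k := m + n) φ hφ (by
    simp only [finrank_prod, finrank_fin_fun, h1]
    omega) (by rw [finrank_prod]; omega)).1 ?_⟩
  rw [hu]
  exact h3

/-! ## The Thom isomorphism over subsets of `ℂP^m` -/

/-- The inclusion of the bundle over `A`. -/
def joinBundleIncl (A : Set (CP m)) (n : ℕ) : C(joinBundle A n, CPSum m n) :=
  ⟨Subtype.val, continuous_subtype_val⟩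

theorem mapsTo_joinBundleIncl (A : Set (CP m)) :
    MapsTo (joinBundleIncl A n) (Subtype.val ⁻¹' (tube A univ \ CPn m n)) (outer _ _) :=
  fun _ hx => hx.1.1

theorem mem_bundle_of_mem_joinBundle {A : Set (CP m)} {x : CPSum m n} (hx : x ∈ joinBundle A n) :
    x ∈ bundle (Fin (m + 1) → ℂ) (Fin (n + 1) → ℂ) := by
  rw [← compl_CPn]
  exact hx.2

theorem bundleProj_mem_of_mem_joinBundle {A : Set (CP m)} {x : CPSum m n}
    (hx : x ∈ joinBundle A n) :
    bundleProj (Fin (m + 1) → ℂ) (Fin (n + 1) → ℂ) ⟨x, mem_bundle_of_mem_joinBundle hx⟩ ∈ A := by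
  rw [← fstProj_eq_bundleProj x hx.2]
  exact fstProj_mem x hx

theorem mem_joinBundle_of_bundleProj_mem {A : Set (CP m)} {x : CPSum m n}
    (hx : x ∈ bundle (Fin (m + 1) → ℂ) (Fin (n + 1) → ℂ)) (hA : bundleProj _ _ ⟨x, hx⟩ ∈ A) :
    x ∈ joinBundle A n := by
  refine ⟨?_, by rwa [← compl_CPn] at hx⟩
  induction x using Projectivization.ind with
  | h v hv =>
    rw [bundleProj_mk] at hA
    exact mk_mem_joinCP_iff.2 fun _ => hA

/-- The two descriptions of the bundle over `A`. -/
def joinBundleHomeo (A : Set (CP m)) (n : ℕ) :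
    joinBundle A n ≃ₜ bundleProj (Fin (m + 1) → ℂ) (Fin (n + 1) → ℂ) ⁻¹' A where
  toFun x := ⟨⟨x.1, mem_bundle_of_mem_joinBundle x.2⟩, bundleProj_mem_of_mem_joinBundle x.2⟩
  invFun x := ⟨x.1.1, mem_joinBundle_of_bundleProj_mem x.1.2 x.2⟩
  left_inv _ := rfl
  right_inv _ := rfl
  continuous_toFun := (continuous_subtype_val.subtype_mk _).subtype_mk _
  continuous_invFun := (continuous_subtype_val.comp continuous_subtype_val).subtype_mk _

/-- For the largest tube, consisting of the points of the join with `b ≠ 0`, the punctured tube is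
the complement of the zero section of `E_A`, so the bundle statement applies as it stands. -/
theorem isThom_projA {u : H 2 (CPSum m n) ∅} (hu : AddSubgroup.zmultiples u = ⊤)
    {τ : Cochain (2 * (n + 1)) (CPSum m n)}
    (hτ : τ ∈ relCocycles (2 * (n + 1)) (outer (Fin (m + 1) → ℂ) (Fin (n + 1) → ℂ)))
    (h : outerToAbs _ _ (2 * (n + 1)) (H.mk (2 * (n + 1)) _ ⟨τ, hτ⟩) = cupPow u (n + 1))
    (A : Set (CP m)) : IsThom (projA A n) (Subtype.val ⁻¹' (tube A univ \ CPn m n))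
      (cochainMap (2 * (n + 1)) (joinBundleIncl A n) τ) := by
  have h1 := isThomOn_of_cupPow (finrank_fin_fun ℂ) (by omega) (by rw [finrank_fin_fun]; omega)
    hu hτ h A
  refine IsThom.of_homeomorph (joinBundleHomeo A n) (π := projA A n) (fun x => ?_) ?_ h1
  · exact Subtype.ext (fstProj_eq_bundleProj x.1 x.2.2 _).symm
  · ext x
    rw [tube_univ]
    exact ⟨fun hx => ⟨⟨x.2.1, hx⟩, x.2.2⟩, fun hx => hx.1.2⟩

theorem exists_lift_cupPow (u : H 2 (CPSum m n) ∅) :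
    ∃ (τ : Cochain (2 * (n + 1)) (CPSum m n))
      (hτ : τ ∈ relCocycles (2 * (n + 1)) (outer (Fin (m + 1) → ℂ) (Fin (n + 1) → ℂ))),
      outerToAbs _ _ (2 * (n + 1)) (H.mk (2 * (n + 1)) _ ⟨τ, hτ⟩) = cupPow u (n + 1) := by
  obtain ⟨s, hs⟩ := outerToAbs_surjective (V := Fin (m + 1) → ℂ) (W := Fin (n + 1) → ℂ)
    (q := 2 * (n + 1)) (by rw [finrank_fin_fun]; omega) (cupPow u (n + 1))
  obtain ⟨⟨τ, hτ⟩, rfl⟩ := H.mk_surjective _ s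
  exact ⟨τ, hτ, hs⟩

theorem subsingleton_H_join (A : Set (CP m)) {q : ℕ} (hq : q < 2 * (n + 1)) :
    Subsingleton (HPair q (joinCP A n) (CPn m n)) := by
  obtain ⟨u, hu⟩ := exists_generator m n
  obtain ⟨τ, hτ, h⟩ := exists_lift_cupPow u
  have h1 := (isThom_projA hu hτ h A).subsingleton hq
  have hT := isTubularNbhd_tube (n := n) A isOpen_univ (subset_univ _)
  have h2 : Subsingleton (HPair q (joinCP A n) (tube A univ)) :=
    (bijective_resExc hT q).1.subsingleton
  exact (bijective_resTube hT q).2.subsingleton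

theorem bijective_resAbs (A : Set (CP m)) {k : ℕ} (hk : k ≤ 2 * n + 1) :
    Bijective (resAbs k (CPn_subset_joinCP (n := n) A)) := by
  have he := Topology.IsEmbedding.inclusion (CPn_subset_joinCP (n := n) A)
  have h : ∀ q < 2 * (n + 1), Subsingleton
      (H q (joinCP A n) (range (ContinuousMap.inclusion (CPn_subset_joinCP (n := n) A)))) := by
    intro q hq
    rw [range_continuousMap_inclusion]
    exact subsingleton_H_join A hq
  refine ⟨pullback_injective_of_rel he (h k (by omega)), ?_⟩
  -- In degree `2n+1` the next relative group, in degree `2n+2`, need not vanish; surjectivity holds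
  -- because `H^{2n+1}(ℂP^n) = 0`.
  by_cases hk' : k = 2 * n + 1
  · have := subsingleton_H_CPn (m := m) (n := n) (q := k) (by omega)
    exact fun y => ⟨0, Subsingleton.elim _ _⟩
  · exact pullback_surjective_of_rel he (h (k + 1) (by omega))

theorem res_res {X : Type*} [TopologicalSpace X] {q : ℕ} {S S' S'' Y Y' Y'' : Set X}
    (hS : S ⊆ S') (hY : Y ⊆ Y') (hS' : S' ⊆ S'') (hY' : Y' ⊆ Y'') (x : HPair q S'' Y'') :
    res q hS hY (res q hS' hY' x) = res q (hS.trans hS') (hY.trans hY') x := by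
  obtain ⟨φ, rfl⟩ := H.mk_surjective _ x
  rfl

/-- The restriction of relative classes of the ambient space. -/
def restrict {X : Type*} [TopologicalSpace X] (q : ℕ) (S : Set X) {Y Y' : Set X} (h : Y ⊆ Y') :
    H q X Y' →+ HPair q S Y :=
  pullback q (⟨Subtype.val, continuous_subtype_val⟩ : C(S, X)) fun _ hx => h hx

theorem res_restrict {X : Type*} [TopologicalSpace X] {q : ℕ} {S S' Y Y' Y'' : Set X}
    (hS : S ⊆ S') (hY : Y ⊆ Y') (hY' : Y' ⊆ Y'') (x : H q X Y'') :
    res q hS hY (restrict q S' hY' x) = restrict q S (hY.trans hY') x := by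
  obtain ⟨φ, rfl⟩ := H.mk_surjective _ x
  rfl

/-! ## The Thom homomorphism for tubular neighbourhoods -/

theorem invHom_apply {G K : Type*} [AddCommGroup G] [AddCommGroup K] {f : G →+ K}
    (hf : Bijective f) (x : G) : invHom f (f x) = x := by
  rw [invHom, dif_pos hf]
  exact (AddEquiv.ofBijective f hf).symm_apply_apply x

theorem apply_invHom {G K : Type*} [AddCommGroup G] [AddCommGroup K] {f : G →+ K}
    (hf : Bijective f) (y : K) : f (invHom f y) = y := by
  rw [invHom, dif_pos hf]
  exact (AddEquiv.ofBijective f hf).apply_symm_apply y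

theorem bijective_invHom {G K : Type*} [AddCommGroup G] [AddCommGroup K] {f : G →+ K}
    (hf : Bijective f) : Bijective (invHom f) := by
  rw [invHom, dif_pos hf]
  exact (AddEquiv.ofBijective f hf).symm.bijective

section

variable {A : Set (CP m)} {T T' : Set (CPSum m n)}

/-- The homomorphism `v ↦ p_A^* v ⌣ c`, with values in the cohomology of the bundle relative to
the punctured tubular neighbourhood. -/
def tubeThom (hT : IsTubularNbhd A n T) {s : ℕ} (c : HPair s (joinCP A n) (CPn m n)) (j : ℕ) :
    HAbs j A →+ HPair (j + s) (joinBundle A n) (T \ CPn m n) :=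
  ((cup j s _).flip (resExc hT s (invHom (resTube hT s) c))).comp
    (pullback j (projA A n) (mapsTo_empty _ _))

/-- Restriction from `T` to `T'` is an isomorphism on all groups involved and carries the one copy
of the class `c` to the other, so by naturality of the cup product it intertwines the two
homomorphisms. -/
theorem bijective_tubeThom_iff (hT : IsTubularNbhd A n T) (hT' : IsTubularNbhd A n T')
    (h : T' ⊆ T) {s : ℕ} (c : HPair s (joinCP A n) (CPn m n)) (j : ℕ) :
    Bijective (tubeThom hT c j) ↔ Bijective (tubeThom hT' c j) := by
  let σ : ∀ q, HPair q (joinCP A n) T →+ HPair q (joinCP A n) T' := fun q => res q subset_rfl h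
  let ρ : ∀ q, HPair q (joinBundle A n) (T \ CPn m n) →+
      HPair q (joinBundle A n) (T' \ CPn m n) :=
    fun q => res q subset_rfl (sdiff_subset_sdiff_left h)
  have h1 : ∀ q x, resTube hT' q (σ q x) = resTube hT q x := fun q x =>
    res_res _ _ _ _ x
  have h2 : ∀ q x, resExc hT' q (σ q x) = ρ q (resExc hT q x) := fun q x =>
    (res_res _ _ _ _ x).trans (res_res _ _ _ _ x).symm
  have hσ : ∀ q, Bijective (σ q) := fun q => by
    refine (Bijective.of_comp_iff' (bijective_resTube hT' q) _).1 ?_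
    convert bijective_resTube hT q using 1
    exact funext (h1 q)
  have hρ : ∀ q, Bijective (ρ q) := fun q => by
    refine (Bijective.of_comp_iff _ (bijective_resExc hT q)).1 ?_
    convert (bijective_resExc hT' q).comp (hσ q) using 1
    exact funext fun x => (h2 q x).symm
  have h3 : ρ s (resExc hT s (invHom (resTube hT s) c)) =
      resExc hT' s (invHom (resTube hT' s) c) := by
    rw [← h2]
    congr 1
    refine (bijective_resTube hT' s).1 ?_
    rw [h1, apply_invHom (bijective_resTube hT s), apply_invHom (bijective_resTube hT' s)]
  have h4 : ∀ v, ρ (j + s) (tubeThom hT c j v) = tubeThom hT' c j v := by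
    intro v
    refine (pullback_cup _ _ _ _).trans ?_
    change cup j s _ _ (ρ s _) = _
    rw [h3]
    exact congrArg (fun x => cup j s _ x _) (pullback_id_apply _ _)
  rw [← Bijective.of_comp_iff' (hρ (j + s))]
  exact iff_of_eq (congrArg Bijective (funext h4))

end

/-- Gives `t_A` an explicit cocycle, defined on the ambient space and vanishing off the zero
section, so that it can be compared with the Thom cocycle of the bundle. -/
theorem classT_eq {u : HAbs 2 (univ : Set (CPSum m n))}
    {τ : Cochain (2 * (n + 1)) (CPSum m n)}
    (hτ : τ ∈ relCocycles (2 * (n + 1)) (outer (Fin (m + 1) → ℂ) (Fin (n + 1) → ℂ)))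
    (h : outerToAbs _ _ (2 * (n + 1)) (H.mk (2 * (n + 1)) _ ⟨τ, hτ⟩) =
      cupPow (pullback 2 ((Homeomorph.Set.univ (CPSum m n)).symm :
        C(CPSum m n, (univ : Set (CPSum m n)))) (mapsTo_empty _ _) u) (n + 1))
    (A : Set (CP m)) : classT A n u =
      restrict (2 * (n + 1)) (joinCP A n) CPn_subset_outer (H.mk (2 * (n + 1)) _ ⟨τ, hτ⟩) := by
  have hb : Bijective (toAbs (2 * (n + 1)) univ (CPn m n)) :=
    bijective_toAbs (subset_univ _) (by omega)
  let e : C((univ : Set (CPSum m n)), CPSum m n) := ⟨Subtype.val, continuous_subtype_val⟩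
  let t : HPair (2 * (n + 1)) (univ : Set (CPSum m n)) (CPn m n) :=
    restrict (2 * (n + 1)) univ CPn_subset_outer (H.mk (2 * (n + 1)) _ ⟨τ, hτ⟩)
  have h1 : toAbs (2 * (n + 1)) univ (CPn m n) t = cupPow u (n + 1) := by
    have h2 := congrArg (pullback (2 * (n + 1)) e (mapsTo_empty e ∅)) h
    rw [pullback_cupPow, pullback_comp_apply] at h2
    refine Eq.trans ?_ (h2.trans (congrArg (fun u => cupPow u (n + 1)) ?_))
    · rfl
    · exact pullback_id_apply _ u
  rw [classT, ← h1, invHom_apply hb]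
  exact res_restrict _ _ _ _

theorem bijective_tubeThom {u : HAbs 2 (univ : Set (CPSum m n))}
    (hu : AddSubgroup.zmultiples u = ⊤) {A : Set (CP m)} {T : Set (CPSum m n)}
    (hT : IsTubularNbhd A n T) (j : ℕ) : Bijective (tubeThom hT (classT A n u) j) := by
  obtain ⟨U, hU, hU', hUT⟩ := hT.nhds
  have hT1 := isTubularNbhd_tube A hU hU'
  have hT0 := isTubularNbhd_tube (n := n) A isOpen_univ (subset_univ _)
  -- `T` need not be comparable with the largest tube, but both contain the tube built from an open
  -- `U` whose trace on the join lies in `T`.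
  rw [bijective_tubeThom_iff hT hT1 (tube_subset.trans hUT),
    ← bijective_tubeThom_iff hT0 hT1 (tube_mono A U)]
  set u' : H 2 (CPSum m n) ∅ := pullback 2 ((Homeomorph.Set.univ (CPSum m n)).symm :
        C(CPSum m n, (univ : Set (CPSum m n)))) (mapsTo_empty _ _) u with hu'
  have hu'' : AddSubgroup.zmultiples u' = ⊤ :=
    zmultiples_map_eq_top (bijective_homeomorph (Homeomorph.Set.univ (CPSum m n)).symm 2).2 hu
  obtain ⟨τ, hτ, h⟩ := exists_lift_cupPow u'
  let y : HPair (2 * (n + 1)) (joinCP A n) (tube A univ) :=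
    restrict (2 * (n + 1)) (joinCP A n) (fun _ hx => hx.1) (H.mk (2 * (n + 1)) _ ⟨τ, hτ⟩)
  have hy : resTube hT0 (2 * (n + 1)) y = classT A n u := by
    rw [classT_eq hτ h]
    exact res_restrict _ _ _ _
  rw [tubeThom, ← hy, invHom_apply (bijective_resTube hT0 _)]
  exact (isThom_projA hu'' hτ h A).bijective
    (cochainMap_mem_relCocycles (mapsTo_joinBundleIncl A) hτ) j

/-- After the Thom isomorphism, only the identifications with the cohomology of `(A * ℂP^n, ℂP^n)`
and the map to absolute cohomology remain. The latter is bijective since all degrees here are at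
least `2n+2`. -/
theorem bijective_fA {u : HAbs 2 (univ : Set (CPSum m n))}
    (hu : AddSubgroup.zmultiples u = ⊤) {A : Set (CP m)} {T : Set (CPSum m n)}
    (hT : IsTubularNbhd A n T) (j : ℕ) : Bijective (fA hT u j) :=
  (bijective_toAbs (CPn_subset_joinCP A) (by omega)).comp ((bijective_resTube hT _).comp
    ((bijective_invHom (bijective_resExc hT _)).comp (bijective_tubeThom hu hT j)))

end ProjJoin

end

/-! ### The theorem -/

open SingCoh ProjJoin in
theorem mainTheorem8 (m n : ℕ) (A : Set (CP m)) :
    (∀ k : ℕ, k ≤ 2 * n + 1 →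
      Function.Bijective
        (resAbs k (CPn_subset_joinCP A) : HAbs k (joinCP A n) →+ HAbs k (CPn m n))) ∧
    Function.Bijective
      (toAbs (2 * (n + 1)) Set.univ (CPn m n) :
        HPair (2 * (n + 1)) Set.univ (CPn m n) →+ HAbs (2 * (n + 1)) Set.univ) ∧
    (∃ T : Set (CPSum m n), IsTubularNbhd A n T) ∧
    ∀ (T : Set (CPSum m n)) (hT : IsTubularNbhd A n T),
      (∀ q : ℕ, Function.Bijective (resTube hT q)) ∧
      (∀ q : ℕ, Function.Bijective (resExc hT q)) ∧
      ∀ u : HAbs 2 (Set.univ : Set (CPSum m n)), AddSubgroup.zmultiples u = ⊤ →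
        ∀ j : ℕ, Function.Bijective
          (fA hT u j : HAbs j A →+ HAbs (j + 2 * (n + 1)) (joinCP A n)) :=
  ⟨fun _ hk => bijective_resAbs A hk, bijective_toAbs (Set.subset_univ _) (by omega),
    ⟨_, isTubularNbhd_tube A isOpen_univ (Set.subset_univ _)⟩, fun _ hT =>
      ⟨bijective_resTube hT, bijective_resExc hT, fun _ hu j => bijective_fA hu hT j⟩⟩
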